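/- Let $G=(V,E)$ be a finite directed graph with $n$ nodes and edge weights $w:E\to[0,\infty)$, and write $w(E)=\sum_{e\in E}w(e)$. For $s,t\in V$ let $\mathrm{dist}_w(s,t)$ be the minimum total weight of a directed $s\leadsto t$ path ($\infty$ if there is none); a set $X\subseteq E$ cuts $(s,t)$ if every directed $s\leadsto t$ path contains an edge of $X$. For $\Delta>0$, a weak (one-way) low-diameter decomposition of $(G,w)$ with parameter $\Delta$ and loss $\mathrm{LOSS}$ is a random set $X\subseteq E$ such that 1. every outcome of $X$ cuts every pair $(s,t)$ with $\mathrm{dist}_w(s,t)\ge\Delta$, and 2. for every $e\in E$, $\Pr[e\in X]\le \frac{w(e)}{\Delta}\cdot\mathrm{LOSS}$. Corollary (weak LDD). There is a function $\varepsilon:\mathbb N\to\mathbb R$ with $\varepsilon(n)\to0$ as $n\to\infty$ such that every finite directed graph $G=(V,E)$ with $n$ nodes and any edge weights $w\ge0$ has, for every $\Delta>0$, a weak low-diameter decomposition with parameter $\Delta$ and $$\mathrm{LOSS}\le\min\left\{\,n^{1/3+\varepsilon(n)},\; W^{1/2}\cdot n^{\varepsilon(n)}\right\},\qquad W:=\frac{w(E)}{\Delta}.$$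 -/

import Mathlib

open scoped NNReal ENNReal Topology

/-- Directed walks from one node to another in a digraph, edge by edge. -/
inductive Digraph.DiWalk {V : Type*} (G : Digraph V) : V → V → Type _
  | nil (u : V) : Digraph.DiWalk G u u
  | cons {u v t : V} (h : G.Adj u v) (p : Digraph.DiWalk G v t) : Digraph.DiWalk G u t

/-- The list of (directed) edges traversed by a walk. -/
def Digraph.DiWalk.edges {V : Type*} {G : Digraph V} :
    {s t : V} → Digraph.DiWalk G s t → List (V × V)
  | _, _, .nil _ => []
  | _, _, @Digraph.DiWalk.cons _ _ u v _ _ p => (u, v) :: p.edges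

/-- The length of a walk under the edge weights `w`. -/
def Digraph.DiWalk.weight {V : Type*} {G : Digraph V} (w : V × V → ℝ≥0) {s t : V}
    (p : Digraph.DiWalk G s t) : ℝ≥0 :=
  (p.edges.map w).sum

/-- The weighted distance from `s` to `t`; it is `∞` if `t` cannot be reached from `s`. -/
noncomputable def Digraph.wdist {V : Type*} (G : Digraph V) (w : V × V → ℝ≥0) (s t : V) : ℝ≥0∞ :=
  ⨅ p : Digraph.DiWalk G s t, (p.weight w : ℝ≥0∞)

/-- The edge set of a digraph. -/
def Digraph.edges {V : Type*} (G : Digraph V) : Set (V × V) :=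
  {e | G.Adj e.1 e.2}

open Classical in
/-- The total weight `w(E)` of all edges. -/
noncomputable def Digraph.totalWeight {V : Type*} [Fintype V] (G : Digraph V)
    (w : V × V → ℝ≥0) : ℝ≥0 :=
  ∑ e ∈ Finset.univ.filter (fun e => e ∈ G.edges), w e

/-- The pair `(s, t)` is cut by `X`: every `s`-to-`t` walk uses an edge of `X`. -/
def Digraph.IsCutBy {V : Type*} (G : Digraph V) (X : Set (V × V)) (s t : V) : Prop :=
  ∀ p : Digraph.DiWalk G s t, ∃ e ∈ p.edges, e ∈ X

/-- The random edge set with law `μ` is the output of a weak (one-way) low-diameter decomposition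
of the weighted digraph `(G, w)` with parameter `Δ` and loss at most `loss`. -/
structure Digraph.IsWeakLDD {V : Type*} (G : Digraph V) (w : V × V → ℝ≥0) (Δ : ℝ≥0)
    (μ : PMF (Set (V × V))) (loss : ℝ) : Prop where
  /-- Every possible outcome is a set of edges of `G`. -/
  subset_edges : ∀ X ∈ μ.support, X ⊆ G.edges
  /-- Every possible outcome cuts all pairs at distance at least `Δ`. -/
  cuts : ∀ X ∈ μ.support, ∀ s t : V, (Δ : ℝ≥0∞) ≤ G.wdist w s t → G.IsCutBy X s t
  /-- Each edge `e` belongs to the random set with probability at most `(w(e) / Δ) * loss`. -/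
  prob_le : ∀ e ∈ G.edges,
    (μ.toOuterMeasure {X | e ∈ X}).toReal ≤ (w e : ℝ) / (Δ : ℝ) * loss

/-! By minimax, the required random cut exists as soon as, for every edge cost c ≥ 0, a single set
that cuts all pairs at distance at least Δ costs at most (ℓ/Δ)·∑ c(e)w(e) (`HasCut`,
`HasCut.exists_pmf`). Take the length unit Δ/(4Λ^(K+1)), with K fixed and Λ a small power of n or of
W, and delete outright all edges longer than one unit. It then suffices to double every distance of
at least 4Λ^(K+1), about log n times: a simple path with edges of length at most 1 is shorter than
n, so far pairs end up unreachable (`exists_cut`).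

One doubling phase (`exists_phase`) first passes to a subgraph F in which mutually reachable
vertices are at distance at most 1 in the original graph E (`exists_scc_ldd`), so a path of F never
comes back near a vertex it has left far behind. The phase then destroys every F-path of length at
most 8Λ^(K+1) whose ends are at E-distance at least Λ^(K+1). Its tool is region growing around the
members of a list, in order, at radius about Λ^j (`exists_carve`): up to logarithms this costs ∑ c w
/ Λ^j. It separates x from u when u is near some member y while x is far from y and from all earlier
members (`KillPair`). Greedy set cover reduces the phase to a weighted family of such operations
that hits each path sufficiently often (`Dichotomy.exists_operations`).

That family comes from `Dichotomy`: for every weighting of paths at scale Λ^k inside a vertex set of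
volume v, either one chain of length at most Λ^k meets a fraction αΛ^(2k)/v of them, or one list
kills a fraction q/Λ^j of their windows at some lower scale j. At the top scale with v ≤ Λ^(3K) the
chain meets a fraction α/Λ^K, which balances its price 1/Λ^K. Unit vertex volumes give v = n, hence
loss about Λ^K = n^(1/3). Taking the outgoing weight as volume gives v = 4WΛ^(K+1), hence Λ^(2K-1) ≈
4W and loss about W^(1/2).

The dichotomy is proved by induction on k (`Dichotomy.succ`). A path of level k+1 splits into about
Λ/2 windows of level k. Suppose both alternatives fail at level k+1. Let f_n(v) be the best expected
claim minus travel tax of a strategy that starts at v and strings together at most n random blocks.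
As no short chain meets more than τ of the paths, f_n ≤ 4τ (`Plan.value_le`). The function f_n is
one-sidedly Lipschitz, so it is almost constant around most windows (`Lvl.many_flat`). Slice the
vertices into rows by rounding f_n and apply level k inside each row. Random blocks that meet the
windows either seldom pass near the sources of the windows, and then a sequence of them kills many
windows, which is excluded; or they often do, and entering a block near the source is a new first
move (`row_kill_or_move`). Such a move gains about h and stays in its row, so f_(n+1) exceeds f_n by
h/2 at a constant fraction of sources (`Dichotomy.value_increase`). After Λ rounds the bound 4τ is
violated. -/

/-! ### Minimax and sequences of random blocks -/

/-- A finite zero-sum game in which every mixed strategy of the column player admits a reply of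
payoff at least `1` has a finite mixture of replies with payoff above `1 / 2` in each column. -/
theorem exists_mixture_of_forall_reply {ι : Type*} [Fintype ι] {α : Type*} [Nonempty α]
    (pay : α → ι → ℝ)
    (h : ∀ p : ι → ℝ, (∀ i, 0 ≤ p i) → ∑ i, p i = 1 → ∃ a, 1 ≤ ∑ i, p i * pay a i) :
    ∃ (κ : Type) (_ : Fintype κ) (wt : κ → ℝ) (z : κ → α),
      (∀ k, 0 ≤ wt k) ∧ ∑ k, wt k = 1 ∧ ∀ i, 1 / 2 < ∑ k, wt k * pay (z k) i := by
  classical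
  -- Otherwise a functional separates the hull of the payoff vectors from the open orthant above
  -- 1/2. Its negated coefficients `c` are nonnegative, because the orthant is unbounded upwards.
  -- Normalised, they form a column strategy against which every reply pays less than the all-ones
  -- vector, that is, less than 1.
  have key : ∃ b ∈ convexHull ℝ (Set.range pay), ∀ i, 1 / 2 < b i := by
    by_contra hcon
    push Not at hcon
    set U : Set (ι → ℝ) := {b | ∀ i, 1 / 2 < b i} with hU
    have hUo : IsOpen U := by
      have : U = Set.pi Set.univ (fun _ => Set.Ioi (1 / 2 : ℝ)) := by
        ext b; simp [hU]
      rw [this]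
      exact isOpen_set_pi Set.finite_univ (fun _ _ => isOpen_Ioi)
    have hUc : Convex ℝ U := by
      have : U = Set.pi Set.univ (fun _ => Set.Ioi (1 / 2 : ℝ)) := by
        ext b; simp [hU]
      rw [this]
      exact convex_pi (fun _ _ => convex_Ioi _)
    have hdisj : Disjoint U (convexHull ℝ (Set.range pay)) := by
      rw [Set.disjoint_left]
      intro b hb hb2
      obtain ⟨i, hi⟩ := hcon b hb2
      exact absurd (hb i) (not_lt.2 hi)
    obtain ⟨f, u, hf1, hf2⟩ := geometric_hahn_banach_open hUc hUo (convex_convexHull ℝ _) hdisj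
    set c : ι → ℝ := fun i => - f (Pi.single i 1) with hc
    have hfe : ∀ b : ι → ℝ, f b = - ∑ i, c i * b i := by
      intro b
      have : b = ∑ i, b i • (Pi.single i (1 : ℝ) : ι → ℝ) := by
        ext j; simp [Finset.sum_apply, Pi.single_apply]
      conv_lhs => rw [this]
      simp only [map_sum, map_smul, smul_eq_mul, hc]
      rw [← Finset.sum_neg_distrib]
      exact Finset.sum_congr rfl (fun i _ => by ring)
    have hone : (fun _ => (1 : ℝ)) ∈ U := by
      intro i; norm_num
    have hcn : ∀ i, 0 ≤ c i := by
      intro i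
      by_contra hneg
      push Not at hneg
      have hmem : ∀ t : ℝ, 0 ≤ t → (fun j => 1 + t * (Pi.single i (1 : ℝ) : ι → ℝ) j) ∈ U := by
        intro t ht j
        by_cases hj : j = i
        · subst hj; simp; linarith
        · simp [hj]; norm_num
      have hval : ∀ t : ℝ, 0 ≤ t → - ∑ j, c j - t * c i < u := by
        intro t ht
        have := hf1 _ (hmem t ht)
        rw [hfe] at this
        have e : ∑ j, c j * (1 + t * (Pi.single i (1 : ℝ) : ι → ℝ) j) = ∑ j, c j + t * c i := by
          simp only [mul_add, mul_one, Finset.sum_add_distrib]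
          congr 1
          rw [Finset.sum_eq_single i]
          · simp; ring
          · intro j _ hj; simp [hj]
          · simp
        rw [e] at this
        linarith
      have ht0 : 0 ≤ (|u + ∑ j, c j|) / (- c i) := div_nonneg (abs_nonneg _) (by linarith)
      have := hval _ ht0
      have e : |u + ∑ j, c j| / (- c i) * c i = - |u + ∑ j, c j| := by
        field_simp [hneg.ne]
      rw [e] at this
      have := le_abs_self (u + ∑ j, c j)
      linarith
    obtain ⟨a0⟩ := ‹Nonempty α›
    have h1 := hf1 _ hone
    have h2 := hf2 _ (subset_convexHull ℝ _ ⟨a0, rfl⟩)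
    have hpos : 0 < ∑ i, c i := by
      rcases (Finset.sum_nonneg (fun i (_ : i ∈ Finset.univ) => hcn i)).lt_or_eq with h | h
      · exact h
      · exfalso
        have hz : ∀ i, c i = 0 := fun i =>
          (Finset.sum_eq_zero_iff_of_nonneg (fun i _ => hcn i)).1 h.symm i (Finset.mem_univ i)
        rw [hfe] at h1 h2
        simp only [hz, zero_mul, Finset.sum_const_zero, neg_zero] at h1 h2
        linarith
    obtain ⟨a, ha⟩ := h (fun i => c i / ∑ j, c j) (fun i => div_nonneg (hcn i) hpos.le)
      (by rw [← Finset.sum_div]; exact div_self hpos.ne')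
    have h3 := hf2 _ (subset_convexHull ℝ _ ⟨a, rfl⟩)
    rw [hfe] at h1 h3
    have e : ∑ i, c i / (∑ j, c j) * pay a i = (∑ i, c i * pay a i) / ∑ j, c j := by
      rw [Finset.sum_div]; exact Finset.sum_congr rfl (fun i _ => by ring)
    rw [e, le_div_iff₀ hpos] at ha
    simp only [mul_one] at h1
    linarith
  obtain ⟨b, hb, hb2⟩ := key
  rw [mem_convexHull_iff_exists_fintype] at hb
  obtain ⟨κ, hκ, wt, z, hw, hs, hz, hx⟩ := hb
  choose a ha using hz
  refine ⟨κ, hκ, wt, a, hw, hs, fun i => ?_⟩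
  have := hb2 i
  rw [← hx] at this
  simpa [Finset.sum_apply, ha] using this

/-- If a weighted average with total weight one is at least `y`, some value is at least `y`. -/
theorem exists_le_of_le_weighted_sum {κ : Type*} [Fintype κ] (β X : κ → ℝ) (x y : ℝ)
    (hβ : ∀ k, 0 ≤ β k) (hβ1 : ∑ k, β k ≤ 1)
    (h : y ≤ ∑ k, β k * X k + (1 - ∑ k, β k) * x) : y ≤ x ∨ ∃ k, y ≤ X k := by
  by_contra hcon
  push Not at hcon
  obtain ⟨h1, h2⟩ := hcon
  have h3 : ∑ k, β k * X k ≤ ∑ k, β k * y :=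
    Finset.sum_le_sum (fun k _ => mul_le_mul_of_nonneg_left (h2 k).le (hβ k))
  rcases hβ1.lt_or_eq with h4 | h4
  · have : (1 - ∑ k, β k) * x < (1 - ∑ k, β k) * y := mul_lt_mul_of_pos_left h1 (by linarith)
    rw [← Finset.sum_mul] at h3
    nlinarith
  · have : ∃ k ∈ Finset.univ, β k ≠ 0 := by
      apply Finset.exists_ne_zero_of_sum_ne_zero
      rw [h4]; norm_num
    obtain ⟨k, -, hk⟩ := this
    have h5 : ∑ k, β k * X k < ∑ k, β k * y :=
      Finset.sum_lt_sum (fun k _ => mul_le_mul_of_nonneg_left (h2 k).le (hβ k))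
        ⟨k, Finset.mem_univ k, mul_lt_mul_of_pos_left (h2 k) (lt_of_le_of_ne (hβ k) hk.symm)⟩
    rw [← Finset.sum_mul, h4] at h5
    rw [h4] at h
    linarith

open Classical in
/-- A sequence of `N` blocks in which many targets are first met by a favourable block. -/
theorem exists_block_sequence {κ Ω : Type*} [Fintype κ] [Fintype Ω] (β : κ → ℝ)
    (hβ : ∀ k, 0 ≤ β k) (hβ1 : ∑ k, β k ≤ 1) (O K : Ω → κ → Prop) (N : ℕ) :
    ∀ m : Ω → ℝ, (∀ ω, 0 ≤ m ω) → ∃ S : List κ,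
      ∑ ω, m ω * (N * (∑ k, if O ω k then β k else 0) /
          (1 + N * ((∑ k, if O ω k then β k else 0) + ∑ k, if K ω k then β k else 0))) ≤
        ∑ ω, m ω * (if ∃ S₁ b S₂, S = S₁ ++ b :: S₂ ∧ O ω b ∧ ∀ b' ∈ S₁, ¬ K ω b' then 1 else 0) := by
  set o : Ω → ℝ := fun ω => ∑ k, if O ω k then β k else 0 with ho
  set q : Ω → ℝ := fun ω => ∑ k, if K ω k then β k else 0 with hq
  have ho0 : ∀ ω, 0 ≤ o ω := fun ω => Finset.sum_nonneg (fun k _ => by split_ifs <;> simp [hβ])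
  have hq0 : ∀ ω, 0 ≤ q ω := fun ω => Finset.sum_nonneg (fun k _ => by split_ifs <;> simp [hβ])
  induction N with
  | zero =>
    intro m hm
    refine ⟨[], ?_⟩
    simp
  | succ N ih =>
    intro m hm
    set f : Ω → ℝ := fun ω => N * o ω / (1 + N * (o ω + q ω)) with hf
    have hden : ∀ ω, 0 < 1 + (N : ℝ) * (o ω + q ω) := fun ω => by
      have := mul_nonneg (Nat.cast_nonneg (α := ℝ) N) (add_nonneg (ho0 ω) (hq0 ω)); linarith
    have hf0 : ∀ ω, 0 ≤ f ω := fun ω =>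
      div_nonneg (mul_nonneg (Nat.cast_nonneg N) (ho0 ω)) (hden ω).le
    have hf1 : ∀ ω, f ω ≤ 1 := fun ω => by
      rw [hf]; dsimp only
      rw [div_le_one (hden ω)]
      have := mul_nonneg (Nat.cast_nonneg (α := ℝ) N) (hq0 ω); linarith
    -- `X k` is the value guaranteed when the first block is `k`: favourable targets are won,
    -- spoiled ones are lost, undecided ones keep the bound `f` for `N` blocks. The missing
    -- probability `1 - ∑ β` stands for playing no block.
    set X : κ → ℝ := fun k => ∑ ω, m ω * (if O ω k then 1 else if K ω k then 0 else f ω) with hX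
    have hstep : ∑ ω, m ω * ((N + 1 : ℕ) * o ω / (1 + (N + 1 : ℕ) * (o ω + q ω))) ≤
        ∑ k, β k * X k + (1 - ∑ k, β k) * ∑ ω, m ω * f ω := by
      have e : ∑ k, β k * X k + (1 - ∑ k, β k) * ∑ ω, m ω * f ω =
          ∑ ω, m ω * (∑ k, β k * (if O ω k then 1 else if K ω k then 0 else f ω) +
            (1 - ∑ k, β k) * f ω) := by
        simp only [hX, Finset.mul_sum, mul_add, Finset.sum_add_distrib]
        congr 1
        · rw [Finset.sum_comm]
          refine Finset.sum_congr rfl (fun ω _ => Finset.sum_congr rfl (fun k _ => by ring))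
        · exact Finset.sum_congr rfl (fun ω _ => by ring)
      rw [e]
      refine Finset.sum_le_sum (fun ω _ => mul_le_mul_of_nonneg_left ?_ (hm ω))
      have h1 : ∀ k, β k * f ω + (if O ω k then β k else 0) * (1 - f ω)
          - (if K ω k then β k else 0) * f ω ≤
          β k * (if O ω k then 1 else if K ω k then 0 else f ω) := by
        intro k
        have := mul_nonneg (hβ k) (hf0 ω)
        split_ifs <;> nlinarith
      have h2 := Finset.sum_le_sum (fun k (_ : k ∈ Finset.univ) => h1 k)
      rw [Finset.sum_sub_distrib, Finset.sum_add_distrib, ← Finset.sum_mul, ← Finset.sum_mul,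
        ← Finset.sum_mul] at h2
      -- One random block turns `f` into `f + o (1 - f) - q f`, which equals (N+1)o / (1 + N(o+q));
      -- this exceeds the required bound.
      have h3 : ((N + 1 : ℕ) : ℝ) * o ω / (1 + (N + 1 : ℕ) * (o ω + q ω)) ≤
          f ω + o ω * (1 - f ω) - q ω * f ω := by
        have e2 : f ω + o ω * (1 - f ω) - q ω * f ω = (N + 1) * o ω / (1 + N * (o ω + q ω)) := by
          have := hden ω
          simp only [hf]
          field_simp
          ring
        rw [e2]
        push_cast
        apply div_le_div_of_nonneg_left _ (hden ω)
        · have := ho0 ω; have := hq0 ω; nlinarith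
        · have := ho0 ω; positivity
      linarith
    rcases exists_le_of_le_weighted_sum β X _ _ hβ hβ1 hstep with h | ⟨k, h⟩
    · obtain ⟨S, hS⟩ := ih m hm
      exact ⟨S, h.trans hS⟩
    -- The targets already decided by `k` are removed before the rest of the sequence is chosen.
    · obtain ⟨S, hS⟩ := ih (fun ω => if O ω k ∨ K ω k then 0 else m ω)
        (fun ω => by split_ifs <;> simp [hm])
      refine ⟨k :: S, h.trans ?_⟩
      have e : X k = ∑ ω, m ω * (if O ω k then 1 else 0) +
          ∑ ω, (if O ω k ∨ K ω k then 0 else m ω) * f ω := by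
        simp only [hX]
        rw [← Finset.sum_add_distrib]
        refine Finset.sum_congr rfl (fun ω _ => ?_)
        by_cases h1 : O ω k <;> by_cases h2 : K ω k <;> simp [h1, h2]
      rw [e]
      refine (add_le_add_right hS _).trans ?_
      rw [← Finset.sum_add_distrib]
      refine Finset.sum_le_sum (fun ω _ => ?_)
      by_cases h1 : O ω k
      · have : ∃ S₁ b S₂, k :: S = S₁ ++ b :: S₂ ∧ O ω b ∧ ∀ b' ∈ S₁, ¬ K ω b' :=
          ⟨[], k, S, rfl, h1, by simp⟩
        rw [if_pos this]
        simp [h1]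
      · by_cases h2 : K ω k
        · simp only [h1, h2, or_true, if_true, if_false, mul_zero, zero_mul, add_zero]
          exact mul_nonneg (hm ω) (by split_ifs <;> simp)
        · simp only [h1, h2, or_self, if_false, mul_zero, zero_add]
          refine mul_le_mul_of_nonneg_left ?_ (hm ω)
          by_cases h3 : ∃ S₁ b S₂, S = S₁ ++ b :: S₂ ∧ O ω b ∧ ∀ b' ∈ S₁, ¬ K ω b'
          · obtain ⟨S₁, b, S₂, rfl, hb, hS1⟩ := h3
            have h5 : ∃ S₁' b' S₂', k :: (S₁ ++ b :: S₂) = S₁' ++ b' :: S₂' ∧ O ω b' ∧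
                ∀ b'' ∈ S₁', ¬ K ω b'' := by
              refine ⟨k :: S₁, b, S₂, by simp, hb, fun b' hb' => ?_⟩
              rcases List.mem_cons.1 hb' with rfl | h4
              · exact h2
              · exact hS1 _ h4
            rw [if_pos h5]
            split_ifs <;> simp
          · rw [if_neg h3]
            split_ifs <;> simp

/-! ### Lengths of chains and rounding of the line -/

/-- The length of a list of points with respect to `d`. -/
def chainLen {V : Type*} (d : V → V → ℝ) : List V → ℝ
  | [] => 0
  | [_] => 0
  | a :: b :: l => d a b + chainLen d (b :: l)

section chainLen
variable {V : Type*} {d : V → V → ℝ}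

theorem chainLen_nonneg (hd : ∀ x y, 0 ≤ d x y) : ∀ L : List V, 0 ≤ chainLen d L
  | [] => le_rfl
  | [_] => le_rfl
  | a :: b :: l => add_nonneg (hd a b) (chainLen_nonneg hd (b :: l))

theorem chainLen_append_cons (L₁ : List V) (y : V) (L₂ : List V) :
    chainLen d (L₁ ++ y :: L₂) = chainLen d (L₁ ++ [y]) + chainLen d (y :: L₂) := by
  induction L₁ with
  | nil => simp [chainLen]
  | cons a l ih =>
    cases l with
    | nil => simp [chainLen]
    | cons b l => simp only [List.cons_append, chainLen] at ih ⊢; linarith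

theorem chainLen_append (L₁ L₂ : List V) (h₁ : L₁ ≠ []) (h₂ : L₂ ≠ []) :
    chainLen d (L₁ ++ L₂) =
      chainLen d L₁ + d (L₁.getLast h₁) (L₂.head h₂) + chainLen d L₂ := by
  induction L₁ with
  | nil => exact absurd rfl h₁
  | cons a l ih =>
    cases l with
    | nil =>
      cases L₂ with
      | nil => exact absurd rfl h₂
      | cons b l₂ => simp [chainLen]
    | cons b l =>
      have := ih (by simp)
      simp only [List.cons_append, chainLen] at this ⊢
      rw [List.getLast_cons (by simp)]
      linarith

theorem chainLen_le_of_append (hd : ∀ x y, 0 ≤ d x y) (L₁ L₂ : List V) :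
    chainLen d L₁ ≤ chainLen d (L₁ ++ L₂) ∧ chainLen d L₂ ≤ chainLen d (L₁ ++ L₂) := by
  by_cases h₁ : L₁ = []
  · subst h₁; simp [chainLen, chainLen_nonneg hd]
  by_cases h₂ : L₂ = []
  · subst h₂; simp [chainLen, chainLen_nonneg hd]
  rw [chainLen_append L₁ L₂ h₁ h₂]
  have := hd (L₁.getLast h₁) (L₂.head h₂)
  have := chainLen_nonneg hd L₁
  have := chainLen_nonneg hd L₂
  constructor <;> linarith

theorem dist_le_chainLen (hd : ∀ x y, 0 ≤ d x y) (h0 : ∀ x, d x x = 0)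
    (ht : ∀ x y z, d x z ≤ d x y + d y z) (L₁ L₂ : List V) (x y : V)
    (hx : x ∈ L₁) (hy : y ∈ L₂) : d x y ≤ chainLen d (L₁ ++ L₂) := by
  have head : ∀ (L : List V) (a y : V), y ∈ a :: L → d a y ≤ chainLen d (a :: L) := by
    intro L
    induction L with
    | nil => intro a y hy; simp at hy; subst hy; simp [chainLen, h0]
    | cons b l ih =>
      intro a y hy
      rcases List.mem_cons.1 hy with rfl | h
      · rw [h0]; exact chainLen_nonneg hd _
      · have := ih b y h
        have := ht a b y
        simp only [chainLen]; linarith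
  obtain ⟨A, B, rfl⟩ := List.append_of_mem hx
  have h1 : y ∈ x :: (B ++ L₂) := by simp [hy]
  have h2 := head _ _ _ h1
  have h3 := (chainLen_le_of_append hd A (x :: (B ++ L₂))).2
  simp only [List.append_assoc, List.cons_append] at h3 ⊢
  linarith

/-- The list is cut where its prefix length first exceeds `B`. The step into `y` is charged to the
first piece and the rest restarts at `y`, so each removed piece uses up more than `B` of the total
length. -/
theorem chainLen_split (B : ℝ) (hB : 0 ≤ B) (L : List V) :
    chainLen d L ≤ B ∨ ∃ L₁ y L₂, L = L₁ ++ y :: L₂ ∧ L₁ ≠ [] ∧ chainLen d L₁ ≤ B ∧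
      B < chainLen d (L₁ ++ [y]) := by
  induction L using List.reverseRecOn with
  | nil => left; simpa [chainLen] using hB
  | append_singleton L y ih =>
    rcases ih with h | ⟨L₁, z, L₂, rfl, h1, h2, h3⟩
    · by_cases h4 : chainLen d (L ++ [y]) ≤ B
      · exact Or.inl h4
      · right
        refine ⟨L, y, [], rfl, ?_, h, not_le.1 h4⟩
        rintro rfl
        simp [chainLen] at h4
        linarith
    · exact Or.inr ⟨L₁, z, L₂ ++ [y], by simp, h1, h2, h3⟩

/-- A subadditive functional that is at most `τ` on lists of length at most `B` is at most
`τ * (1 + len / B)` on every list. -/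
theorem subadditive_le_of_short (hd : ∀ x y, 0 ≤ d x y) (B τ : ℝ) (hB : 0 < B) (hτ : 0 ≤ τ)
    (T : List V → ℝ) (Θ : Set V) (hsub : ∀ L₁ L₂, T (L₁ ++ L₂) ≤ T L₁ + T L₂)
    (hT : ∀ L, (∀ v ∈ L, v ∈ Θ) → chainLen d L ≤ B → T L ≤ τ) :
    ∀ L, (∀ v ∈ L, v ∈ Θ) → T L ≤ τ * (1 + chainLen d L / B) := by
  have : ∀ n : ℕ, ∀ L : List V, L.length = n → (∀ v ∈ L, v ∈ Θ) →
      T L ≤ τ * (1 + chainLen d L / B) := by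
    intro n
    induction n using Nat.strong_induction_on with
    | _ n ih =>
      intro L hL hΘ
      rcases chainLen_split B hB.le L with h | ⟨L₁, y, L₂, rfl, h1, h2, h3⟩
      · have := hT L hΘ h
        have h5 : 0 ≤ τ * (chainLen d L / B) :=
          mul_nonneg hτ (div_nonneg (chainLen_nonneg hd L) hB.le)
        rw [mul_add, mul_one]; linarith
      · have hpos := List.length_pos_iff.2 h1
        have h4 := ih (y :: L₂).length (by simp at hL ⊢; omega) (y :: L₂) rfl
          (fun v hv => hΘ v (by simp only [List.mem_append]; exact Or.inr hv))
        have h5 := hT L₁ (fun v hv => hΘ v (by simp only [List.mem_append]; exact Or.inl hv)) h2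
        have h6 := hsub L₁ (y :: L₂)
        have h7 : B + chainLen d (y :: L₂) ≤ chainLen d (L₁ ++ y :: L₂) := by
          rw [chainLen_append_cons]; linarith
        have h8 : 1 + chainLen d (y :: L₂) / B ≤ chainLen d (L₁ ++ y :: L₂) / B := by
          rw [le_div_iff₀ hB, add_mul, div_mul_cancel₀ _ hB.ne']; linarith
        nlinarith [mul_le_mul_of_nonneg_left h8 hτ]
  exact fun L => this _ L rfl

end chainLen

/-- Among the two partitions of the line into intervals of length `ω`, offset by `ω / 2`, one has
`[x, x + ω / 2)` inside a single interval. -/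
theorem exists_shift_floor_eq (ω x : ℝ) (hω : 0 < ω) :
    (∀ y, x ≤ y → y < x + ω / 2 → ⌊y / ω⌋ = ⌊x / ω⌋) ∨
    (∀ y, x ≤ y → y < x + ω / 2 → ⌊(y + ω / 2) / ω⌋ = ⌊(x + ω / 2) / ω⌋) := by
  have h1 : ∀ t, (t + ω / 2) / ω = t / ω + 1 / 2 := fun t => by field_simp
  have hy : ∀ y, x ≤ y → y < x + ω / 2 → x / ω ≤ y / ω ∧ y / ω < x / ω + 1 / 2 := by
    intro y h2 h3
    refine ⟨by gcongr, ?_⟩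
    rw [← h1]; gcongr
  have hfl := Int.floor_le (x / ω)
  have hlt := Int.lt_floor_add_one (x / ω)
  by_cases h : x / ω < ⌊x / ω⌋ + 1 / 2
  · left
    intro y h2 h3
    obtain ⟨h4, h5⟩ := hy y h2 h3
    rw [Int.floor_eq_iff]
    constructor <;> linarith
  · right
    push Not at h
    intro y h2 h3
    obtain ⟨h4, h5⟩ := hy y h2 h3
    rw [h1, h1]
    have e : ⌊x / ω + 1 / 2⌋ = ⌊x / ω⌋ + 1 := by
      rw [Int.floor_eq_iff]; push_cast; constructor <;> linarith
    rw [e, Int.floor_eq_iff]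
    push_cast
    constructor <;> linarith

/-! ### Frames, windows of paths, kills and scores -/

/-- A stretch `p a, p (a + 1), …, p b` of a sequence of vertices. -/
structure Seg (V : Type*) where
  p : ℕ → V
  a : ℕ
  b : ℕ

namespace Seg
variable {V : Type*}

/-- The segment is a simple path along the relation `E`. -/
def IsPath (E : V → V → Prop) (s : Seg V) : Prop :=
  s.a ≤ s.b ∧ (∀ i, s.a ≤ i → i < s.b → E (s.p i) (s.p (i + 1))) ∧ Set.InjOn s.p (Set.Icc s.a s.b)

/-- The length of a segment under the weights `w`. -/
def len (w : V → V → ℝ) (s : Seg V) : ℝ := ∑ i ∈ Finset.Ico s.a s.b, w (s.p i) (s.p (i + 1))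

/-- The vertex `y` lies on the segment. -/
def Mem (s : Seg V) (y : V) : Prop := ∃ i, s.a ≤ i ∧ i ≤ s.b ∧ s.p i = y

/-- The list `C` meets the segment. -/
def Touch (s : Seg V) (C : List V) : Prop := ∃ y ∈ C, s.Mem y

theorem IsPath.sub {E : V → V → Prop} {s : Seg V} (h : s.IsPath E) {a b : ℕ} (h1 : s.a ≤ a)
    (h2 : a ≤ b) (h3 : b ≤ s.b) : (⟨s.p, a, b⟩ : Seg V).IsPath E :=
  ⟨h2, fun i hi hi2 => h.2.1 i (h1.trans hi) (lt_of_lt_of_le hi2 h3),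
    h.2.2.mono (Set.Icc_subset_Icc h1 h3)⟩

end Seg

/-- Two truncated quasi-metrics on the vertices of a weighted digraph: `df` measures how far apart
vertices are, `dn` how near, and a path never returns `dn`-near to a `df`-far past vertex. -/
structure Frame (V : Type*) where
  dn : V → V → ℝ
  df : V → V → ℝ
  w : V → V → ℝ
  vol : V → ℝ
  E : V → V → Prop
  H : ℝ
  Λ : ℕ
  A : ℕ → ℕ
  df_le_dn : ∀ x y, df x y ≤ dn x y
  df_nonneg : ∀ x y, 0 ≤ df x y
  dn_self : ∀ x, dn x x = 0
  df_tri : ∀ x y z, df x z ≤ df x y + df y z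
  dn_tri : ∀ x y z, dn x z ≤ dn x y + dn y z
  dn_le_w : ∀ x y, E x y → dn x y ≤ w x y
  w_nonneg : ∀ x y, 0 ≤ w x y
  w_le_one : ∀ x y, E x y → w x y ≤ 1
  w_le_vol : ∀ x y, E x y → w x y ≤ vol x
  vol_nonneg : ∀ x, 0 ≤ vol x
  -- A path together with a return makes its two ends mutually reachable in the subgraph, whose
  -- strongly connected components have been made small in the whole graph.
  back : ∀ s : Seg V, s.IsPath E → dn (s.p s.b) (s.p s.a) ≤ H → df (s.p s.a) (s.p s.b) ≤ 1
  one_le_Λ : 1 ≤ Λ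

namespace Frame
variable {V : Type*} (M : Frame V)

theorem dn_nonneg (x y : V) : 0 ≤ M.dn x y := (M.df_nonneg x y).trans (M.df_le_dn x y)

theorem df_self (x : V) : M.df x x = 0 :=
  le_antisymm ((M.df_le_dn x x).trans (M.dn_self x).le) (M.df_nonneg x x)

theorem one_le_pow (k : ℕ) : (1 : ℝ) ≤ (M.Λ : ℝ) ^ k :=
  one_le_pow₀ (by exact_mod_cast M.one_le_Λ)

theorem dn_le_sum {s : Seg V} (h : s.IsPath M.E) {i j : ℕ} (hi : s.a ≤ i) (hij : i ≤ j)
    (hj : j ≤ s.b) :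
    M.dn (s.p i) (s.p j) ≤ ∑ t ∈ Finset.Ico i j, M.w (s.p t) (s.p (t + 1)) := by
  induction j, hij using Nat.le_induction with
  | base => simp [M.dn_self]
  | succ j hij ih =>
    rw [Finset.sum_Ico_succ_top hij]
    have h1 := ih (by omega)
    have h2 := M.dn_tri (s.p i) (s.p j) (s.p (j + 1))
    have h3 := M.dn_le_w _ _ (h.2.1 j (by omega) (by omega))
    linarith

theorem dn_le_len {s : Seg V} (h : s.IsPath M.E) {i j : ℕ} (hi : s.a ≤ i) (hij : i ≤ j)
    (hj : j ≤ s.b) : M.dn (s.p i) (s.p j) ≤ s.len M.w :=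
  (M.dn_le_sum h hi hij hj).trans
    (Finset.sum_le_sum_of_subset_of_nonneg (Finset.Ico_subset_Ico hi hj)
      (fun _ _ _ => M.w_nonneg _ _))

/-- The first index after which the path stays at `df`-distance at least `2 * i * R` from its
start. -/
noncomputable def cut (R : ℝ) (s : Seg V) (i : ℕ) : ℕ :=
  sInf {n | s.a ≤ n ∧ ∀ j, n ≤ j → j ≤ s.b → 2 * i * R ≤ M.df (s.p s.a) (s.p j)}

/-- The `i`-th window of width `R` of a path. -/
noncomputable def win (R : ℝ) (s : Seg V) (i : ℕ) : Seg V := ⟨s.p, M.cut R s i, M.cut R s (i + 1)⟩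

variable {M} {R : ℝ} {s : Seg V}

theorem cut_spec (i : ℕ) : s.a ≤ M.cut R s i ∧
    ∀ j, M.cut R s i ≤ j → j ≤ s.b → 2 * i * R ≤ M.df (s.p s.a) (s.p j) := by
  have : (max s.a (s.b + 1)) ∈
      {n | s.a ≤ n ∧ ∀ j, n ≤ j → j ≤ s.b → 2 * i * R ≤ M.df (s.p s.a) (s.p j)} :=
    ⟨le_max_left _ _, fun j h1 h2 => by have := (le_max_right s.a (s.b + 1)).trans h1; omega⟩
  exact Nat.sInf_mem ⟨_, this⟩

theorem cut_mono (hR : 0 ≤ R) {i j : ℕ} (h : i ≤ j) : M.cut R s i ≤ M.cut R s j := by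
  refine Nat.sInf_le ⟨(cut_spec j).1, fun t h1 h2 => le_trans ?_ ((cut_spec j).2 t h1 h2)⟩
  have : (i : ℝ) ≤ j := by exact_mod_cast h
  nlinarith

theorem cut_le (hab : s.a ≤ s.b) {i : ℕ} (h : 2 * i * R ≤ M.df (s.p s.a) (s.p s.b)) :
    M.cut R s i ≤ s.b := by
  refine Nat.sInf_le ⟨hab, fun j h1 h2 => ?_⟩
  have : j = s.b := le_antisymm h2 h1
  rw [this]; exact h

/-- By minimality the vertex just before the cut is at distance less than 2iR from the start, and
one edge adds at most 1. -/
theorem df_cut_le (hR : 0 ≤ R) (hs : s.IsPath M.E) {i : ℕ} (h : M.cut R s i ≤ s.b) :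
    M.df (s.p s.a) (s.p (M.cut R s i)) ≤ 2 * i * R + 1 := by
  have hsp := cut_spec (M := M) (R := R) (s := s) i
  rcases hsp.1.lt_or_eq with h1 | h1
  · obtain ⟨n, hn⟩ : ∃ n, M.cut R s i = n + 1 := ⟨M.cut R s i - 1, by omega⟩
    have h2 : n ∉ {n | s.a ≤ n ∧ ∀ j, n ≤ j → j ≤ s.b → 2 * i * R ≤ M.df (s.p s.a) (s.p j)} := by
      apply Nat.notMem_of_lt_sInf
      change n < M.cut R s i
      omega
    have h3 : M.df (s.p s.a) (s.p n) < 2 * i * R := by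
      by_contra hcon
      push Not at hcon
      refine h2 ⟨by omega, fun j hj hj2 => ?_⟩
      rcases hj.lt_or_eq with h4 | h4
      · exact hsp.2 j (by omega) hj2
      · rw [← h4]; exact hcon
    have hE := hs.2.1 n (by omega) (by omega)
    have h4 := M.df_tri (s.p s.a) (s.p n) (s.p (n + 1))
    have h5 := (M.df_le_dn (s.p n) (s.p (n + 1))).trans (M.dn_le_w _ _ hE)
    have h6 := M.w_le_one _ _ hE
    rw [hn]; linarith
  · rw [← h1, M.df_self]; positivity

/-- Far ends and simple path: the conditions on a path that do not concern its length. -/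
def Far (M : Frame V) (R : ℝ) (s : Seg V) : Prop := s.IsPath M.E ∧ R ≤ M.df (s.p s.a) (s.p s.b)

theorem cut_le_of_far {k : ℕ} (h : M.Far (M.Λ ^ (k + 1)) s) {i : ℕ} (hi : i ≤ M.Λ / 2) :
    M.cut (M.Λ ^ k) s i ≤ s.b := by
  refine cut_le h.1.1 (le_trans ?_ h.2)
  have h1 : (2 * i : ℝ) ≤ M.Λ := by
    have : 2 * i ≤ M.Λ := by omega
    exact_mod_cast this
  rw [pow_succ']
  have := M.one_le_pow k
  exact mul_le_mul_of_nonneg_right h1 (by linarith)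

theorem far_df {k : ℕ} (h : M.Far (M.Λ ^ (k + 1)) s) {i i' j : ℕ} (hi : i ≤ i')
    (hi' : i' ≤ M.Λ / 2) (hj : M.cut (M.Λ ^ k) s i' ≤ j) (hjb : j ≤ s.b) :
    2 * ((i' : ℝ) - i) * M.Λ ^ k - 1 ≤ M.df (s.p (M.cut (M.Λ ^ k) s i)) (s.p j) := by
  have h1 := (cut_spec (M := M) (R := M.Λ ^ k) (s := s) i').2 j hj hjb
  have h2 := df_cut_le (by have := M.one_le_pow k; linarith) h.1
    (cut_le_of_far h (hi.trans hi'))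
  have h3 := M.df_tri (s.p s.a) (s.p (M.cut (M.Λ ^ k) s i)) (s.p j)
  nlinarith

/-- Consecutive cuts are 2R apart up to the error 1 of one edge, and 2R - 1 ≥ R; this is why cuts
are placed at multiples of 2R. -/
theorem win_far {k : ℕ} (h : M.Far (M.Λ ^ (k + 1)) s) {i : ℕ} (hi : i < M.Λ / 2) :
    M.Far (M.Λ ^ k) (M.win (M.Λ ^ k) s i) := by
  have hR := M.one_le_pow k
  refine ⟨h.1.sub (cut_spec _).1 (cut_mono (by linarith) (Nat.le_succ i))
    (cut_le_of_far h hi), ?_⟩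
  have := far_df h (Nat.le_succ i) hi le_rfl (cut_le_of_far h hi)
  simp only [win]
  push_cast at this
  linarith

theorem sum_blocks (c : ℕ → ℕ) (hc : Monotone c) (f : ℕ → ℝ) {m n : ℕ} (hmn : m ≤ n) :
    ∑ i ∈ Finset.Ico m n, ∑ j ∈ Finset.Ico (c i) (c (i + 1)), f j =
      ∑ j ∈ Finset.Ico (c m) (c n), f j := by
  induction n, hmn using Nat.le_induction with
  | base => simp
  | succ n hmn ih =>
    rw [Finset.sum_Ico_succ_top hmn, ih,
      Finset.sum_Ico_consecutive _ (hc hmn) (hc (Nat.le_succ n))]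

theorem sum_len_win_le {k : ℕ} (h : M.Far (M.Λ ^ (k + 1)) s) :
    ∑ i ∈ Finset.Ico 0 (M.Λ / 2), (M.win (M.Λ ^ k) s i).len M.w ≤ s.len M.w := by
  have hR := M.one_le_pow k
  simp only [Seg.len, win]
  rw [sum_blocks (M.cut (M.Λ ^ k) s) (fun i j hij => cut_mono (by linarith) hij)
    (fun j => M.w (s.p j) (s.p (j + 1))) (Nat.zero_le _)]
  exact Finset.sum_le_sum_of_subset_of_nonneg
    (Finset.Ico_subset_Ico (cut_spec _).1 (cut_le_of_far h le_rfl)) (fun _ _ _ => M.w_nonneg _ _)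

/-- Lag between the start of a kill window and the window itself. -/
def lag (M : Frame V) (k : ℕ) : ℕ := M.A k + 2

/-- The ball radius used at level `k`. -/
def rad (M : Frame V) (k : ℕ) : ℝ := 2 * M.A k * M.Λ ^ k

/-- The sequence `S` has an element on `Y` none of whose predecessors, nor itself, is within `ρ`
of `x`. -/
def Kill (M : Frame V) (ρ : ℝ) (S : List V) (x : V) (Y : Seg V) : Prop :=
  ∃ S₁ y S₂, S = S₁ ++ y :: S₂ ∧ Y.Mem y ∧ ∀ c ∈ S₁ ++ [y], ρ < M.dn x c

theorem Kill.append {ρ : ℝ} {S : List V} {x : V} {Y : Seg V} (h : M.Kill ρ S x Y) (S₀ S₃ : List V)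
    (h0 : ∀ c ∈ S₀, ρ < M.dn x c) : M.Kill ρ (S₀ ++ S ++ S₃) x Y := by
  obtain ⟨S₁, y, S₂, rfl, hy, hc⟩ := h
  refine ⟨S₀ ++ S₁, y, S₂ ++ S₃, by simp, hy, fun c hc' => ?_⟩
  simp only [List.append_assoc, List.mem_append] at hc' hc
  rcases hc' with h1 | h1 | h1
  · exact h0 c h1
  · exact hc c (Or.inl h1)
  · exact hc c (Or.inr h1)

/-- The starting vertex of the kill window number `i`. -/
noncomputable def src (M : Frame V) (k : ℕ) (s : Seg V) (i : ℕ) : V :=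
  s.p (M.cut (M.Λ ^ k) s (i - M.lag k))

open Classical in
/-- The fraction of the level-`j` windows of a level-`k` path killed by the sequence `S`. -/
noncomputable def score (M : Frame V) : ℕ → ℕ → List V → Seg V → ℝ
  | 0, _, _, _ => 0
  | k + 1, j, S, s => 1 / (M.Λ : ℝ) * ∑ i ∈ Finset.Ico (M.lag k) (M.Λ / 2),
      if j = k then
        (if (M.win (M.Λ ^ k) s i).len M.w ≤ M.A k * M.Λ ^ k ∧
            M.Kill (M.rad k) S (M.src k s i) (M.win (M.Λ ^ k) s i) then 1 else 0)
      else score M k j S (M.win (M.Λ ^ k) s i)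

theorem score_nonneg (k j : ℕ) (S : List V) (s : Seg V) : 0 ≤ M.score k j S s := by
  induction k generalizing s with
  | zero => simp [score]
  | succ k ih =>
    rw [score]
    refine mul_nonneg (by positivity) (Finset.sum_nonneg (fun i _ => ?_))
    split_ifs
    · exact zero_le_one
    · exact le_rfl
    · exact ih _

theorem score_nil (k j : ℕ) (s : Seg V) : M.score k j [] s = 0 := by
  induction k generalizing s with
  | zero => simp [score]
  | succ k ih =>
    rw [score]
    have : ∀ x Y, ¬ M.Kill (M.rad k) [] x Y := by
      rintro x Y ⟨S₁, y, S₂, h, -⟩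
      simp at h
    simp [this, ih]

/-- Later members of a sequence never undo a kill. Earlier ones do so only by coming within the
radius of a window source, and all sources lie on the path. -/
theorem score_append_le {k j : ℕ} {s : Seg V} (hs : M.Far (M.Λ ^ k) s) (S₀ S S₃ : List V)
    (h0 : ∀ c ∈ S₀, ∀ i, s.a ≤ i → i ≤ s.b → M.rad j < M.dn (s.p i) c) :
    M.score k j S s ≤ M.score k j (S₀ ++ S ++ S₃) s := by
  induction k generalizing s with
  | zero => simp [score]
  | succ k ih =>
    rw [score, score]
    refine mul_le_mul_of_nonneg_left (Finset.sum_le_sum (fun i hi => ?_)) (by positivity)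
    rw [Finset.mem_Ico] at hi
    have hR := M.one_le_pow k
    split_ifs with h1 h2 h3 h4
    · exact le_rfl
    · refine absurd ⟨h2.1, h2.2.append S₀ S₃ (fun c hc => ?_)⟩ h3
      subst h1
      exact h0 c hc _ (cut_spec _).1 (cut_le_of_far hs (by omega))
    · exact zero_le_one
    · exact le_rfl
    · exact ih (win_far hs hi.2) (fun c hc t h5 h6 =>
        h0 c hc t ((cut_spec (M := M) i).1.trans h5) (le_trans h6 (cut_le_of_far hs hi.2)))

-- Averaging: a path has at most Λ/2 windows and the score divides by Λ, so some window has at least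
-- the average score. Descending level by level reaches one fixed source and window of level `j`
-- that the sequences kill with total weight at least `t`.
open Classical in
theorem exists_window_of_score {κ : Type*} [Fintype κ] (D : κ → ℝ)
    (Sq : κ → List V) {k j : ℕ} {t : ℝ} (ht : 0 < t) {s : Seg V} (hs : M.Far (M.Λ ^ k) s)
    (h : t ≤ ∑ x, D x * M.score k j (Sq x) s) :
    ∃ i a b, s.a ≤ i ∧ i ≤ a ∧ a ≤ b ∧ b ≤ s.b ∧
      (⟨s.p, a, b⟩ : Seg V).len M.w ≤ M.A j * M.Λ ^ j ∧
      t ≤ ∑ x, D x * (if M.Kill (M.rad j) (Sq x) (s.p i) ⟨s.p, a, b⟩ then 1 else 0) := by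
  induction k generalizing s with
  | zero => simp [score] at h; linarith
  | succ k ih =>
    have hR := M.one_le_pow k
    set F : ℕ → ℝ := fun i => ∑ x, D x *
      (if j = k then
        (if (M.win (M.Λ ^ k) s i).len M.w ≤ M.A k * M.Λ ^ k ∧
            M.Kill (M.rad k) (Sq x) (M.src k s i) (M.win (M.Λ ^ k) s i) then 1 else 0)
      else score M k j (Sq x) (M.win (M.Λ ^ k) s i)) with hF
    have e : ∑ x, D x * M.score (k + 1) j (Sq x) s =
        1 / (M.Λ : ℝ) * ∑ i ∈ Finset.Ico (M.lag k) (M.Λ / 2), F i := by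
      simp only [score, hF, Finset.mul_sum]
      rw [Finset.sum_comm]
      exact Finset.sum_congr rfl (fun i _ => Finset.sum_congr rfl (fun x _ => by ring))
    have hΛ : (0 : ℝ) < M.Λ := by exact_mod_cast M.one_le_Λ
    have hex : ∃ i ∈ Finset.Ico (M.lag k) (M.Λ / 2), t ≤ F i := by
      by_contra hcon
      push Not at hcon
      have h1 : ∑ i ∈ Finset.Ico (M.lag k) (M.Λ / 2), F i ≤
          ∑ i ∈ Finset.Ico (M.lag k) (M.Λ / 2), t :=
        Finset.sum_le_sum (fun i hi => (hcon i hi).le)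
      rw [Finset.sum_const, nsmul_eq_mul, Nat.card_Ico] at h1
      have h2 : ((M.Λ / 2 - M.lag k : ℕ) : ℝ) ≤ M.Λ / 2 := by
        have h3 : M.Λ / 2 - M.lag k ≤ M.Λ / 2 := Nat.sub_le _ _
        calc ((M.Λ / 2 - M.lag k : ℕ) : ℝ) ≤ ((M.Λ / 2 : ℕ) : ℝ) := by exact_mod_cast h3
          _ ≤ M.Λ / 2 := Nat.cast_div_le
      rw [e, one_div, ← div_eq_inv_mul, le_div_iff₀ hΛ] at h
      nlinarith
    obtain ⟨i, hi, hti⟩ := hex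
    rw [Finset.mem_Ico] at hi
    by_cases hj : j = k
    · subst hj
      simp only [hF, if_true] at hti
      by_cases hl : (M.win (M.Λ ^ j) s i).len M.w ≤ M.A j * M.Λ ^ j
      · simp only [hl, true_and] at hti
        exact ⟨_, _, _, (cut_spec _).1, cut_mono (by linarith) (Nat.sub_le _ _),
          cut_mono (by linarith) (Nat.le_succ i), cut_le_of_far hs hi.2, hl, hti⟩
      · simp [hl] at hti; linarith
    · simp only [hF, hj, if_false] at hti
      obtain ⟨i', a, b, h1, h2, h3, h4, h5, h6⟩ := ih (win_far hs hi.2) hti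
      exact ⟨i', a, b, (cut_spec (M := M) i).1.trans h1, h2, h3, h4.trans (cut_le_of_far hs hi.2),
        h5, h6⟩

/-- Of two points on a chain of length at most R = Λ^k, one is `dn`-within R of the other. If the
later point of the path is near the earlier one, `back` bounds the forward `df`-distance by 1; so it
is at most R in either case. As the first window is short, the two cut indices cannot be far apart.
-/
theorem touch_near {k : ℕ} (h : M.Far (M.Λ ^ (k + 1)) s) (hH : (M.Λ : ℝ) ^ k ≤ M.H) {C : List V}
    (hC : chainLen M.dn C ≤ M.Λ ^ k) {i i' : ℕ} (hii : i < i') (hi' : i' < M.Λ / 2)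
    (hl : (M.win (M.Λ ^ k) s i).len M.w ≤ M.A k * M.Λ ^ k)
    (h1 : (M.win (M.Λ ^ k) s i).Touch C) (h2 : (M.win (M.Λ ^ k) s i').Touch C) :
    i' ≤ i + M.A k + 1 := by
  have hR := M.one_le_pow k
  obtain ⟨y, hy, t, hta, htb, rfl⟩ := h1
  obtain ⟨y', hy', t', hta', htb', rfl⟩ := h2
  simp only [win] at hta htb hta' htb' hy hy' hl ⊢
  have hcm : ∀ {i j : ℕ}, i ≤ j → M.cut (M.Λ ^ k) s i ≤ M.cut (M.Λ ^ k) s j :=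
    fun hij => cut_mono (by linarith) hij
  have hb1 : M.cut (M.Λ ^ k) s (i + 1) ≤ s.b := cut_le_of_far h (by omega)
  have hb2 : M.cut (M.Λ ^ k) s (i' + 1) ≤ s.b := cut_le_of_far h (by omega)
  have htt : t ≤ t' := htb.trans ((hcm hii).trans hta')
  have hsa := (cut_spec (M := M) (R := M.Λ ^ k) (s := s) i).1
  have hdf : M.df (s.p t) (s.p t') ≤ M.Λ ^ k := by
    have hdn : M.dn (s.p t) (s.p t') ≤ M.Λ ^ k ∨ M.dn (s.p t') (s.p t) ≤ M.Λ ^ k := by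
      obtain ⟨L₁, L₂, rfl⟩ := List.append_of_mem hy
      rcases List.mem_append.1 hy' with h3 | h3
      · right
        exact (dist_le_chainLen M.dn_nonneg M.dn_self M.dn_tri L₁ (s.p t :: L₂) _ _ h3
          (by simp)).trans hC
      · left
        have e : L₁ ++ s.p t :: L₂ = (L₁ ++ [s.p t]) ++ L₂ := by simp
        rcases List.mem_cons.1 h3 with h4 | h4
        · rw [h4, M.dn_self]; linarith
        · rw [e] at hC
          exact (dist_le_chainLen M.dn_nonneg M.dn_self M.dn_tri (L₁ ++ [s.p t]) L₂ _ _ (by simp)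
            h4).trans hC
    rcases hdn with h3 | h3
    · exact (M.df_le_dn _ _).trans h3
    · have := M.back ⟨s.p, t, t'⟩ (h.1.sub (hsa.trans hta) htt (htb'.trans hb2)) (h3.trans hH)
      exact this.trans hR
  have h4 := (cut_spec (M := M) (R := M.Λ ^ k) (s := s) i').2 t' hta' (htb'.trans hb2)
  have h5 := df_cut_le (by linarith) h.1 (cut_le_of_far h (show i ≤ M.Λ / 2 by omega))
  have h6 := M.df_tri (s.p s.a) (s.p (M.cut (M.Λ ^ k) s i)) (s.p t')
  have h7 := M.df_tri (s.p (M.cut (M.Λ ^ k) s i)) (s.p t) (s.p t')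
  have h8 := (M.df_le_dn (s.p (M.cut (M.Λ ^ k) s i)) (s.p t)).trans
    (M.dn_le_len (s := ⟨s.p, M.cut (M.Λ ^ k) s i, M.cut (M.Λ ^ k) s (i + 1)⟩)
      (h.1.sub hsa (hcm (Nat.le_succ i)) hb1) le_rfl hta htb)
  have h9 : 2 * (i' : ℝ) * M.Λ ^ k ≤ (2 * i + 2 + M.A k) * M.Λ ^ k := by nlinarith
  have h10 := le_of_mul_le_mul_right h9 (by linarith)
  have h11 : 2 * i' ≤ 2 * i + 2 + M.A k := by exact_mod_cast h10
  omega

/-- A path of level `k` inside `Θ`. -/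
structure Lvl (M : Frame V) (k : ℕ) (Θ : Set V) (s : Seg V) : Prop where
  far : M.Far (M.Λ ^ k) s
  mem : ∀ i, s.a ≤ i → i ≤ s.b → s.p i ∈ Θ
  len_le : s.len M.w ≤ M.A k * M.Λ ^ k

/-- Each edge is charged to its tail; simplicity of the path makes the tails distinct. -/
theorem len_le_vol {s : Seg V} [DecidableEq V] (h : s.IsPath M.E) (Θ : Finset V)
    (hΘ : ∀ i, s.a ≤ i → i ≤ s.b → s.p i ∈ Θ) [DecidablePred s.Mem] :
    s.len M.w ≤ ∑ v ∈ Θ, if s.Mem v then M.vol v else 0 := by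
  calc s.len M.w ≤ ∑ i ∈ Finset.Ico s.a s.b, M.vol (s.p i) :=
        Finset.sum_le_sum (fun i hi => by
          rw [Finset.mem_Ico] at hi
          exact M.w_le_vol _ _ (h.2.1 i hi.1 hi.2))
    _ = ∑ v ∈ (Finset.Ico s.a s.b).image s.p, M.vol v := by
        rw [Finset.sum_image]
        intro i hi j hj hij
        simp only [Finset.coe_Ico, Set.mem_Ico] at hi hj
        exact h.2.2 ⟨hi.1, hi.2.le⟩ ⟨hj.1, hj.2.le⟩ hij
    _ ≤ ∑ v ∈ Θ.filter s.Mem, M.vol v := by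
        refine Finset.sum_le_sum_of_subset_of_nonneg ?_ (fun _ _ _ => M.vol_nonneg _)
        intro v hv
        obtain ⟨i, hi, rfl⟩ := Finset.mem_image.1 hv
        rw [Finset.mem_Ico] at hi
        exact Finset.mem_filter.2 ⟨hΘ i hi.1 hi.2.le, i, hi.1, hi.2.le, rfl⟩
    _ = _ := by rw [Finset.sum_filter]

end Frame

/-! ### Plans and their optimal value -/

/-- A randomised strategy for building a chain of blocks: each move draws a block `C` together with
claims `φ` on the paths that the block meets. -/
inductive Plan (ι V : Type*)
  | quit : Plan ι V
  | move (n : ℕ) (pr : Fin n → ℝ) (C : Fin n → List V) (hC : ∀ i, C i ≠ []) (φ : Fin n → ι → ℝ)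
      (next : Fin n → Plan ι V) : Plan ι V

namespace Plan
variable {ι V : Type*}

/-- The conditions on a single random move. -/
structure OkMove (d : V → V → ℝ) (P : ι → Seg V) (Θ : Set V) (R ψ : ℝ) {n : ℕ} (pr : Fin n → ℝ)
    (C : Fin n → List V) (φ : Fin n → ι → ℝ) : Prop where
  pr_nonneg : ∀ i, 0 ≤ pr i
  pr_sum : ∑ i, pr i = 1
  mem : ∀ i, ∀ v ∈ C i, v ∈ Θ
  len : ∀ i, chainLen d (C i) ≤ R
  φ_nonneg : ∀ i x, 0 ≤ φ i x
  φ_le : ∀ i x, φ i x ≤ 1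
  touch : ∀ i x, ¬ (P x).Touch (C i) → φ i x = 0
  diffuse : ∀ x, ∑ i, pr i * φ i x ≤ ψ

/-- A plan with at most `k` moves, all of them admissible. -/
def Ok (d : V → V → ℝ) (P : ι → Seg V) (Θ : Set V) (R ψ : ℝ) : ℕ → Plan ι V → Prop
  | _, quit => True
  | 0, move _ _ _ _ _ _ => False
  | k + 1, move _ pr C _ φ next => OkMove d P Θ R ψ pr C φ ∧ ∀ i, Ok d P Θ R ψ k (next i)

/-- Expected total claim on each path. -/
def claim : Plan ι V → ι → ℝ
  | quit, _ => 0
  | move _ pr _ _ φ next, x => ∑ i, pr i * (φ i x + (next i).claim x)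

/-- Probability that a path is claimed when claims are made independently. -/
def hit : Plan ι V → ι → ℝ
  | quit, _ => 0
  | move _ pr _ _ φ next, x => ∑ i, pr i * (φ i x + (1 - φ i x) * (next i).hit x)

/-- Expected total distance travelled between blocks. -/
def travel (d : V → V → ℝ) : Plan ι V → V → ℝ
  | quit, _ => 0
  | move _ pr C hC _ next, v =>
    ∑ i, pr i * (d v ((C i).head (hC i)) + (next i).travel d ((C i).getLast (hC i)))

/-- Expectation of a functional of the chain built by the plan. -/
def expect (f : List V → ℝ) : Plan ι V → List V → ℝ
  | quit, acc => f acc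
  | move _ pr C _ _ next, acc => ∑ i, pr i * (next i).expect f (acc ++ C i)

variable {d : V → V → ℝ} {P : ι → Seg V} {Θ : Set V} {R ψ : ℝ}

theorem Ok.mono {k l : ℕ} (h : k ≤ l) {p : Plan ι V} (hp : Ok d P Θ R ψ k p) :
    Ok d P Θ R ψ l p := by
  induction p generalizing k l with
  | quit => cases l <;> trivial
  | move n pr C hC φ next ih =>
    cases k with
    | zero => exact absurd hp id
    | succ k =>
      cases l with
      | zero => omega
      | succ l => exact ⟨hp.1, fun i => ih i (by omega) (hp.2 i)⟩

theorem claim_nonneg {k : ℕ} {p : Plan ι V} (hp : Ok d P Θ R ψ k p) (x : ι) : 0 ≤ p.claim x := by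
  induction p generalizing k with
  | quit => simp [claim]
  | move n pr C hC φ next ih =>
    cases k with
    | zero => exact absurd hp id
    | succ k =>
      exact Finset.sum_nonneg (fun i _ => mul_nonneg (hp.1.pr_nonneg i)
        (add_nonneg (hp.1.φ_nonneg i x) (ih i (hp.2 i))))

theorem hit_nonneg_le_one {k : ℕ} {p : Plan ι V} (hp : Ok d P Θ R ψ k p) (x : ι) :
    0 ≤ p.hit x ∧ p.hit x ≤ 1 := by
  induction p generalizing k with
  | quit => simp [hit]
  | move n pr C hC φ next ih =>
    cases k with
    | zero => exact absurd hp id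
    | succ k =>
      have h := fun i => ih i (hp.2 i)
      constructor
      · exact Finset.sum_nonneg (fun i _ => mul_nonneg (hp.1.pr_nonneg i)
          (add_nonneg (hp.1.φ_nonneg i x)
            (mul_nonneg (sub_nonneg.2 (hp.1.φ_le i x)) (h i).1)))
      · rw [hit]
        refine le_trans (Finset.sum_le_sum (fun i _ => ?_)) hp.1.pr_sum.le
        have h1 := hp.1.pr_nonneg i
        have h2 := mul_le_mul_of_nonneg_left (h i).2 (sub_nonneg.2 (hp.1.φ_le i x))
        nlinarith

theorem claim_le {k : ℕ} {p : Plan ι V} (hψ : 0 ≤ ψ) (hp : Ok d P Θ R ψ k p) (x : ι) :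
    p.claim x ≤ k * ψ := by
  induction p generalizing k with
  | quit => simpa [claim] using mul_nonneg (Nat.cast_nonneg (α := ℝ) k) hψ
  | move n pr C hC φ next ih =>
    cases k with
    | zero => exact absurd hp id
    | succ k =>
      have h1 : ∑ i, pr i * (next i).claim x ≤ ∑ i, pr i * (k * ψ) :=
        Finset.sum_le_sum (fun i _ =>
          mul_le_mul_of_nonneg_left (ih i (hp.2 i)) (hp.1.pr_nonneg i))
      rw [← Finset.sum_mul, hp.1.pr_sum] at h1
      have h2 := hp.1.diffuse x
      simp only [claim, mul_add, Finset.sum_add_distrib]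
      push_cast
      linarith

theorem hit_le_claim {k : ℕ} {p : Plan ι V} (hp : Ok d P Θ R ψ k p) (x : ι) :
    p.hit x ≤ p.claim x := by
  induction p generalizing k with
  | quit => simp [hit, claim]
  | move n pr C hC φ next ih =>
    cases k with
    | zero => exact absurd hp id
    | succ k =>
      refine Finset.sum_le_sum (fun i _ => mul_le_mul_of_nonneg_left ?_ (hp.1.pr_nonneg i))
      have h1 := ih i (hp.2 i)
      have h2 := mul_nonneg (hp.1.φ_nonneg i x) (hit_nonneg_le_one (hp.2 i) x).1
      linarith

/-- Each move claims a fixed path with probability at most ψ, whatever happened before. So a present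
claim overlaps later ones with probability at most Kψ, and double counting costs only the factor 1 -
Kψ. -/
theorem claim_le_hit {K k : ℕ} (hk : k ≤ K) {p : Plan ι V} (hψ : 0 ≤ ψ)
    (hp : Ok d P Θ R ψ k p) (x : ι) : (1 - K * ψ) * p.claim x ≤ p.hit x := by
  induction p generalizing k with
  | quit => simp [hit, claim]
  | move n pr C hC φ next ih =>
    cases k with
    | zero => exact absurd hp id
    | succ k =>
      rw [hit, claim, Finset.mul_sum]
      refine Finset.sum_le_sum (fun i _ => ?_)
      have h1 := ih i (by omega) (hp.2 i)
      have h2 : (next i).hit x ≤ K * ψ := by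
        refine (hit_le_claim (hp.2 i) x).trans ((claim_le hψ (hp.2 i) x).trans ?_)
        have : (k : ℝ) ≤ K := by exact_mod_cast (by omega : k ≤ K)
        exact mul_le_mul_of_nonneg_right this hψ
      have h3 := hp.1.φ_nonneg i x
      have h4 := mul_le_mul_of_nonneg_left h2 h3
      have h5 : (1 - K * ψ) * (φ i x + (next i).claim x) ≤
          φ i x + (1 - φ i x) * (next i).hit x := by nlinarith
      have := mul_le_mul_of_nonneg_left h5 (hp.1.pr_nonneg i)
      nlinarith

theorem travel_nonneg (hd : ∀ x y, 0 ≤ d x y) {k : ℕ} {p : Plan ι V} (hp : Ok d P Θ R ψ k p)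
    (v : V) : 0 ≤ p.travel d v := by
  induction p generalizing k v with
  | quit => simp [travel]
  | move n pr C hC φ next ih =>
    cases k with
    | zero => exact absurd hp id
    | succ k =>
      exact Finset.sum_nonneg (fun i _ => mul_nonneg (hp.1.pr_nonneg i)
        (add_nonneg (hd _ _) (ih i (hp.2 i) _)))

theorem travel_le_add (ht : ∀ x y z, d x z ≤ d x y + d y z) (hd : ∀ x y, 0 ≤ d x y) {k : ℕ}
    {p : Plan ι V} (hp : Ok d P Θ R ψ k p) (u v : V) :
    p.travel d u ≤ d u v + p.travel d v := by
  cases p with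
  | quit => simpa [travel] using hd u v
  | move n pr C hC φ next =>
    cases k with
    | zero => exact absurd hp id
    | succ k =>
      have h1 : ∑ i, pr i * d u v = d u v := by rw [← Finset.sum_mul, hp.1.pr_sum, one_mul]
      rw [travel, travel, ← h1, ← Finset.sum_add_distrib]
      refine Finset.sum_le_sum (fun i _ => ?_)
      rw [← mul_add]
      refine mul_le_mul_of_nonneg_left ?_ (hp.1.pr_nonneg i)
      have := ht u v ((C i).head (hC i))
      linarith

-- A claim is nonzero only if its block meets the path, so being met dominates being claimed,
-- outcome by outcome.
open Classical in
theorem hit_le_expect {k : ℕ} {p : Plan ι V} (hp : Ok d P Θ R ψ k p) (x : ι) (acc : List V) :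
    (if (P x).Touch acc then (1 : ℝ) else p.hit x) ≤
      p.expect (fun L => if (P x).Touch L then 1 else 0) acc := by
  induction p generalizing k acc with
  | quit => simp [hit, expect]
  | move n pr C hC φ next ih =>
    cases k with
    | zero => exact absurd hp id
    | succ k =>
      rw [expect]
      have h := fun i => ih i (hp.2 i) (acc ++ C i)
      have h' := Finset.sum_le_sum (fun i (_ : i ∈ Finset.univ) =>
        mul_le_mul_of_nonneg_left (h i) (hp.1.pr_nonneg i))
      refine le_trans ?_ h'
      have happ : ∀ i, (P x).Touch (acc ++ C i) ↔ (P x).Touch acc ∨ (P x).Touch (C i) := by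
        intro i
        simp only [Seg.Touch, List.mem_append]
        constructor
        · rintro ⟨y, h1 | h1, h2⟩
          · exact Or.inl ⟨y, h1, h2⟩
          · exact Or.inr ⟨y, h1, h2⟩
        · rintro (⟨y, h1, h2⟩ | ⟨y, h1, h2⟩)
          · exact ⟨y, Or.inl h1, h2⟩
          · exact ⟨y, Or.inr h1, h2⟩
      by_cases hacc : (P x).Touch acc
      · simp only [hacc, happ, true_or, if_true, mul_one]
        exact hp.1.pr_sum.ge
      · simp only [hacc, happ, false_or, if_false, hit]
        refine Finset.sum_le_sum (fun i _ => mul_le_mul_of_nonneg_left ?_ (hp.1.pr_nonneg i))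
        have h1 := hit_nonneg_le_one (hp.2 i) x
        have h2 := hp.1.φ_le i x
        split_ifs with h3
        · nlinarith [mul_nonneg (sub_nonneg.2 h2) (sub_nonneg.2 h1.2)]
        · rw [hp.1.touch i x h3]; simp

theorem expect_sum [Fintype ι] (η : ι → ℝ) (f : ι → List V → ℝ) (p : Plan ι V) (acc : List V) :
    p.expect (fun L => ∑ x, η x * f x L) acc = ∑ x, η x * p.expect (f x) acc := by
  induction p generalizing acc with
  | quit => simp [expect]
  | move n pr C hC φ next ih =>
    simp only [expect, ih, Finset.mul_sum]
    rw [Finset.sum_comm]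
    exact Finset.sum_congr rfl (fun _ _ => Finset.sum_congr rfl (fun _ _ => by ring))

/-- The length of the final chain is the travel between blocks plus the lengths of the blocks, of
which there are at most `k`, each at most `R`. -/
theorem expect_le (f : List V → ℝ) (α β : ℝ) (hβ : 0 ≤ β) (hR : 0 ≤ R)
    (hf : ∀ L, (∀ v ∈ L, v ∈ Θ) → f L ≤ α + β * chainLen d L) {k : ℕ} {p : Plan ι V}
    (hp : Ok d P Θ R ψ k p) (acc : List V) (hacc : ∀ v ∈ acc, v ∈ Θ) (hne : acc ≠ []) :
    p.expect f acc ≤ α + β * (chainLen d acc + p.travel d (acc.getLast hne) + k * R) := by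
  induction p generalizing k acc with
  | quit =>
    have h1 := hf acc hacc
    have h2 : 0 ≤ β * (k * R) := by positivity
    simp only [expect, travel]
    linarith
  | move n pr C hC φ next ih =>
    cases k with
    | zero => exact absurd hp id
    | succ k =>
      have hmem : ∀ i, ∀ v ∈ acc ++ C i, v ∈ Θ := fun i v hv => by
        rcases List.mem_append.1 hv with h | h
        · exact hacc v h
        · exact hp.1.mem i v h
      have h1 := fun i => ih i (hp.2 i) (acc ++ C i) (hmem i) (by simp [hne])
      rw [expect, travel]
      calc ∑ i, pr i * (next i).expect f (acc ++ C i)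
          ≤ ∑ i, pr i * (α + β * (chainLen d acc + (d (acc.getLast hne) ((C i).head (hC i)) +
              (next i).travel d ((C i).getLast (hC i))) + (k + 1) * R)) := by
            refine Finset.sum_le_sum (fun i _ => mul_le_mul_of_nonneg_left ?_ (hp.1.pr_nonneg i))
            refine (h1 i).trans ?_
            have h2 := chainLen_append (d := d) acc (C i) hne (hC i)
            have h3 := hp.1.len i
            have h4 : (acc ++ C i).getLast (by simp [hne]) = (C i).getLast (hC i) :=
              List.getLast_append_of_ne_nil _ (hC i)
            rw [h4, h2]
            have : chainLen d acc + d (acc.getLast hne) ((C i).head (hC i)) + chainLen d (C i) +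
              (next i).travel d ((C i).getLast (hC i)) + k * R ≤
              chainLen d acc + (d (acc.getLast hne) ((C i).head (hC i)) +
              (next i).travel d ((C i).getLast (hC i))) + (k + 1) * R := by linarith
            have := mul_le_mul_of_nonneg_left this hβ
            linarith
        _ = _ := by
            have e : ∀ i, pr i * (α + β * (chainLen d acc + (d (acc.getLast hne)
              ((C i).head (hC i)) + (next i).travel d ((C i).getLast (hC i))) + (k + 1) * R)) =
              pr i * (α + β * (chainLen d acc + (k + 1) * R)) + β * (pr i *
              (d (acc.getLast hne) ((C i).head (hC i)) +
                (next i).travel d ((C i).getLast (hC i)))) := fun i => by ring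
            simp only [e]
            rw [Finset.sum_add_distrib, ← Finset.sum_mul, hp.1.pr_sum, ← Finset.mul_sum]
            push_cast
            ring

theorem expect_nil_le (hd : ∀ x y, 0 ≤ d x y) (f : List V → ℝ) (α β : ℝ) (hβ : 0 ≤ β) (hR : 0 ≤ R)
    (hf : ∀ L, (∀ v ∈ L, v ∈ Θ) → f L ≤ α + β * chainLen d L) {k : ℕ} {p : Plan ι V}
    (hp : Ok d P Θ R ψ k p) (v : V) :
    p.expect f [] ≤ α + β * (p.travel d v + k * R) := by
  cases p with
  | quit =>
    have h1 := hf [] (by simp)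
    have h2 : 0 ≤ β * (k * R) := by positivity
    simp only [expect, travel, chainLen] at h1 ⊢
    linarith
  | move n pr C hC φ next =>
    cases k with
    | zero => exact absurd hp id
    | succ k =>
      have h1 := fun i => expect_le f α β hβ hR hf (hp.2 i) (C i) (hp.1.mem i) (hC i)
      rw [expect, travel]
      calc ∑ i, pr i * (next i).expect f ([] ++ C i)
          ≤ ∑ i, (pr i * (α + β * ((k + 1) * R)) + β * (pr i *
              (d v ((C i).head (hC i)) + (next i).travel d ((C i).getLast (hC i))))) := by
            refine Finset.sum_le_sum (fun i _ => ?_)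
            have h2 := mul_le_mul_of_nonneg_left (h1 i) (hp.1.pr_nonneg i)
            refine (by simpa using h2 : _ ≤ _).trans ?_
            have h3 := hp.1.len i
            have h4 := hd v ((C i).head (hC i))
            have h5 : chainLen d (C i) + (next i).travel d ((C i).getLast (hC i)) + k * R ≤
              (k + 1) * R + (d v ((C i).head (hC i)) +
                (next i).travel d ((C i).getLast (hC i))) := by linarith
            have h6 := mul_le_mul_of_nonneg_left (mul_le_mul_of_nonneg_left h5 hβ)
              (hp.1.pr_nonneg i)
            nlinarith
        _ = _ := by
            rw [Finset.sum_add_distrib, ← Finset.sum_mul, hp.1.pr_sum, ← Finset.mul_sum]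
            push_cast
            ring

/-- Expected claim minus the travel tax. -/
noncomputable def gain [Fintype ι] (d : V → V → ℝ) (η : ι → ℝ) (lam : ℝ) (p : Plan ι V) (v : V) :
    ℝ := ∑ x, η x * p.claim x - lam * p.travel d v

/-- The optimal gain from `v` with at most `k` moves. -/
noncomputable def value [Fintype ι] (d : V → V → ℝ) (P : ι → Seg V) (Θ : Set V) (R ψ : ℝ)
    (η : ι → ℝ) (lam : ℝ) (k : ℕ) (v : V) : ℝ :=
  sSup {t | ∃ p : Plan ι V, Ok d P Θ R ψ k p ∧ t = gain d η lam p v}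

section value
variable [Fintype ι] {η : ι → ℝ} {lam : ℝ}

theorem bddAbove_gain (hd : ∀ x y, 0 ≤ d x y) (hψ : 0 ≤ ψ) (hη : ∀ x, 0 ≤ η x) (hl : 0 ≤ lam)
    (k : ℕ) (v : V) : BddAbove {t | ∃ p : Plan ι V, Ok d P Θ R ψ k p ∧ t = gain d η lam p v} := by
  refine ⟨∑ x, η x * (k * ψ), ?_⟩
  rintro t ⟨p, hp, rfl⟩
  have h1 : ∑ x, η x * p.claim x ≤ ∑ x, η x * (k * ψ) :=
    Finset.sum_le_sum (fun x _ => mul_le_mul_of_nonneg_left (claim_le hψ hp x) (hη x))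
  have h2 := mul_nonneg hl (travel_nonneg hd hp v)
  rw [gain]; linarith

theorem nonempty_gain (k : ℕ) (v : V) :
    {t | ∃ p : Plan ι V, Ok d P Θ R ψ k p ∧ t = gain d η lam p v}.Nonempty :=
  ⟨_, quit, by cases k <;> trivial, rfl⟩

theorem gain_le_value (hd : ∀ x y, 0 ≤ d x y) (hψ : 0 ≤ ψ) (hη : ∀ x, 0 ≤ η x) (hl : 0 ≤ lam)
    {k : ℕ} {p : Plan ι V} (hp : Ok d P Θ R ψ k p) (v : V) :
    gain d η lam p v ≤ value d P Θ R ψ η lam k v :=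
  le_csSup (bddAbove_gain hd hψ hη hl k v) ⟨p, hp, rfl⟩

theorem value_nonneg (hd : ∀ x y, 0 ≤ d x y) (hψ : 0 ≤ ψ) (hη : ∀ x, 0 ≤ η x) (hl : 0 ≤ lam)
    (k : ℕ) (v : V) : 0 ≤ value d P Θ R ψ η lam k v := by
  have := gain_le_value (d := d) (P := P) (Θ := Θ) (R := R) hd hψ hη hl (k := k) (p := quit)
    (by cases k <;> trivial) v
  simpa [gain, claim, travel] using this

theorem value_mono (hd : ∀ x y, 0 ≤ d x y) (hψ : 0 ≤ ψ) (hη : ∀ x, 0 ≤ η x) (hl : 0 ≤ lam)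
    (k : ℕ) (v : V) : value d P Θ R ψ η lam k v ≤ value d P Θ R ψ η lam (k + 1) v := by
  refine csSup_le (nonempty_gain k v) ?_
  rintro t ⟨p, hp, rfl⟩
  exact gain_le_value hd hψ hη hl (hp.mono (Nat.le_succ k)) v

/-- From `u` one can follow a plan meant for `v`, at the price of the tax on the detour. Only this
one-sided Lipschitz bound is available, since `d` is not symmetric. -/
theorem value_sub_le (ht : ∀ x y z, d x z ≤ d x y + d y z) (hd : ∀ x y, 0 ≤ d x y) (hψ : 0 ≤ ψ)
    (hη : ∀ x, 0 ≤ η x) (hl : 0 ≤ lam) (k : ℕ) (u v : V) :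
    value d P Θ R ψ η lam k v - lam * d u v ≤ value d P Θ R ψ η lam k u := by
  rw [sub_le_iff_le_add]
  refine csSup_le (nonempty_gain k v) ?_
  rintro t ⟨p, hp, rfl⟩
  have h1 := gain_le_value (P := P) (Θ := Θ) hd hψ hη hl hp u
  have h2 := mul_le_mul_of_nonneg_left (travel_le_add ht hd hp u v) hl
  simp only [gain] at h1 ⊢
  linarith

/-- The Bellman inequality. The supremum need not be attained, so every outcome is continued by a
plan optimal up to `e`. -/
theorem le_value_succ (hd : ∀ x y, 0 ≤ d x y) (hψ : 0 ≤ ψ) (hη : ∀ x, 0 ≤ η x) (hl : 0 ≤ lam)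
    {k n : ℕ} {pr : Fin n → ℝ} {C : Fin n → List V} (hC : ∀ i, C i ≠ []) {φ : Fin n → ι → ℝ}
    (h : OkMove d P Θ R ψ pr C φ) (v : V) (t : ℝ)
    (ht : ∀ i, t ≤ ∑ x, η x * φ i x - lam * d v ((C i).head (hC i)) +
      value d P Θ R ψ η lam k ((C i).getLast (hC i))) :
    t ≤ value d P Θ R ψ η lam (k + 1) v := by
  refine le_of_forall_pos_le_add (fun e he => ?_)
  have hex : ∀ i, ∃ p : Plan ι V, Ok d P Θ R ψ k p ∧
      value d P Θ R ψ η lam k ((C i).getLast (hC i)) - e ≤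
        gain d η lam p ((C i).getLast (hC i)) := by
    intro i
    obtain ⟨t', ⟨p, hp, rfl⟩, h2⟩ := exists_lt_of_lt_csSup
      (nonempty_gain (d := d) (P := P) (Θ := Θ) (R := R) (ψ := ψ) (η := η) (lam := lam) k
        ((C i).getLast (hC i)))
      (show value d P Θ R ψ η lam k ((C i).getLast (hC i)) - e < sSup _ by
        rw [value]; linarith)
    exact ⟨p, hp, h2.le⟩
  choose next hn1 hn2 using hex
  have h1 := gain_le_value (P := P) (Θ := Θ) (R := R) (ψ := ψ) (k := k + 1) hd hψ hη hl
    (p := move n pr C hC φ next) ⟨h, hn1⟩ v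
  have h2 : t - e ≤ gain d η lam (move n pr C hC φ next) v := by
    have e1 : gain d η lam (move n pr C hC φ next) v =
        ∑ i, pr i * (∑ x, η x * φ i x - lam * d v ((C i).head (hC i)) +
          gain d η lam (next i) ((C i).getLast (hC i))) := by
      simp only [gain, claim, travel, Finset.mul_sum, mul_add, mul_sub, Finset.sum_add_distrib,
        Finset.sum_sub_distrib]
      rw [Finset.sum_comm (s := (Finset.univ : Finset ι)),
        Finset.sum_comm (s := (Finset.univ : Finset ι))]
      simp only [mul_left_comm]
      ring
    rw [e1]
    have e2 : t - e = ∑ i, pr i * (t - e) := by rw [← Finset.sum_mul, h.pr_sum, one_mul]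
    rw [e2]
    refine Finset.sum_le_sum (fun i _ => mul_le_mul_of_nonneg_left ?_ (h.pr_nonneg i))
    have := ht i
    have := hn2 i
    linarith
  linarith

open Classical in
/-- If no chain of length at most `B` has large union measure, the value is bounded. -/
theorem value_le (hd : ∀ x y, 0 ≤ d x y) (hψ : 0 ≤ ψ) (hη : ∀ x, 0 ≤ η x) (hR : 0 ≤ R)
    {K k : ℕ} (hk : k ≤ K) (hK : K * ψ ≤ 1 / 2) {B τ : ℝ} (hB : 0 < B) (hτ : 0 ≤ τ)
    (hKR : K * R ≤ B)
    (hT : ∀ L : List V, (∀ v ∈ L, v ∈ Θ) → chainLen d L ≤ B →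
      ∑ x, η x * (if (P x).Touch L then 1 else 0) ≤ τ) (v : V) :
    value d P Θ R ψ η (2 * τ / B) k v ≤ 4 * τ := by
  refine csSup_le (nonempty_gain k v) ?_
  rintro t ⟨p, hp, rfl⟩
  set T : List V → ℝ := fun L => ∑ x, η x * (if (P x).Touch L then 1 else 0) with hTdef
  have hsub : ∀ L₁ L₂, T (L₁ ++ L₂) ≤ T L₁ + T L₂ := by
    intro L₁ L₂
    simp only [hTdef]
    rw [← Finset.sum_add_distrib]
    refine Finset.sum_le_sum (fun x _ => ?_)
    rw [← mul_add]
    refine mul_le_mul_of_nonneg_left ?_ (hη x)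
    have : (P x).Touch (L₁ ++ L₂) → (P x).Touch L₁ ∨ (P x).Touch L₂ := by
      rintro ⟨y, h1, h2⟩
      rcases List.mem_append.1 h1 with h3 | h3
      · exact Or.inl ⟨y, h3, h2⟩
      · exact Or.inr ⟨y, h3, h2⟩
    by_cases h1 : (P x).Touch L₁ <;> by_cases h2 : (P x).Touch L₂ <;>
      by_cases h3 : (P x).Touch (L₁ ++ L₂) <;> simp [h1, h2, h3]
    exact absurd (this h3) (by simp [h1, h2])
  have hTL := subadditive_le_of_short hd B τ hB hτ T Θ hsub hT
  have h1 : p.expect T [] ≤ τ + τ / B * (p.travel d v + k * R) :=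
    expect_nil_le hd T τ (τ / B) (by positivity) hR
      (fun L hL => (hTL L hL).trans (by rw [mul_add, mul_one]; apply le_of_eq; ring)) hp v
  have h2 : ∑ x, η x * p.hit x ≤ p.expect T [] := by
    rw [hTdef, expect_sum]
    refine Finset.sum_le_sum (fun x _ => mul_le_mul_of_nonneg_left ?_ (hη x))
    have := hit_le_expect hp x []
    have hn : ¬ (P x).Touch [] := by rintro ⟨y, h, -⟩; simp at h
    rwa [if_neg hn] at this
  -- Here Kψ ≤ 1/2 makes overlaps cost at most a factor 2.
  have h3 : ∑ x, η x * p.claim x ≤ 2 * ∑ x, η x * p.hit x := by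
    rw [Finset.mul_sum]
    refine Finset.sum_le_sum (fun x _ => ?_)
    have h4 := claim_le_hit hk hψ hp x
    have h5 := claim_nonneg hp x
    have h6 : p.claim x ≤ 2 * p.hit x := by nlinarith
    have := mul_le_mul_of_nonneg_left h6 (hη x)
    linarith
  have h4 : τ / B * (k * R) ≤ τ := by
    have h5 : (k : ℝ) * R ≤ B := by
      have : (k : ℝ) ≤ K := by exact_mod_cast hk
      exact (mul_le_mul_of_nonneg_right this hR).trans hKR
    calc τ / B * (k * R) ≤ τ / B * B := mul_le_mul_of_nonneg_left h5 (by positivity)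
      _ = τ := div_mul_cancel₀ _ hB.ne'
  -- Twice the hit bound τ + (τ/B)(travel + kR) contains the travel with coefficient 2τ/B, exactly
  -- the tax rate; what remains is at most 4τ.
  rw [gain]
  have e : 2 * τ / B * p.travel d v = 2 * (τ / B * p.travel d v) := by ring
  rw [e]
  linarith

end value
end Plan

/-! ### Random blocks in one row: a kill or a move -/

/-- A threshold crossing of a function of lists that vanishes on the empty list. -/
theorem List.exists_threshold_split {V : Type*} (f : List V → ℝ) (t : ℝ) (h0 : f [] < t)
    (L : List V) (h : t ≤ f L) : ∃ A y B, L = A ++ y :: B ∧ f A < t ∧ t ≤ f (A ++ [y]) := by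
  induction L using List.reverseRecOn with
  | nil => exact absurd h (not_le.2 h0)
  | append_singleton L z ih =>
    by_cases h1 : t ≤ f L
    · obtain ⟨A, y, B, rfl, h2, h3⟩ := ih h1
      exact ⟨A, y, B ++ [z], by simp, h2, h3⟩
    · exact ⟨L, z, [], rfl, not_le.1 h1, h⟩

namespace Seg
variable {V : Type*} {Y : Seg V}

theorem touch_append {L₁ L₂ : List V} : Y.Touch (L₁ ++ L₂) ↔ Y.Touch L₁ ∨ Y.Touch L₂ := by
  simp only [Touch, List.mem_append, or_and_right, exists_or]

theorem Touch.mono {L₁ L₂ : List V} (h : Y.Touch L₁) (hs : ∀ v ∈ L₁, v ∈ L₂) : Y.Touch L₂ := by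
  obtain ⟨y, h1, h2⟩ := h
  exact ⟨y, hs y h1, h2⟩

theorem not_touch_nil : ¬ Y.Touch [] := by rintro ⟨y, h, -⟩; simp at h

end Seg

namespace Frame
variable {V : Type*} (M : Frame V)

open Classical in
/-- A random block entered near `v`, together with window claims. -/
def HasMove {Ω : Type*} [Fintype Ω] (m : Ω → ℝ) (Y : Ω → Seg V) (Θ : Set V) (R ρ δ γ : ℝ) (v : V) :
    Prop :=
  ∃ (κ : Type) (_ : Fintype κ) (pr : κ → ℝ) (C : κ → List V) (hC : ∀ b, C b ≠ [])
    (cl : κ → Ω → ℝ),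
    (∀ b, 0 ≤ pr b) ∧ ∑ b, pr b = 1 ∧ (∀ b, ∀ v ∈ C b, v ∈ Θ) ∧
    (∀ b, chainLen M.dn (C b) ≤ R) ∧ (∀ b, M.dn v ((C b).head (hC b)) ≤ ρ) ∧
    (∀ b ω, 0 ≤ cl b ω ∧ cl b ω ≤ 1) ∧ (∀ b ω, ¬ (Y ω).Touch (C b) → cl b ω = 0) ∧
    (∀ ω, ∑ b, pr b * cl b ω ≤ δ) ∧ ∀ b, γ ≤ ∑ ω, m ω * cl b ω

/-- A member `c` within ρ of `x` and not after `y` on a chain of length at most `R` would bring `y`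
within ρ + R of `x`. -/
theorem lt_of_far {R ρ : ℝ} {A B : List V} {x y c : V}
    (hlen : chainLen M.dn (A ++ y :: B) ≤ R) (hc : c ∈ A ++ [y]) (hfar : ρ + R < M.df x y) :
    ρ < M.dn x c := by
  by_contra hcon
  push Not at hcon
  have h1 := M.df_tri x c y
  have h2 := M.df_le_dn x c
  have h3 : M.dn c y ≤ R := by
    have e : A ++ y :: B = (A ++ [y]) ++ B := by simp
    rcases List.mem_append.1 hc with h | h
    · exact (dist_le_chainLen M.dn_nonneg M.dn_self M.dn_tri A (y :: B) c y h (by simp)).trans hlen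
    · rw [List.mem_singleton] at h
      rw [h, M.dn_self]
      exact (chainLen_nonneg M.dn_nonneg _).trans hlen
  have h4 := (M.df_le_dn c y).trans h3
  linarith

open Classical in
set_option maxHeartbeats 1000000 in
/-- Windows in a single row, each touched by a random block with probability at least `τ`: either a
sequence of initial parts of blocks kills many of them, or many of their sources have a diffuse
move. -/
theorem row_kill_or_move {Ω : Type*} [Fintype Ω] {κ : Type} [Fintype κ] (m : Ω → ℝ)
    (hm : ∀ ω, 0 ≤ m ω) (x : Ω → V) (Y : Ω → Seg V) (Θ : Set V) (β : κ → ℝ) (hβ : ∀ b, 0 ≤ β b)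
    (hβ1 : ∑ b, β b ≤ 1) (C : κ → List V) {R ρ τ θ γ : ℝ} (hR : 1 ≤ R) (hτ : 0 < τ) (hθ : 0 < θ)
    (hθ1 : θ ≤ 1) (hγ : 0 < γ) (hC : ∀ b, ∀ v ∈ C b, v ∈ Θ) (hlen : ∀ b, chainLen M.dn (C b) ≤ R)
    (htouch : ∀ ω, τ ≤ ∑ b, if (Y ω).Touch (C b) then β b else 0)
    (hfar : ∀ ω y, (Y ω).Mem y → ρ + R < M.df (x ω) y) (hγ2 : γ ≤ (∑ ω, m ω) * τ) :
    (∃ S : List V, (∀ v ∈ S, v ∈ Θ) ∧ (∑ ω, m ω) * (θ / (24 * R)) ≤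
        ∑ ω, m ω * (if M.Kill ρ S (x ω) (Y ω) then 1 else 0)) ∨
    ∃ G : Finset Ω, (∑ ω, m ω) / 8 ≤ ∑ ω ∈ G, m ω ∧
      ∀ ω ∈ G, M.HasMove m Y Θ R ρ (16 * θ) (γ / 8) (x ω) := by
  set tch : Ω → ℝ := fun ω => ∑ b, if (Y ω).Touch (C b) then β b else 0 with htch
  have htpos : ∀ ω, 0 < tch ω := fun ω => hτ.trans_le (htouch ω)
  -- Thinning: accepting a touch of `ω` only with probability `a ω` makes the accepted probability
  -- exactly τ for every window, as the diffuseness bound requires.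
  set a : Ω → ℝ := fun ω => τ / tch ω with ha
  have ha0 : ∀ ω, 0 ≤ a ω := fun ω => div_nonneg hτ.le (htpos ω).le
  have ha1 : ∀ ω, a ω ≤ 1 := fun ω => (div_le_one (htpos ω)).2 (htouch ω)
  have hat : ∀ ω, a ω * tch ω = τ := fun ω => div_mul_cancel₀ _ (htpos ω).ne'
  have hma : ∀ ω, 0 ≤ m ω * a ω := fun ω => mul_nonneg (hm ω) (ha0 ω)
  set gn : List V → ℝ := fun L => ∑ ω, m ω * a ω * (if (Y ω).Touch L then 1 else 0) with hgn
  have gn_mono : ∀ {L₁ L₂ : List V}, (∀ v ∈ L₁, v ∈ L₂) → gn L₁ ≤ gn L₂ := by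
    intro L₁ L₂ hs
    refine Finset.sum_le_sum (fun ω _ => mul_le_mul_of_nonneg_left ?_ (hma ω))
    by_cases h : (Y ω).Touch L₁
    · simp [h, h.mono hs]
    · simp only [h, if_false]; split_ifs <;> simp
  have gn_sub : ∀ L₁ L₂ : List V, gn (L₁ ++ L₂) ≤ gn L₁ + gn L₂ := by
    intro L₁ L₂
    simp only [hgn]
    rw [← Finset.sum_add_distrib]
    refine Finset.sum_le_sum (fun ω _ => ?_)
    rw [← mul_add]
    refine mul_le_mul_of_nonneg_left ?_ (hma ω)
    rw [Seg.touch_append]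
    by_cases h1 : (Y ω).Touch L₁ <;> by_cases h2 : (Y ω).Touch L₂ <;> simp [h1, h2]
  have gn_nil : gn [] = 0 := by simp [hgn, Seg.not_touch_nil]
  set good : κ → Prop := fun b => γ / 4 ≤ gn (C b) with hgood
  -- A good block is split at the point where half its gain is reached: the initial part through `y`
  -- serves for killing, while the part from `y` on still has half the gain and serves for a move.
  have hsplit : ∀ b, ∃ A y B, good b → C b = A ++ y :: B ∧ gn A < gn (C b) / 2 ∧
      gn (C b) / 2 ≤ gn (A ++ [y]) := by
    intro b
    by_cases hb : good b
    · have hb' : γ / 4 ≤ gn (C b) := hb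
      obtain ⟨A, y, B, h⟩ := List.exists_threshold_split gn (gn (C b) / 2)
        (by rw [gn_nil]; linarith) (C b) (by linarith)
      exact ⟨A, y, B, fun _ => h⟩
    · rcases isEmpty_or_nonempty V with hV | ⟨⟨v⟩⟩
      · have : C b = [] := List.eq_nil_iff_forall_not_mem.2 (fun v => (hV.false v).elim)
        by_cases hΩ : Nonempty Ω
        · obtain ⟨ω⟩ := hΩ
          exact (hV.false (x ω)).elim
        · rw [not_nonempty_iff] at hΩ
          simp at hγ2
          linarith
      · exact ⟨[], v, [], fun h => absurd h hb⟩
  choose A y B hABC using hsplit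
  set I : κ → List V := fun b => if good b then A b ++ [y b] else [] with hI
  have hIC : ∀ b, ∀ v ∈ I b, v ∈ C b := by
    intro b v hv
    by_cases hb : good b
    · simp only [hI, hb, if_true] at hv
      rw [(hABC b hb).1]
      simp only [List.mem_append, List.mem_cons] at hv ⊢
      tauto
    · simp [hI, hb] at hv
  set O : Ω → κ → Prop := fun ω b => (Y ω).Touch (I b) with hO
  set K : Ω → κ → Prop := fun ω b => ∃ c ∈ I b, M.dn (x ω) c ≤ ρ with hK
  set o : Ω → ℝ := fun ω => ∑ b, if O ω b then β b else 0 with ho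
  set q : Ω → ℝ := fun ω => ∑ b, if K ω b then β b else 0 with hq
  have ho0 : ∀ ω, 0 ≤ o ω := fun ω => Finset.sum_nonneg (fun b _ => by split_ifs <;> simp [hβ])
  have hq0 : ∀ ω, 0 ≤ q ω := fun ω => Finset.sum_nonneg (fun b _ => by split_ifs <;> simp [hβ])
  have hmt0 : 0 ≤ ∑ ω, m ω := Finset.sum_nonneg (fun ω _ => hm ω)
  have hot : ∀ ω, o ω ≤ tch ω := fun ω => Finset.sum_le_sum (fun b _ => by
    by_cases h : O ω b
    · have : (Y ω).Touch (C b) := Seg.Touch.mono h (hIC b)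
      simp [h, this]
    · simp only [h, if_false]; split_ifs <;> simp [hβ])
  have hsumg : ∑ b, β b * gn (C b) = (∑ ω, m ω) * τ := by
    simp only [hgn, Finset.mul_sum]
    rw [Finset.sum_comm, Finset.sum_mul]
    refine Finset.sum_congr rfl (fun ω _ => ?_)
    rw [← hat ω, htch]
    simp only [Finset.mul_sum]
    refine Finset.sum_congr rfl (fun b _ => ?_)
    split_ifs <;> ring
  have hsumo : ∑ b, β b * gn (I b) = ∑ ω, m ω * (a ω * o ω) := by
    simp only [hgn, Finset.mul_sum]
    rw [Finset.sum_comm]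
    refine Finset.sum_congr rfl (fun ω _ => ?_)
    simp only [ho, Finset.mul_sum]
    refine Finset.sum_congr rfl (fun b _ => ?_)
    simp only [hO]
    split_ifs <;> ring
  have hIgn : ∀ b, gn (C b) / 2 - γ / 8 ≤ gn (I b) := by
    intro b
    by_cases hb : good b
    · have := (hABC b hb).2.2
      simp only [hI, hb, if_true]
      linarith
    · have hb' : gn (C b) < γ / 4 := not_le.1 hb
      simp only [hI, hb, if_false, gn_nil]
      linarith
  -- Half of the gain survives the split, and the bad blocks lose at most γ/8 ≤ μτ/8, where μ = ∑ m.
  have hown1 : 3 / 8 * ((∑ ω, m ω) * τ) ≤ ∑ ω, m ω * (a ω * o ω) := by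
    rw [← hsumo]
    have h1 := Finset.sum_le_sum (fun b (_ : b ∈ Finset.univ) =>
      mul_le_mul_of_nonneg_left (hIgn b) (hβ b))
    have h2 : ∑ b, β b * (gn (C b) / 2 - γ / 8) =
        (∑ b, β b * gn (C b)) / 2 - (∑ b, β b) * (γ / 8) := by
      rw [Finset.sum_div, Finset.sum_mul, ← Finset.sum_sub_distrib]
      exact Finset.sum_congr rfl (fun b _ => by ring)
    rw [h2, hsumg] at h1
    have h3 : (∑ b, β b) * (γ / 8) ≤ γ / 8 := by
      have := mul_le_mul_of_nonneg_right hβ1 (show 0 ≤ γ / 8 by linarith)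
      linarith
    linarith
  set W : Finset Ω := Finset.univ.filter (fun ω => τ / 8 ≤ a ω * o ω) with hW
  have hWmass : (∑ ω, m ω) / 4 ≤ ∑ ω ∈ W, m ω := by
    have h1 : ∑ ω, m ω * (a ω * o ω) ≤ ∑ ω, (m ω * (τ / 8) + (if ω ∈ W then m ω else 0) * τ) := by
      refine Finset.sum_le_sum (fun ω _ => ?_)
      have h2 : a ω * o ω ≤ τ := by
        rw [← hat ω]; exact mul_le_mul_of_nonneg_left (hot ω) (ha0 ω)
      have h3 := hm ω
      by_cases hω : ω ∈ W
      · simp only [hω, if_true]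
        have := mul_le_mul_of_nonneg_left h2 h3
        nlinarith [mul_nonneg h3 hτ.le]
      · have h4 : a ω * o ω < τ / 8 := by simpa [hW] using hω
        simp only [hω, if_false]
        have := mul_le_mul_of_nonneg_left h4.le h3
        linarith
    rw [Finset.sum_add_distrib, ← Finset.sum_mul, ← Finset.sum_mul, ← Finset.sum_filter,
      Finset.filter_mem_eq_inter, Finset.univ_inter] at h1
    have h5 : (∑ ω, m ω) / 4 * τ ≤ (∑ ω ∈ W, m ω) * τ := by linarith
    exact le_of_mul_le_mul_right h5 hτ
  have hWo : ∀ ω ∈ W, τ / 8 ≤ o ω := fun ω hω => by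
    have h1 : τ / 8 ≤ a ω * o ω := by simpa [hW] using hω
    exact h1.trans (by nlinarith [ha1 ω, ho0 ω])
  -- With o ≥ τ/8 on `W`, this number of blocks gives N·o ≥ θ/R.
  set N : ℕ := ⌈8 * θ / (R * τ)⌉₊ with hN
  have hRτ : 0 < R * τ := by positivity
  have hNlow : 8 * θ / (R * τ) ≤ N := Nat.le_ceil _
  have hN1 : 1 ≤ N := Nat.one_le_iff_ne_zero.2 (by
    rw [hN]; exact (Nat.ceil_pos.2 (by positivity)).ne')
  have hNpos : (0 : ℝ) < N := by exact_mod_cast hN1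
  set W₁ : Finset Ω := W.filter (fun ω => q ω ≤ 1 / N) with hW1
  set W₂ : Finset Ω := W.filter (fun ω => ¬ q ω ≤ 1 / N) with hW2
  have hsum12 : ∑ ω ∈ W₁, m ω + ∑ ω ∈ W₂, m ω = ∑ ω ∈ W, m ω :=
    Finset.sum_filter_add_sum_filter_not _ _ _
  -- If most sources are avoided by the initial parts (q ≤ 1/N), a sequence of blocks kills.
  -- Otherwise q > 1/N, and the blocks conditioned to pass near the source form the move.
  by_cases hcase : (∑ ω, m ω) / 8 ≤ ∑ ω ∈ W₁, m ω
  · left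
    obtain ⟨S, hS⟩ := exists_block_sequence β hβ hβ1 O K N m hm
    refine ⟨S.flatMap I, fun v hv => ?_, ?_⟩
    · obtain ⟨b, -, hb⟩ := List.mem_flatMap.1 hv
      exact hC b v (hIC b v hb)
    · have hkill : ∀ ω, (∃ S₁ b S₂, S = S₁ ++ b :: S₂ ∧ O ω b ∧ ∀ b' ∈ S₁, ¬ K ω b') →
          M.Kill ρ (S.flatMap I) (x ω) (Y ω) := by
        rintro ω ⟨S₁, b, S₂, rfl, hOb, hS1⟩
        have hgb : good b := by
          by_contra hb
          simp only [hO, hI, hb, if_false] at hOb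
          exact Seg.not_touch_nil hOb
        obtain ⟨z, hz, hzY⟩ := hOb
        obtain ⟨D, E, hDE⟩ := List.append_of_mem hz
        refine ⟨S₁.flatMap I ++ D, z, E ++ S₂.flatMap I, ?_, hzY, fun c hc => ?_⟩
        · simp [hDE]
        · rw [List.append_assoc, List.mem_append] at hc
          rcases hc with hc | hc
          · obtain ⟨b', hb', hcb'⟩ := List.mem_flatMap.1 hc
            by_contra hcon
            exact hS1 b' hb' ⟨c, hcb', not_lt.1 hcon⟩
          · have h1 : C b = D ++ z :: (E ++ B b) := by
              have h2 := (hABC b hgb).1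
              simp only [hI, hgb, if_true] at hDE
              rw [h2]
              have : A b ++ y b :: B b = (A b ++ [y b]) ++ B b := by simp
              rw [this, hDE]; simp
            exact M.lt_of_far (by rw [← h1]; exact hlen b) hc (hfar ω z hzY)
      have hlow : ∀ ω ∈ W₁, θ / (3 * R) ≤ N * o ω / (1 + N * (o ω + q ω)) := by
        intro ω hω
        rw [hW1, Finset.mem_filter] at hω
        have h1 := hWo ω hω.1
        have h2 : N * q ω ≤ 1 := by
          have := mul_le_mul_of_nonneg_left hω.2 hNpos.le
          rwa [mul_one_div_cancel hNpos.ne'] at this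
        have h3 : θ / R ≤ N * o ω := by
          calc θ / R = 8 * θ / (R * τ) * (τ / 8) := by field_simp
            _ ≤ N * o ω := mul_le_mul hNlow h1 (by positivity) hNpos.le
        have h4 : θ / R ≤ 1 := by rw [div_le_one (by linarith)]; linarith
        have h5 : 0 < θ / R := by positivity
        have h6 := mul_nonneg hNpos.le (hq0 ω)
        rw [show θ / (3 * R) = θ / R / 3 by field_simp, mul_add]
        rw [div_le_div_iff₀ (by norm_num) (by linarith)]
        nlinarith
      calc (∑ ω, m ω) * (θ / (24 * R)) = (∑ ω, m ω) / 8 * (θ / (3 * R)) := by ring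
        _ ≤ (∑ ω ∈ W₁, m ω) * (θ / (3 * R)) :=
            mul_le_mul_of_nonneg_right hcase (by positivity)
        _ ≤ ∑ ω ∈ W₁, m ω * (N * o ω / (1 + N * (o ω + q ω))) := by
            rw [Finset.sum_mul]
            exact Finset.sum_le_sum (fun ω hω => mul_le_mul_of_nonneg_left (hlow ω hω) (hm ω))
        _ ≤ ∑ ω, m ω * (N * o ω / (1 + N * (o ω + q ω))) := by
            refine Finset.sum_le_sum_of_subset_of_nonneg (Finset.subset_univ _) (fun ω _ _ => ?_)
            have := ho0 ω
            have := hq0 ω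
            have := hm ω
            positivity
        _ ≤ ∑ ω, m ω * (if ∃ S₁ b S₂, S = S₁ ++ b :: S₂ ∧ O ω b ∧ ∀ b' ∈ S₁, ¬ K ω b'
              then 1 else 0) := by convert hS
        _ ≤ _ := by
            refine Finset.sum_le_sum (fun ω _ => mul_le_mul_of_nonneg_left ?_ (hm ω))
            by_cases h : ∃ S₁ b S₂, S = S₁ ++ b :: S₂ ∧ O ω b ∧ ∀ b' ∈ S₁, ¬ K ω b'
            · rw [if_pos h, if_pos (hkill ω h)]
            · rw [if_neg h]; split_ifs <;> simp
  · right
    push Not at hcase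
    refine ⟨W₂, by linarith, fun ω hω => ?_⟩
    rw [hW2, Finset.mem_filter, not_le] at hω
    have hqN := hω.2
    have hq1 : q ω ≤ 1 := by
      refine le_trans (Finset.sum_le_sum (fun b _ => ?_)) hβ1
      split_ifs
      · exact le_rfl
      · exact hβ b
    have hqpos : 0 < q ω := lt_trans (by positivity) hqN
    -- `N = 1` would force q > 1. So the ceiling was taken of a number above 1 and at most doubled
    -- it.
    have hz1 : 1 < 8 * θ / (R * τ) := by
      by_contra hcon
      push Not at hcon
      have : N ≤ 1 := by rw [hN]; exact Nat.ceil_le.2 (by exact_mod_cast hcon)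
      have : N = 1 := le_antisymm this hN1
      rw [this] at hqN
      norm_num at hqN
      linarith
    have hNup : (N : ℝ) ≤ 16 * θ / (R * τ) := by
      have h1 := Nat.ceil_lt_add_one (show (0 : ℝ) ≤ 8 * θ / (R * τ) by positivity)
      have h2 : 16 * θ / (R * τ) = 8 * θ / (R * τ) + 8 * θ / (R * τ) := by ring
      rw [h2]
      exact le_of_lt (lt_of_lt_of_le h1 (by linarith))
    have hqlow : τ / q ω ≤ 16 * θ := by
      rw [div_le_iff₀ hqpos]
      have h1 : 1 < q ω * N := by rwa [div_lt_iff₀ hNpos] at hqN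
      have h2 : 1 < q ω * (16 * θ / (R * τ)) :=
        lt_of_lt_of_le h1 (mul_le_mul_of_nonneg_left hNup hqpos.le)
      rw [← mul_div_assoc, lt_div_iff₀ hRτ, one_mul] at h2
      nlinarith
    -- The block is entered at its member `c` near the source. As `c` does not come after `y`, the
    -- remaining block still contains `y` and everything following it.
    have hent : ∀ b : {b // K ω b}, ∃ c A₁ A₂, A b ++ [y b] = A₁ ++ c :: A₂ ∧ M.dn (x ω) c ≤ ρ ∧
        good b := by
      rintro ⟨b, c, hc, hcρ⟩
      have hgb : good b := by
        by_contra hb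
        simp [hI, hb] at hc
      simp only [hI, hgb, if_true] at hc
      obtain ⟨A₁, A₂, h⟩ := List.append_of_mem hc
      exact ⟨c, A₁, A₂, h, hcρ, hgb⟩
    choose c A₁ A₂ hcA using hent
    have hCeq : ∀ b : {b // K ω b}, C b = A₁ b ++ (c b :: A₂ b ++ B b) := by
      intro b
      have h1 := (hABC b (hcA b).2.2).1
      rw [h1]
      have : A b.1 ++ y b.1 :: B b.1 = (A b.1 ++ [y b.1]) ++ B b.1 := by simp
      rw [this, (hcA b).1]; simp
    set C' : {b // K ω b} → List V := fun b => c b :: A₂ b ++ B b with hC'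
    have hC'C : ∀ b, ∀ v ∈ C' b, v ∈ C b := by
      intro b v hv
      rw [hCeq b]; exact List.mem_append_right _ hv
    refine ⟨{b // K ω b}, inferInstance, fun b => β b / q ω, C', fun b => by simp [hC'],
      fun b ω' => if (Y ω').Touch (C' b) then a ω' else 0, fun b => div_nonneg (hβ b) hqpos.le,
      ?_, fun b v hv => hC b v (hC'C b v hv), fun b => ?_, fun b => by simpa [hC'] using (hcA b).2.1,
      fun b ω' => by dsimp only; split_ifs <;> simp [ha0, ha1], fun b ω' h => by simp [h], fun ω' => ?_,
      fun b => ?_⟩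
    · rw [← Finset.sum_div]
      rw [div_eq_one_iff_eq hqpos.ne', hq]
      dsimp only
      rw [← Finset.sum_filter]
      exact (Finset.sum_subtype _ (by simp) _).symm
    · refine le_trans ?_ (hlen b)
      rw [hCeq b]
      exact (chainLen_le_of_append M.dn_nonneg (A₁ b) (C' b)).2
    -- Conditioning on passing near the source divides probabilities by `q`, so every window is
    -- claimed with probability at most τ/q ≤ 16θ.
    · refine le_trans ?_ hqlow
      calc ∑ b : {b // K ω b}, β b / q ω * (if (Y ω').Touch (C' b) then a ω' else 0)
          ≤ ∑ b : {b // K ω b}, (if (Y ω').Touch (C b) then β b else 0) * (a ω' / q ω) := by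
            refine Finset.sum_le_sum (fun b _ => ?_)
            have h0 : 0 ≤ β b * (a ω' / q ω) :=
              mul_nonneg (hβ b) (div_nonneg (ha0 ω') hqpos.le)
            by_cases h : (Y ω').Touch (C' b)
            · rw [if_pos h, if_pos (h.mono (hC'C b))]
              apply le_of_eq; ring
            · rw [if_neg h]
              split_ifs
              · simpa using h0
              · simp
        _ ≤ ∑ b, (if (Y ω').Touch (C b) then β b else 0) * (a ω' / q ω) := by
            rw [← Finset.sum_subtype (Finset.univ.filter (K ω)) (by simp)
              (fun b => (if (Y ω').Touch (C b) then β b else 0) * (a ω' / q ω))]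
            refine Finset.sum_le_sum_of_subset_of_nonneg (Finset.filter_subset _ _)
              (fun b _ _ => mul_nonneg ?_ (div_nonneg (ha0 ω') hqpos.le))
            split_ifs <;> simp [hβ]
        _ = τ / q ω := by
            rw [← Finset.sum_mul, ← hat ω']
            ring
    · have hgb := (hcA b).2.2
      have h1 : gn (C b) ≤ gn (A b) + gn (y b :: B b) := by
        conv_lhs => rw [(hABC b hgb).1]
        exact gn_sub _ _
      have h2 := (hABC b hgb).2.1
      have h3 : γ / 4 ≤ gn (C b) := hgb
      have h4 : gn (y b :: B b) ≤ gn (C' b) := by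
        refine gn_mono (fun v hv => ?_)
        have hy : y b ∈ c b :: A₂ b := by
          have h5 := congrArg List.getLast? (hcA b).1
          simp only [List.getLast?_append, List.getLast?_singleton, Option.some_or] at h5
          have h6 : (c b :: A₂ b).getLast? = some (y b) := by
            cases h7 : (c b :: A₂ b).getLast? with
            | none => simp at h7
            | some v => rw [h7] at h5; simpa using h5.symm
          exact List.mem_of_getLast? h6
        simp only [hC', List.cons_append, List.mem_cons, List.mem_append] at hv hy ⊢
        rcases hv with rfl | hv
        · tauto
        · tauto
      have h5 : gn (C' b) = ∑ ω', m ω' * (if (Y ω').Touch (C' b) then a ω' else 0) := by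
        simp only [hgn]
        refine Finset.sum_congr rfl (fun ω' _ => ?_)
        split_ifs <;> ring
      rw [← h5]
      linarith

end Frame

/-! ### The dichotomy, for one row and for several rows -/

/-- Lists indexed by integers can be concatenated in decreasing order of the index. -/
theorem exists_concat_decreasing {V : Type*} (f : ℤ → List V) (F : Finset ℤ) :
    ∃ S : List V, (∀ v ∈ S, ∃ r ∈ F, v ∈ f r) ∧
      ∀ r ∈ F, ∃ S₀ S₃, S = S₀ ++ f r ++ S₃ ∧ ∀ c ∈ S₀, ∃ r', r < r' ∧ c ∈ f r' := by
  induction F using Finset.induction_on_min with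
  | empty => exact ⟨[], by simp⟩
  | insert a F ha ih =>
    obtain ⟨S, h1, h2⟩ := ih
    refine ⟨S ++ f a, fun v hv => ?_, fun r hr => ?_⟩
    · rcases List.mem_append.1 hv with h | h
      · obtain ⟨r, hr, hv⟩ := h1 v h
        exact ⟨r, Finset.mem_insert_of_mem hr, hv⟩
      · exact ⟨a, Finset.mem_insert_self _ _, h⟩
    · rcases Finset.mem_insert.1 hr with h | h
      · subst h
        refine ⟨S, [], by simp, fun c hc => ?_⟩
        obtain ⟨r', hr', hv⟩ := h1 c hc
        exact ⟨r', ha r' hr', hv⟩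
      · obtain ⟨S₀, S₃, h3, h4⟩ := h2 r h
        exact ⟨S₀, S₃ ++ f a, by rw [h3]; simp, h4⟩

namespace Frame
variable {V : Type*} {M : Frame V}

theorem HasMove.of_subtype {Ω : Type*} [Fintype Ω] {s : Ω → Prop} [Fintype {ω // s ω}] {m : Ω → ℝ}
    {Y : Ω → Seg V} {Θ : Set V} {R ρ δ γ : ℝ} {v : V} (hδ : 0 ≤ δ)
    (h : M.HasMove (fun ω : {ω // s ω} => m ω) (fun ω => Y ω) Θ R ρ δ γ v) :
    M.HasMove m Y Θ R ρ δ γ v := by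
  classical
  obtain ⟨κ, hκ, pr, C, hC, cl, h1, h2, h3, h4, h5, h6, h7, h8, h9⟩ := h
  refine ⟨κ, hκ, pr, C, hC, fun b ω => if hs : s ω then cl b ⟨ω, hs⟩ else 0, h1, h2, h3, h4, h5,
    fun b ω => ?_, fun b ω ht => ?_, fun ω => ?_, fun b => ?_⟩
  · dsimp only
    split_ifs
    · exact h6 b _
    · simp
  · dsimp only
    split_ifs with hs
    · exact h7 b ⟨ω, hs⟩ ht
    · rfl
  · by_cases hs : s ω
    · simpa [hs] using h8 ⟨ω, hs⟩
    · simpa [hs] using hδ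
  · refine (h9 b).trans (le_of_eq ?_)
    have e : ∑ ω, m ω * (if hs : s ω then cl b ⟨ω, hs⟩ else 0) =
        ∑ ω, if hs : s ω then m ω * cl b ⟨ω, hs⟩ else 0 :=
      Finset.sum_congr rfl (fun ω _ => by split_ifs <;> simp)
    rw [e]
    rw [Finset.sum_dite, Finset.sum_const_zero, add_zero]
    refine Finset.sum_bij' (fun ω _ => ⟨ω.1, by simp [ω.2]⟩)
      (fun ω _ => ⟨ω.1, (Finset.mem_filter.1 ω.2).2⟩) ?_ ?_ ?_ ?_ ?_ <;> simp

/-- The volume of a set of vertices. -/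
def tvol (M : Frame V) (Θ : Finset V) : ℝ := ∑ v ∈ Θ, M.vol v

open Classical in
/-- Every weighting of level-`k` paths in `Θ` has either a chain of length `Λ ^ k` meeting many of
them, or a sequence killing many windows of a lower level. -/
def Dichotomy (M : Frame V) (k : ℕ) (α q : ℝ) : Prop :=
  ∀ (Θ : Finset V) (ι : Type) [Fintype ι] (P : ι → Seg V) (η : ι → ℝ), (∀ x, 0 ≤ η x) →
    ∑ x, η x = 1 → (∀ x, M.Lvl k Θ (P x)) →
    (∃ C : List V, (∀ v ∈ C, v ∈ Θ) ∧ chainLen M.dn C ≤ M.Λ ^ k ∧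
      α * M.Λ ^ (2 * k) / M.tvol Θ ≤ ∑ x, η x * (if (P x).Touch C then 1 else 0)) ∨
    ∃ j < k, ∃ S : List V, (∀ v ∈ S, v ∈ Θ) ∧ q / M.Λ ^ j ≤ ∑ x, η x * M.score k j S (P x)

theorem Lvl.pow_le_tvol {k : ℕ} {Θ : Finset V} {s : Seg V} (h : M.Lvl k Θ s) :
    (M.Λ : ℝ) ^ k ≤ M.tvol Θ := by
  classical
  have h1 := h.far.2.trans (M.df_le_dn _ _)
  have h2 := M.dn_le_len h.far.1 le_rfl h.far.1.1 le_rfl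
  have h3 := M.len_le_vol h.far.1 Θ (fun i hi hi' => h.mem i hi hi')
  refine h1.trans (h2.trans (h3.trans (Finset.sum_le_sum (fun v _ => ?_))))
  split_ifs
  · exact le_rfl
  · exact M.vol_nonneg v

-- The minimax form of the dichotomy: a single distribution over chains and lists serves all paths
-- simultaneously, each path being treated well by at least one of the two kinds. Factors Λ^J
-- normalise kills of different levels.
open Classical in
theorem Dichotomy.mixture {k : ℕ} {α q : ℝ} (hM : M.Dichotomy k α q) (hα : 0 < α) (hq : 0 < q)
    (Θ : Finset V) {Ω : Type} [Fintype Ω] [Nonempty Ω] (Y : Ω → Seg V)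
    (hY : ∀ ω, M.Lvl k Θ (Y ω)) :
    ∃ (κ : Type) (_ : Fintype κ) (wt : κ → ℝ) (C : κ → List V) (J : κ → ℕ) (S : κ → List V),
      (∀ b, 0 ≤ wt b) ∧ ∑ b, wt b = 1 ∧ (∀ b, ∀ v ∈ C b, v ∈ Θ) ∧
      (∀ b, chainLen M.dn (C b) ≤ M.Λ ^ k) ∧ (∀ b, ∀ v ∈ S b, v ∈ Θ) ∧
      (∀ b, J b < k ∨ S b = []) ∧
      ∀ ω, α * M.Λ ^ (2 * k) / M.tvol Θ / 4 ≤ (∑ b, if (Y ω).Touch (C b) then wt b else 0) ∨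
        q / 4 ≤ ∑ b, wt b * (M.Λ ^ J b * M.score k (J b) (S b) (Y ω)) := by
  have hΛ : (0 : ℝ) < M.Λ := by exact_mod_cast M.one_le_Λ
  have hv : 0 < M.tvol Θ :=
    lt_of_lt_of_le (by positivity) (hY (Classical.arbitrary Ω)).pow_le_tvol
  set τ := α * M.Λ ^ (2 * k) / M.tvol Θ with hτ
  have hτ0 : 0 < τ := by positivity
  let Adm := {z : List V × ℕ × List V // (∀ v ∈ z.1, v ∈ Θ) ∧ chainLen M.dn z.1 ≤ M.Λ ^ k ∧
    (∀ v ∈ z.2.2, v ∈ Θ) ∧ (z.2.1 < k ∨ z.2.2 = [])}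
  have hnil : chainLen M.dn [] ≤ (M.Λ : ℝ) ^ k := by
    simp only [chainLen]
    positivity
  have : Nonempty Adm := ⟨⟨([], 0, []), by simp, hnil, by simp, Or.inr rfl⟩⟩
  -- The payoff adds the two normalised alternatives. A reply uses one of them and leaves the other
  -- slot empty; a total above 1/2 forces one of the summands to be at least 1/4.
  obtain ⟨κ, hκ, wt, z, h1, h2, h3⟩ := exists_mixture_of_forall_reply (α := Adm)
    (fun z ω => (if (Y ω).Touch z.1.1 then 1 else 0) / τ +
      M.Λ ^ z.1.2.1 * M.score k z.1.2.1 z.1.2.2 (Y ω) / q) (fun p hp hp1 => by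
    rcases hM Θ Ω Y p hp hp1 hY with ⟨C, hC1, hC2, hC3⟩ | ⟨j, hj, S, hS1, hS2⟩
    · refine ⟨⟨(C, 0, []), hC1, hC2, by simp, Or.inr rfl⟩, ?_⟩
      simp only [score_nil, mul_zero, zero_div, add_zero, ← mul_div_assoc]
      rw [← Finset.sum_div, le_div_iff₀ hτ0, one_mul]
      exact hC3
    · refine ⟨⟨([], j, S), by simp, hnil, hS1, Or.inl hj⟩, ?_⟩
      simp only [Seg.not_touch_nil, if_false, zero_div, zero_add]
      have e : ∑ ω, p ω * (M.Λ ^ j * M.score k j S (Y ω) / q) =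
          M.Λ ^ j / q * ∑ ω, p ω * M.score k j S (Y ω) := by
        rw [Finset.mul_sum]
        exact Finset.sum_congr rfl (fun ω _ => by ring)
      rw [e]
      calc (1 : ℝ) = M.Λ ^ j / q * (q / M.Λ ^ j) := by field_simp
        _ ≤ _ := mul_le_mul_of_nonneg_left hS2 (by positivity))
  refine ⟨κ, hκ, wt, fun b => (z b).1.1, fun b => (z b).1.2.1, fun b => (z b).1.2.2, h1, h2,
    fun b => (z b).2.1, fun b => (z b).2.2.1, fun b => (z b).2.2.2.1, fun b => (z b).2.2.2.2,
    fun ω => ?_⟩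
  by_contra hcon
  push Not at hcon
  obtain ⟨hc1, hc2⟩ := hcon
  have h4 := h3 ω
  have e : ∑ b, wt b * ((if (Y ω).Touch (z b).1.1 then 1 else 0) / τ +
      M.Λ ^ (z b).1.2.1 * M.score k (z b).1.2.1 (z b).1.2.2 (Y ω) / q) =
      (∑ b, if (Y ω).Touch (z b).1.1 then wt b else 0) / τ +
      (∑ b, wt b * (M.Λ ^ (z b).1.2.1 * M.score k (z b).1.2.1 (z b).1.2.2 (Y ω))) / q := by
    rw [Finset.sum_div, Finset.sum_div, ← Finset.sum_add_distrib]
    refine Finset.sum_congr rfl (fun b _ => ?_)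
    split_ifs <;> ring
  rw [e] at h4
  have h5 : (∑ b, if (Y ω).Touch (z b).1.1 then wt b else 0) / τ < 1 / 4 := by
    rw [div_lt_iff₀ hτ0]; linarith
  have h6 : (∑ b, wt b * (M.Λ ^ (z b).1.2.1 * M.score k (z b).1.2.1 (z b).1.2.2 (Y ω))) / q
      < 1 / 4 := by
    rw [div_lt_iff₀ hq]; linarith
  linarith

end Frame

namespace Frame
variable {V : Type*} {M : Frame V}

open Classical in
/-- Windows in a single row: a lower-level sequence kills many, or a same-level sequence kills many,
or many sources have a diffuse move. -/
theorem Dichotomy.row {k : ℕ} {α q : ℝ} (hM : M.Dichotomy k α q) (hα : 0 < α) (hq : 0 < q)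
    (Θ : Finset V) {Ω : Type} [Fintype Ω] (m : Ω → ℝ) (hm : ∀ ω, 0 ≤ m ω) (x : Ω → V)
    (Y : Ω → Seg V) (hY : ∀ ω, M.Lvl k Θ (Y ω)) {ρ : ℝ}
    (hfar : ∀ ω y, (Y ω).Mem y → ρ + M.Λ ^ k < M.df (x ω) y) {θ γ : ℝ} (hθ : 0 < θ)
    (hθ1 : θ ≤ 1) (hγ : 0 < γ)
    (hγ2 : γ ≤ (∑ ω, m ω) / 2 * (α * M.Λ ^ (2 * k) / M.tvol Θ / 4)) :
    (∃ j S, (j < k ∨ S = []) ∧ (∀ v ∈ S, v ∈ Θ) ∧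
      (∑ ω, m ω) / 2 * (q / 4) ≤ M.Λ ^ j * ∑ ω, m ω * M.score k j S (Y ω)) ∨
    (∃ S : List V, (∀ v ∈ S, v ∈ Θ) ∧ (∑ ω, m ω) / 2 * (θ / (24 * M.Λ ^ k)) ≤
        ∑ ω, m ω * (if M.Kill ρ S (x ω) (Y ω) then 1 else 0)) ∨
    ∃ G : Finset Ω, (∑ ω, m ω) / 16 ≤ ∑ ω ∈ G, m ω ∧
      ∀ ω ∈ G, M.HasMove m Y Θ (M.Λ ^ k) ρ (16 * θ) (γ / 8) (x ω) := by
  have hne : Nonempty Ω := by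
    by_contra h
    rw [not_nonempty_iff] at h
    simp at hγ2
    linarith
  have hv : 0 < M.tvol Θ :=
    lt_of_lt_of_le (by have := M.one_le_pow k; positivity)
      (hY (Classical.arbitrary Ω)).pow_le_tvol
  have hΛ : (0 : ℝ) < M.Λ := by exact_mod_cast M.one_le_Λ
  obtain ⟨κ, hκ, wt, C, J, S, hwt, hwt1, hC, hlen, hS, hJ, htype⟩ := hM.mixture hα hq Θ Y hY
  set τ := α * M.Λ ^ (2 * k) / M.tvol Θ / 4 with hτ
  have hτ0 : 0 < τ := by positivity
  set T : Ω → Prop := fun ω => τ ≤ ∑ b, if (Y ω).Touch (C b) then wt b else 0 with hT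
  have hsplit : ∑ ω ∈ Finset.univ.filter T, m ω + ∑ ω ∈ Finset.univ.filter (fun ω => ¬ T ω), m ω =
      ∑ ω, m ω := Finset.sum_filter_add_sum_filter_not _ _ _
  by_cases hcase : (∑ ω, m ω) / 2 ≤ ∑ ω ∈ Finset.univ.filter T, m ω
  · right
    have hsub : ∀ f : Ω → ℝ, ∑ ω : {ω // T ω}, f ω = ∑ ω ∈ Finset.univ.filter T, f ω :=
      fun f => (Finset.sum_subtype _ (by simp) f).symm
    rcases M.row_kill_or_move (Ω := {ω // T ω}) (fun ω => m ω) (fun ω => hm ω) (fun ω => x ω)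
      (fun ω => Y ω) Θ wt hwt hwt1.le C (M.one_le_pow k) hτ0 hθ hθ1 hγ hC hlen (fun ω => ω.2)
      (fun ω => hfar ω) (by
        rw [hsub]
        exact hγ2.trans (mul_le_mul_of_nonneg_right hcase hτ0.le)) with
      ⟨S', hS1, hS2⟩ | ⟨G, hG1, hG2⟩
    · left
      refine ⟨S', hS1, ?_⟩
      rw [hsub, hsub (fun ω => m ω * (if M.Kill ρ S' (x ω) (Y ω) then 1 else 0))] at hS2
      refine (mul_le_mul_of_nonneg_right hcase (by positivity)).trans (hS2.trans ?_)
      refine Finset.sum_le_sum_of_subset_of_nonneg (Finset.subset_univ _) (fun ω _ _ => ?_)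
      have := hm ω
      split_ifs <;> simp [this]
    · right
      rw [hsub] at hG1
      refine ⟨G.map (Function.Embedding.subtype _), ?_, fun ω hω => ?_⟩
      · rw [Finset.sum_map]
        simp only [Function.Embedding.coe_subtype]
        linarith
      · obtain ⟨ω', hω', rfl⟩ := Finset.mem_map.1 hω
        exact (hG2 ω' hω').of_subtype (by positivity)
  · left
    push Not at hcase
    have hK : (∑ ω, m ω) / 2 ≤ ∑ ω ∈ Finset.univ.filter (fun ω => ¬ T ω), m ω := by linarith
    have h1 : (∑ ω, m ω) / 2 * (q / 4) ≤
        ∑ b, wt b * (M.Λ ^ J b * ∑ ω, m ω * M.score k (J b) (S b) (Y ω)) := by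
      calc (∑ ω, m ω) / 2 * (q / 4)
          ≤ ∑ ω ∈ Finset.univ.filter (fun ω => ¬ T ω), m ω * (q / 4) := by
            rw [← Finset.sum_mul]
            exact mul_le_mul_of_nonneg_right hK (by positivity)
        _ ≤ ∑ ω ∈ Finset.univ.filter (fun ω => ¬ T ω),
            m ω * ∑ b, wt b * (M.Λ ^ J b * M.score k (J b) (S b) (Y ω)) := by
            refine Finset.sum_le_sum (fun ω hω => mul_le_mul_of_nonneg_left ?_ (hm ω))
            exact (htype ω).resolve_left (Finset.mem_filter.1 hω).2
        _ ≤ ∑ ω, m ω * ∑ b, wt b * (M.Λ ^ J b * M.score k (J b) (S b) (Y ω)) := by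
            refine Finset.sum_le_sum_of_subset_of_nonneg (Finset.subset_univ _) (fun ω _ _ => ?_)
            exact mul_nonneg (hm ω) (Finset.sum_nonneg (fun b _ => mul_nonneg (hwt b)
              (mul_nonneg (by positivity) (score_nonneg _ _ _ _))))
        _ = _ := by
            simp only [Finset.mul_sum]
            rw [Finset.sum_comm]
            exact Finset.sum_congr rfl (fun b _ => Finset.sum_congr rfl (fun ω _ => by ring))
    obtain ⟨b, hb⟩ : ∃ b, (∑ ω, m ω) / 2 * (q / 4) ≤
        M.Λ ^ J b * ∑ ω, m ω * M.score k (J b) (S b) (Y ω) := by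
      by_contra hcon
      push Not at hcon
      have hpos : ∃ b, 0 < wt b := by
        by_contra h
        push Not at h
        have := Finset.sum_nonpos (fun b (_ : b ∈ Finset.univ) => h b)
        linarith
      obtain ⟨b₀, hb₀⟩ := hpos
      have h2 : ∑ b, wt b * (M.Λ ^ J b * ∑ ω, m ω * M.score k (J b) (S b) (Y ω)) <
          ∑ b, wt b * ((∑ ω, m ω) / 2 * (q / 4)) :=
        Finset.sum_lt_sum (fun b _ => mul_le_mul_of_nonneg_left (hcon b).le (hwt b))
          ⟨b₀, Finset.mem_univ _, mul_lt_mul_of_pos_left (hcon b₀) hb₀⟩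
      rw [← Finset.sum_mul, hwt1, one_mul] at h2
      linarith
    exact ⟨J b, S b, hJ b, hS b, hb⟩

open Classical in
/-- Windows in several rows: a lower-level sequence kills many, or a same-level sequence kills many,
or many sources have a diffuse move inside their row. -/
theorem Dichotomy.rows {k : ℕ} {α q : ℝ} (hM : M.Dichotomy k α q) (hα : 0 < α) (hq : 0 < q)
    (Θ : Finset V) {Ω : Type} [Fintype Ω] (m : Ω → ℝ) (hm : ∀ ω, 0 ≤ m ω) (hμ : 0 < ∑ ω, m ω)
    (x : Ω → V) (Y : Ω → Seg V) (row : V → ℤ) (ℓ : Ω → ℤ)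
    (hY : ∀ ω, M.Lvl k (Θ.filter (fun v => row v = ℓ ω) : Finset V) (Y ω))
    (hnx : ∀ ω c, M.dn (x ω) c ≤ M.rad k → row c ≤ ℓ ω)
    (hnY : ∀ ω y c, (Y ω).Mem y → M.dn y c ≤ M.rad k → row c ≤ ℓ ω)
    (hfar : ∀ ω y, (Y ω).Mem y → M.rad k + M.Λ ^ k < M.df (x ω) y)
    (hrad : ∀ j < k, M.rad j ≤ M.rad k) {θ : ℝ} (hθ : 0 < θ) (hθ1 : θ ≤ 1) :
    (∃ j < k, ∃ S : List V, (∀ v ∈ S, v ∈ Θ) ∧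
      (∑ ω, m ω) * (q / (48 * k * M.Λ ^ j)) ≤ ∑ ω, m ω * M.score k j S (Y ω)) ∨
    (∃ S : List V, (∀ v ∈ S, v ∈ Θ) ∧ (∑ ω, m ω) * (θ / (288 * M.Λ ^ k)) ≤
        ∑ ω, m ω * (if M.Kill (M.rad k) S (x ω) (Y ω) then 1 else 0)) ∨
    ∃ G : Finset Ω, (∑ ω, m ω) / 96 ≤ ∑ ω ∈ G, m ω ∧
      ∀ ω ∈ G, M.HasMove m Y (Θ.filter (fun v => row v = ℓ ω) : Finset V) (M.Λ ^ k) (M.rad k)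
        (16 * θ) ((∑ ω, m ω) * α * M.Λ ^ (2 * k) / (128 * M.tvol Θ)) (x ω) := by
  have hΛ : (0 : ℝ) < M.Λ := by exact_mod_cast M.one_le_Λ
  set μ := ∑ ω, m ω with hμdef
  set F : Finset ℤ := Finset.univ.image ℓ with hF
  have hFℓ : ∀ ω, ℓ ω ∈ F := fun ω => Finset.mem_image_of_mem _ (Finset.mem_univ ω)
  set Θr : ℤ → Finset V := fun r => Θ.filter (fun v => row v = r) with hΘr
  set mr : ℤ → ℝ := fun r => ∑ ω with ℓ ω = r, m ω with hmr
  have hmr0 : ∀ r, 0 ≤ mr r := fun r => Finset.sum_nonneg (fun ω _ => hm ω)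
  have hfib : ∀ f : Ω → ℝ, ∑ r ∈ F, ∑ ω with ℓ ω = r, f ω = ∑ ω, f ω := fun f =>
    Finset.sum_fiberwise_of_maps_to (fun ω _ => hFℓ ω) f
  have hrow1 : ∀ r ∈ F, (M.Λ : ℝ) ^ k ≤ M.tvol (Θr r) := by
    intro r hr
    obtain ⟨ω, -, rfl⟩ := Finset.mem_image.1 hr
    exact (hY ω).pow_le_tvol
  have hvolsum : ∑ r ∈ F, M.tvol (Θr r) ≤ M.tvol Θ := by
    simp only [tvol, hΘr, Finset.sum_filter]
    rw [Finset.sum_comm]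
    refine Finset.sum_le_sum (fun v _ => ?_)
    rw [Finset.sum_ite_eq]
    split_ifs
    · exact le_rfl
    · exact M.vol_nonneg v
  have hFne : F.Nonempty := by
    by_contra h
    rw [Finset.not_nonempty_iff_eq_empty] at h
    have := hfib m
    rw [h] at this
    simp at this
    linarith
  have hv : 0 < M.tvol Θ := by
    obtain ⟨r, hr⟩ := hFne
    have h1 := hrow1 r hr
    have h2 : M.tvol (Θr r) ≤ M.tvol Θ :=
      Finset.sum_le_sum_of_subset_of_nonneg (Finset.filter_subset _ _) (fun v _ _ => M.vol_nonneg v)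
    exact lt_of_lt_of_le (by positivity) (h1.trans h2)
  -- A gain threshold common to all rows that hold at least half their volume-proportional share of
  -- mass: a smaller row volume compensates its smaller mass. The sparser rows hold at most μ/2
  -- together.
  set γ := μ * α * M.Λ ^ (2 * k) / (16 * M.tvol Θ) with hγdef
  have hγ : 0 < γ := by positivity
  have hγ8 : μ * α * M.Λ ^ (2 * k) / (128 * M.tvol Θ) = γ / 8 := by
    rw [hγdef]; field_simp; norm_num
  set Kt : ℤ → Prop := fun r => ∃ j S, (j < k ∨ S = []) ∧ (∀ v ∈ S, v ∈ Θr r) ∧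
      mr r / 2 * (q / 4) ≤ M.Λ ^ j * ∑ ω with ℓ ω = r, m ω * M.score k j S (Y ω) with hKt
  set At : ℤ → Prop := fun r => ∃ S : List V, (∀ v ∈ S, v ∈ Θr r) ∧
      mr r / 2 * (θ / (24 * M.Λ ^ k)) ≤
        ∑ ω with ℓ ω = r, m ω * (if M.Kill (M.rad k) S (x ω) (Y ω) then 1 else 0) with hAt
  set Bt : ℤ → Prop := fun r => ∃ G : Finset Ω, (∀ ω ∈ G, ℓ ω = r) ∧ mr r / 16 ≤ ∑ ω ∈ G, m ω ∧
      ∀ ω ∈ G, M.HasMove m Y (Θr r) (M.Λ ^ k) (M.rad k) (16 * θ) (γ / 8) (x ω) with hBt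
  have hrow : ∀ r ∈ F, μ / 2 * (M.tvol (Θr r) / M.tvol Θ) ≤ mr r → Kt r ∨ At r ∨ Bt r := by
    intro r hr hbig
    have hsub : ∀ f : Ω → ℝ, ∑ ω : {ω // ℓ ω = r}, f ω = ∑ ω with ℓ ω = r, f ω :=
      fun f => (Finset.sum_subtype _ (by simp) f).symm
    have hvr : 0 < M.tvol (Θr r) := lt_of_lt_of_le (by positivity) (hrow1 r hr)
    have := hM.row hα hq (Θr r) (Ω := {ω // ℓ ω = r}) (fun ω => m ω) (fun ω => hm ω) (fun ω => x ω)
      (fun ω => Y ω) (fun ω => by have := hY ω; rwa [ω.2] at this) (fun ω => hfar ω) hθ hθ1 hγ (by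
        rw [hsub]
        have h1 := mul_le_mul_of_nonneg_right hbig
          (show 0 ≤ α * M.Λ ^ (2 * k) / M.tvol (Θr r) / 8 by positivity)
        calc γ = μ / 2 * (M.tvol (Θr r) / M.tvol Θ) * (α * M.Λ ^ (2 * k) / M.tvol (Θr r) / 8) := by
              rw [hγdef]; field_simp; norm_num
          _ ≤ _ := h1
          _ = _ := by ring)
    rw [hsub] at this
    rcases this with ⟨j, S, h1, h2, h3⟩ | ⟨S, h1, h2⟩ | ⟨G, h1, h2⟩
    · left
      rw [hsub (fun ω => m ω * M.score k j S (Y ω))] at h3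
      exact ⟨j, S, h1, h2, h3⟩
    · right; left
      rw [hsub (fun ω => m ω * (if M.Kill (M.rad k) S (x ω) (Y ω) then 1 else 0))] at h2
      exact ⟨S, h1, h2⟩
    · right; right
      refine ⟨G.map (Function.Embedding.subtype _), fun ω hω => ?_, ?_, fun ω hω => ?_⟩
      · obtain ⟨ω', -, rfl⟩ := Finset.mem_map.1 hω
        exact ω'.2
      · rw [Finset.sum_map]
        exact h1
      · obtain ⟨ω', hω', rfl⟩ := Finset.mem_map.1 hω
        exact (h2 ω' hω').of_subtype (by positivity)
  have hmass : μ / 2 ≤ ∑ r ∈ F with Kt r, mr r + ∑ r ∈ F with At r, mr r +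
      ∑ r ∈ F with Bt r, mr r := by
    have h1 : ∀ r ∈ F, mr r ≤ ((if Kt r then mr r else 0) + (if At r then mr r else 0) +
        (if Bt r then mr r else 0)) + μ / 2 * (M.tvol (Θr r) / M.tvol Θ) := by
      intro r hr
      have h0 := hmr0 r
      have hvr : 0 ≤ μ / 2 * (M.tvol (Θr r) / M.tvol Θ) := by
        have : 0 ≤ M.tvol (Θr r) := (by positivity : (0 : ℝ) ≤ M.Λ ^ k).trans (hrow1 r hr)
        positivity
      have hi : ∀ (p : Prop) [Decidable p], 0 ≤ if p then mr r else 0 := fun p _ => by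
        split_ifs <;> simp [h0]
      have hk := hi (Kt r)
      have hA := hi (At r)
      have hB := hi (Bt r)
      by_cases hbig : μ / 2 * (M.tvol (Θr r) / M.tvol Θ) ≤ mr r
      · rcases hrow r hr hbig with h | h | h
        · rw [if_pos h]; linarith
        · rw [if_pos h]; linarith
        · rw [if_pos h]; linarith
      · linarith
    have h2 := Finset.sum_le_sum h1
    rw [hfib m, Finset.sum_add_distrib, Finset.sum_add_distrib, Finset.sum_add_distrib,
      ← Finset.mul_sum, ← Finset.sum_div] at h2
    have h3 : μ / 2 * ((∑ r ∈ F, M.tvol (Θr r)) / M.tvol Θ) ≤ μ / 2 * 1 :=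
      mul_le_mul_of_nonneg_left ((div_le_one hv).2 hvolsum) (by positivity)
    simp only [Finset.sum_filter]
    linarith
  by_cases hK6 : μ / 6 ≤ ∑ r ∈ F with Kt r, mr r
  · left
    have hch : ∀ r, ∃ (j : ℕ) (S : List V), (∀ v ∈ S, row v = r ∧ v ∈ Θ) ∧ (Kt r →
        (j < k ∨ S = []) ∧
        mr r / 2 * (q / 4) ≤ M.Λ ^ j * ∑ ω with ℓ ω = r, m ω * M.score k j S (Y ω)) := by
      intro r
      by_cases h : Kt r
      · obtain ⟨j, S, h1, h2, h3⟩ := h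
        exact ⟨j, S, fun v hv => (Finset.mem_filter.1 (h2 v hv)).symm, fun _ => ⟨h1, h3⟩⟩
      · exact ⟨0, [], by simp, fun h' => absurd h' h⟩
    choose j S hSr hS using hch
    -- Lists of higher rows come first. A centre within the radius of a window vertex lies in a row
    -- no higher than that of the window, so the earlier lists do not interfere.
    choose SS hSS1 hSS2 using fun jj =>
      exists_concat_decreasing S (F.filter (fun r => Kt r ∧ j r = jj))
    have hle : ∀ r ∈ F.filter Kt, mr r / 2 * (q / 4) ≤ ∑ jj ∈ Finset.range k,
        M.Λ ^ jj * ∑ ω with ℓ ω = r, m ω * M.score k jj (SS jj) (Y ω) := by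
      intro r hr
      obtain ⟨hrF, hrK⟩ := Finset.mem_filter.1 hr
      obtain ⟨h1, h2⟩ := hS r hrK
      have hnn : ∀ jj ∈ Finset.range k,
          0 ≤ (M.Λ : ℝ) ^ jj * ∑ ω with ℓ ω = r, m ω * M.score k jj (SS jj) (Y ω) := fun jj _ =>
        mul_nonneg (by positivity)
          (Finset.sum_nonneg (fun ω _ => mul_nonneg (hm ω) (score_nonneg _ _ _ _)))
      rcases h1 with h1 | h1
      · refine le_trans (h2.trans ?_) (Finset.single_le_sum hnn (Finset.mem_range.2 h1))
        refine mul_le_mul_of_nonneg_left (Finset.sum_le_sum (fun ω hω =>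
          mul_le_mul_of_nonneg_left ?_ (hm ω))) (by positivity)
        obtain ⟨S₀, S₃, h3, h4⟩ := hSS2 (j r) r (Finset.mem_filter.2 ⟨hrF, hrK, rfl⟩)
        rw [h3]
        refine score_append_le (hY ω).far _ _ _ (fun c hc i hi hi' => ?_)
        obtain ⟨r', hr', hc'⟩ := h4 c hc
        by_contra hcon
        push Not at hcon
        have h5 := hnY ω _ c ⟨i, hi, hi', rfl⟩ (hcon.trans (hrad _ h1))
        rw [(Finset.mem_filter.1 hω).2, (hSr r' c hc').1] at h5
        omega
      · simp only [h1, score_nil, mul_zero, Finset.sum_const_zero] at h2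
        exact h2.trans (Finset.sum_nonneg hnn)
    have hsum := Finset.sum_le_sum hle
    rw [← Finset.sum_mul, ← Finset.sum_div] at hsum
    have h6 : μ * q / 48 ≤ ∑ jj ∈ Finset.range k,
        (M.Λ ^ jj * ∑ ω, m ω * M.score k jj (SS jj) (Y ω)) := by
      calc μ * q / 48 = μ / 6 / 2 * (q / 4) := by ring
        _ ≤ (∑ r ∈ F with Kt r, mr r) / 2 * (q / 4) := by gcongr
        _ ≤ _ := hsum
        _ ≤ ∑ r ∈ F, ∑ jj ∈ Finset.range k,
            M.Λ ^ jj * ∑ ω with ℓ ω = r, m ω * M.score k jj (SS jj) (Y ω) := by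
            refine Finset.sum_le_sum_of_subset_of_nonneg (Finset.filter_subset _ _)
              (fun r _ _ => Finset.sum_nonneg (fun jj _ => mul_nonneg (by positivity)
              (Finset.sum_nonneg (fun ω _ => mul_nonneg (hm ω) (score_nonneg _ _ _ _)))))
        _ = _ := by
            rw [Finset.sum_comm]
            refine Finset.sum_congr rfl (fun jj _ => ?_)
            rw [← Finset.mul_sum, hfib]
    have hk : 0 < k := by
      by_contra h0
      have : k = 0 := by omega
      subst this
      simp only [Finset.range_zero, Finset.sum_empty] at h6
      have : 0 < μ * q / 48 := by positivity
      linarith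
    have hk' : (0 : ℝ) < k := by exact_mod_cast hk
    have h7 : ∑ jj ∈ Finset.range k, μ * q / (48 * k) ≤ ∑ jj ∈ Finset.range k,
        (M.Λ ^ jj * ∑ ω, m ω * M.score k jj (SS jj) (Y ω)) := by
      refine le_trans (le_of_eq ?_) h6
      rw [Finset.sum_const, Finset.card_range, nsmul_eq_mul]
      field_simp
    obtain ⟨jj, hjj, h8⟩ := Finset.exists_le_of_sum_le (Finset.nonempty_range_iff.2 hk.ne') h7
    refine ⟨jj, Finset.mem_range.1 hjj, SS jj, fun v hv => ?_, ?_⟩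
    · obtain ⟨r, -, hv'⟩ := hSS1 jj v hv
      exact (hSr r v hv').2
    · calc μ * (q / (48 * k * M.Λ ^ jj)) = μ * q / (48 * k) / M.Λ ^ jj := by field_simp
        _ ≤ _ := by
          rw [div_le_iff₀ (by positivity)]
          exact h8.trans_eq (mul_comm _ _)
  by_cases hA6 : μ / 6 ≤ ∑ r ∈ F with At r, mr r
  · right; left
    have hch : ∀ r, ∃ S : List V, (∀ v ∈ S, row v = r ∧ v ∈ Θ) ∧ (At r →
        mr r / 2 * (θ / (24 * M.Λ ^ k)) ≤
        ∑ ω with ℓ ω = r, m ω * (if M.Kill (M.rad k) S (x ω) (Y ω) then 1 else 0)) := by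
      intro r
      by_cases h : At r
      · obtain ⟨S, h2, h3⟩ := h
        exact ⟨S, fun v hv => (Finset.mem_filter.1 (h2 v hv)).symm, fun _ => h3⟩
      · exact ⟨[], by simp, fun h' => absurd h' h⟩
    choose S hSr hS using hch
    obtain ⟨SS, hSS1, hSS2⟩ := exists_concat_decreasing S (F.filter At)
    have hnn : ∀ ω, 0 ≤ m ω * (if M.Kill (M.rad k) SS (x ω) (Y ω) then (1 : ℝ) else 0) := fun ω => by
      have := hm ω
      split_ifs <;> simp [this]
    refine ⟨SS, fun v hv => ?_, ?_⟩
    · obtain ⟨r, -, hv'⟩ := hSS1 v hv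
      exact (hSr r v hv').2
    · calc μ * (θ / (288 * M.Λ ^ k)) = μ / 6 / 2 * (θ / (24 * M.Λ ^ k)) := by field_simp; norm_num
        _ ≤ (∑ r ∈ F with At r, mr r) / 2 * (θ / (24 * M.Λ ^ k)) := by gcongr
        _ = ∑ r ∈ F with At r, mr r / 2 * (θ / (24 * M.Λ ^ k)) := by
            rw [← Finset.sum_mul, ← Finset.sum_div]
        _ ≤ ∑ r ∈ F with At r, ∑ ω with ℓ ω = r,
            m ω * (if M.Kill (M.rad k) SS (x ω) (Y ω) then (1 : ℝ) else 0) := by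
            refine Finset.sum_le_sum (fun r hr => ?_)
            obtain ⟨hrF, hrA⟩ := Finset.mem_filter.1 hr
            refine (hS r hrA).trans (Finset.sum_le_sum (fun ω hω =>
              mul_le_mul_of_nonneg_left ?_ (hm ω)))
            by_cases hK : M.Kill (M.rad k) (S r) (x ω) (Y ω)
            · obtain ⟨S₀, S₃, h3, h4⟩ := hSS2 r hr
              have : M.Kill (M.rad k) SS (x ω) (Y ω) := by
                rw [h3]
                refine hK.append _ _ (fun c hc => ?_)
                obtain ⟨r', hr', hc'⟩ := h4 c hc
                by_contra hcon
                push Not at hcon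
                have h5 := hnx ω c hcon
                rw [(Finset.mem_filter.1 hω).2, (hSr r' c hc').1] at h5
                omega
              rw [if_pos hK, if_pos this]
            · rw [if_neg hK]
              split_ifs <;> simp
        _ ≤ ∑ r ∈ F, ∑ ω with ℓ ω = r,
            m ω * (if M.Kill (M.rad k) SS (x ω) (Y ω) then (1 : ℝ) else 0) :=
            Finset.sum_le_sum_of_subset_of_nonneg (Finset.filter_subset _ _)
              (fun r _ _ => Finset.sum_nonneg (fun ω _ => hnn ω))
        _ = _ := hfib _
  · right; right
    have hB6 : μ / 6 ≤ ∑ r ∈ F with Bt r, mr r := by linarith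
    have hch : ∀ r, ∃ G : Finset Ω, Bt r → (∀ ω ∈ G, ℓ ω = r) ∧ mr r / 16 ≤ ∑ ω ∈ G, m ω ∧
        ∀ ω ∈ G, M.HasMove m Y (Θr r) (M.Λ ^ k) (M.rad k) (16 * θ) (γ / 8) (x ω) := by
      intro r
      by_cases h : Bt r
      · obtain ⟨G, hG⟩ := h
        exact ⟨G, fun _ => hG⟩
      · exact ⟨∅, fun h' => absurd h' h⟩
    choose G hG using hch
    refine ⟨(F.filter Bt).biUnion G, ?_, fun ω hω => ?_⟩
    · rw [Finset.sum_biUnion]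
      · calc μ / 96 = μ / 6 / 16 := by ring
          _ ≤ (∑ r ∈ F with Bt r, mr r) / 16 := by gcongr
          _ ≤ _ := by
            rw [Finset.sum_div]
            exact Finset.sum_le_sum (fun r hr => (hG r (Finset.mem_filter.1 hr).2).2.1)
      · intro r hr r' hr' hne
        rw [Function.onFun, Finset.disjoint_left]
        intro ω h1 h2
        exact hne (((hG r (Finset.mem_filter.1 hr).2).1 ω h1).symm.trans
          ((hG r' (Finset.mem_filter.1 hr').2).1 ω h2))
    · obtain ⟨r, hr, hω⟩ := Finset.mem_biUnion.1 hω
      have h1 := hG r (Finset.mem_filter.1 hr).2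
      rw [hγ8, h1.1 ω hω]
      exact h1.2.2 ω hω

end Frame

/-! ### Flat windows and the increase of the value -/

/-- Sums over overlapping runs of `g + 1` consecutive terms. -/
theorem sum_runs_le (f : ℕ → ℝ) (g m : ℕ) (hf : ∀ i < m, 0 ≤ f i) :
    ∑ i ∈ Finset.Ico g m, ∑ j ∈ Finset.Ico (i - g) (i + 1), f j ≤
      (g + 1) * ∑ j ∈ Finset.range m, f j := by
  have h1 : ∀ i ∈ Finset.Ico g m, ∑ j ∈ Finset.Ico (i - g) (i + 1), f j =
      ∑ r ∈ Finset.range (g + 1), f (i - g + r) := by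
    intro i hi
    rw [Finset.mem_Ico] at hi
    rw [Finset.sum_Ico_eq_sum_range]
    congr 2
    omega
  rw [Finset.sum_congr rfl h1, Finset.sum_comm]
  have h2 : ∀ r ∈ Finset.range (g + 1), ∑ i ∈ Finset.Ico g m, f (i - g + r) ≤
      ∑ j ∈ Finset.range m, f j := by
    intro r hr
    rw [Finset.mem_range] at hr
    have hinj : Set.InjOn (fun i => i - g + r) (Finset.Ico g m : Finset ℕ) := by
      intro i hi j hj hij
      simp only [Finset.coe_Ico, Set.mem_Ico] at hi hj hij
      omega
    rw [← Finset.sum_image (f := f) (g := fun i => i - g + r) hinj]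
    refine Finset.sum_le_sum_of_subset_of_nonneg (fun j hj => ?_)
      (fun j hj _ => hf j (Finset.mem_range.1 hj))
    obtain ⟨i, hi, rfl⟩ := Finset.mem_image.1 hj
    rw [Finset.mem_Ico] at hi
    rw [Finset.mem_range]
    omega
  refine (Finset.sum_le_sum h2).trans (le_of_eq ?_)
  rw [Finset.sum_const, Finset.card_range, nsmul_eq_mul]
  push_cast
  ring

/-- Markov's inequality for finite sums. -/
theorem card_filter_mul_le_sum {ι : Type*} (s : Finset ι) (p : ι → Prop) [DecidablePred p]
    (f : ι → ℝ) (c : ℝ) (hf : ∀ i ∈ s, 0 ≤ f i) (hp : ∀ i ∈ s, p i → c ≤ f i) :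
    ((s.filter p).card : ℝ) * c ≤ ∑ i ∈ s, f i := by
  rw [← nsmul_eq_mul, ← Finset.sum_const]
  refine (Finset.sum_le_sum (fun i hi => ?_)).trans
    (Finset.sum_le_sum_of_subset_of_nonneg (Finset.filter_subset p s) (fun i hi _ => hf i hi))
  rw [Finset.mem_filter] at hi
  exact hp i hi.1 hi.2

namespace Frame
variable {V : Type*} {M : Frame V}

/-- The window is short and `f` is almost constant from its source to its end. -/
def Flat (M : Frame V) (k : ℕ) (f : V → ℝ) (h : ℝ) (s : Seg V) (i : ℕ) : Prop :=
  (M.win (M.Λ ^ k) s i).len M.w ≤ M.A k * M.Λ ^ k ∧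
    ∀ t, M.cut (M.Λ ^ k) s (i - M.lag k) ≤ t → t ≤ M.cut (M.Λ ^ k) s (i + 1) →
      |f (s.p t) - f (M.src k s i)| ≤ h

-- Long windows are few by Markov, since the length per window is allowed to grow by a factor 40
-- from level k+1 to level k. A function that rises by at most `lam` times the length and stays in
-- [0, Vm] has bounded variation along the path, so it oscillates much on few runs of windows.
open Classical in
theorem Lvl.many_flat {k : ℕ} {Θ : Set V} {s : Seg V} (hs : M.Lvl (k + 1) Θ s) (f : V → ℝ)
    {lam Vm h : ℝ} (hlam : 0 ≤ lam) (hf : ∀ u v, f v - lam * M.dn u v ≤ f u) (hf0 : ∀ v, 0 ≤ f v)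
    (hfm : ∀ v, f v ≤ Vm) (hA : 40 * M.A (k + 1) ≤ M.A k) (hA0 : 0 < M.A k)
    (hΛ : 4 * (M.lag k + 1) ≤ M.Λ) (hh : 0 < h)
    (hb : (M.lag k + 1) * (2 * lam * (M.A (k + 1) * M.Λ ^ (k + 1)) + Vm) * 40 ≤ M.Λ * h) :
    (M.Λ : ℝ) / 5 ≤ ((Finset.Ico (M.lag k) (M.Λ / 2)).filter (M.Flat k f h s)).card := by
  have hR := M.one_le_pow k
  have hΛ0 : (0 : ℝ) < M.Λ := by exact_mod_cast M.one_le_Λ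
  set R : ℝ := (M.Λ : ℝ) ^ k with hRdef
  set g := M.lag k with hg
  set I := Finset.Ico g (M.Λ / 2) with hI
  have hcm : ∀ {i j : ℕ}, i ≤ j → M.cut R s i ≤ M.cut R s j := fun hij => cut_mono (by linarith) hij
  have hcb : ∀ {i : ℕ}, i ≤ M.Λ / 2 → M.cut R s i ≤ s.b := fun hi => cut_le_of_far hs.far hi
  have hca : ∀ i, s.a ≤ M.cut R s i := fun i => (cut_spec i).1
  -- An increment bounded above by `lam * w` has absolute value at most `F`, and `F` telescopes up
  -- to the length term.
  set F : ℕ → ℝ := fun t => 2 * lam * M.w (s.p t) (s.p (t + 1)) - (f (s.p (t + 1)) - f (s.p t))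
    with hF
  have hFD : ∀ t, s.a ≤ t → t < s.b → |f (s.p (t + 1)) - f (s.p t)| ≤ F t := by
    intro t h1 h2
    have h3 := hf (s.p t) (s.p (t + 1))
    have h4 := mul_le_mul_of_nonneg_left (M.dn_le_w _ _ (hs.far.1.2.1 t h1 h2)) hlam
    have h5 := mul_nonneg hlam (M.w_nonneg (s.p t) (s.p (t + 1)))
    rw [abs_le]
    constructor <;> simp only [hF] <;> linarith
  have hF0 : ∀ t, s.a ≤ t → t < s.b → 0 ≤ F t := fun t h1 h2 => (abs_nonneg _).trans (hFD t h1 h2)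
  have hosc : ∀ c t, s.a ≤ c → c ≤ t → t ≤ s.b →
      |f (s.p t) - f (s.p c)| ≤ ∑ j ∈ Finset.Ico c t, F j := by
    intro c t hc hct
    induction t, hct using Nat.le_induction with
    | base => intro _; simp
    | succ t hct ih =>
      intro htb
      rw [Finset.sum_Ico_succ_top hct]
      have h1 := ih (by omega)
      have h2 := hFD t (by omega) (by omega)
      have h3 := abs_add_le (f (s.p (t + 1)) - f (s.p t)) (f (s.p t) - f (s.p c))
      rw [sub_add_sub_cancel] at h3
      linarith
  have htot : ∑ t ∈ Finset.Ico s.a s.b, F t ≤ 2 * lam * (M.A (k + 1) * M.Λ ^ (k + 1)) + Vm := by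
    have h1 : ∑ t ∈ Finset.Ico s.a s.b, (f (s.p (t + 1)) - f (s.p t)) = f (s.p s.b) - f (s.p s.a) :=
      Finset.sum_Ico_sub (fun t => f (s.p t)) hs.far.1.1
    simp only [hF]
    rw [Finset.sum_sub_distrib, h1, ← Finset.mul_sum]
    have h2 := mul_le_mul_of_nonneg_left hs.len_le (show 0 ≤ 2 * lam by linarith)
    rw [Seg.len] at h2
    have := hf0 (s.p s.b)
    have := hfm (s.p s.a)
    linarith
  set B : ℕ → ℝ := fun j => ∑ t ∈ Finset.Ico (M.cut R s j) (M.cut R s (j + 1)), F t with hB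
  have hB0 : ∀ j < M.Λ / 2, 0 ≤ B j := by
    intro j hj
    refine Finset.sum_nonneg (fun t ht => ?_)
    rw [Finset.mem_Ico] at ht
    exact hF0 t ((hca j).trans ht.1) (lt_of_lt_of_le ht.2 (hcb (by omega)))
  have hBsum : ∑ j ∈ Finset.range (M.Λ / 2), B j ≤
      2 * lam * (M.A (k + 1) * M.Λ ^ (k + 1)) + Vm := by
    refine le_trans ?_ htot
    rw [Finset.range_eq_Ico, sum_blocks (M.cut R s) (fun i j hij => hcm hij) F (Nat.zero_le _)]
    refine Finset.sum_le_sum_of_subset_of_nonneg (Finset.Ico_subset_Ico (hca 0) (hcb le_rfl))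
      (fun t ht _ => ?_)
    rw [Finset.mem_Ico] at ht
    exact hF0 t ht.1 ht.2
  set D : ℕ → ℝ := fun i => ∑ j ∈ Finset.Ico (i - g) (i + 1), B j with hD
  have hDsum : ∑ i ∈ I, D i * 40 ≤ M.Λ * h := by
    rw [← Finset.sum_mul]
    refine le_trans ?_ hb
    refine mul_le_mul_of_nonneg_right ?_ (by norm_num)
    exact (sum_runs_le B g (M.Λ / 2) hB0).trans (mul_le_mul_of_nonneg_left hBsum (by positivity))
  have hD0 : ∀ i ∈ I, 0 ≤ D i := by
    intro i hi
    rw [hI, Finset.mem_Ico] at hi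
    refine Finset.sum_nonneg (fun j hj => ?_)
    rw [Finset.mem_Ico] at hj
    exact hB0 j (by omega)
  have hDosc : ∀ i ∈ I, ∀ t, M.cut R s (i - g) ≤ t → t ≤ M.cut R s (i + 1) →
      |f (s.p t) - f (M.src k s i)| ≤ D i := by
    intro i hi t h1 h2
    rw [hI, Finset.mem_Ico] at hi
    have h3 : M.cut R s (i + 1) ≤ s.b := hcb (by omega)
    refine (hosc _ t (hca _) h1 (h2.trans h3)).trans ?_
    simp only [hD, hB]
    rw [sum_blocks (M.cut R s) (fun i j hij => hcm hij) F (by omega : i - g ≤ i + 1)]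
    refine Finset.sum_le_sum_of_subset_of_nonneg (Finset.Ico_subset_Ico le_rfl h2)
      (fun t ht _ => ?_)
    rw [Finset.mem_Ico] at ht
    exact hF0 t ((hca _).trans ht.1) (lt_of_lt_of_le ht.2 h3)
  set b1 := I.filter (fun i => M.A k * R < (M.win R s i).len M.w) with hb1
  set b2 := I.filter (fun i => h < D i) with hb2
  have hlen0 : ∀ i, 0 ≤ (M.win R s i).len M.w := fun i =>
    Finset.sum_nonneg (fun _ _ => M.w_nonneg _ _)
  have hcard1 : (b1.card : ℝ) ≤ M.Λ / 40 := by
    have h1 := card_filter_mul_le_sum I (fun i => M.A k * R < (M.win R s i).len M.w)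
      (fun i => (M.win R s i).len M.w) (M.A k * R) (fun i _ => hlen0 i) (fun i _ h => h.le)
    have h2 : ∑ i ∈ I, (M.win R s i).len M.w ≤ M.A (k + 1) * M.Λ ^ (k + 1) :=
      (Finset.sum_le_sum_of_subset_of_nonneg (Finset.Ico_subset_Ico (Nat.zero_le _) le_rfl)
        (fun i _ _ => hlen0 i)).trans ((sum_len_win_le hs.far).trans hs.len_le)
    have hA' : (40 : ℝ) * M.A (k + 1) ≤ M.A k := by exact_mod_cast hA
    have hA0' : (0 : ℝ) < M.A k := by exact_mod_cast hA0
    have h3 : (b1.card : ℝ) * (M.A k * R) ≤ M.Λ / 40 * (M.A k * R) := by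
      refine h1.trans (h2.trans ?_)
      rw [pow_succ]
      have := mul_le_mul_of_nonneg_right hA' (show 0 ≤ R * M.Λ by positivity)
      linarith
    exact le_of_mul_le_mul_right h3 (by positivity)
  have hcard2 : (b2.card : ℝ) ≤ M.Λ / 40 := by
    have h1 := card_filter_mul_le_sum I (fun i => h < D i) D h hD0 (fun i _ h => h.le)
    rw [← Finset.sum_mul] at hDsum
    have h3 : (b2.card : ℝ) * h ≤ M.Λ / 40 * h := by linarith
    exact le_of_mul_le_mul_right h3 hh
  have hcov : I ⊆ I.filter (M.Flat k f h s) ∪ (b1 ∪ b2) := by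
    intro i hi
    simp only [Finset.mem_union, hb1, hb2, Finset.mem_filter, hi, true_and]
    by_contra hcon
    push Not at hcon
    exact hcon.1 ⟨hcon.2.1, fun t h1 h2 => (hDosc i hi t h1 h2).trans hcon.2.2⟩
  have hc := (Finset.card_le_card hcov).trans
    ((Finset.card_union_le _ _).trans (Nat.add_le_add_left (Finset.card_union_le _ _) _))
  rw [hI, Nat.card_Ico] at hc
  have hc' : (((M.Λ / 2 - g : ℕ)) : ℝ) ≤ (I.filter (M.Flat k f h s)).card + (b1.card + b2.card) := by
    exact_mod_cast hc
  -- The count is Λ/2 - (g + 1) - 2·Λ/40 ≥ Λ/2 - Λ/4 - Λ/20 = Λ/5.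
  have h5 : (M.Λ : ℝ) / 2 - 1 - g ≤ ((M.Λ / 2 - g : ℕ) : ℝ) := by
    have h6 : M.Λ ≤ 2 * (M.Λ / 2 - g) + 2 * g + 1 := by omega
    have h7 : (M.Λ : ℝ) ≤ 2 * ((M.Λ / 2 - g : ℕ) : ℝ) + 2 * g + 1 := by exact_mod_cast h6
    linarith
  have h8 : (4 : ℝ) * (g + 1) ≤ M.Λ := by exact_mod_cast hΛ
  linarith

end Frame

theorem Finset.card_le_of_forall_le_add (T : Finset ℕ) (d : ℕ)
    (h : ∀ i ∈ T, ∀ i' ∈ T, i < i' → i' ≤ i + d) : T.card ≤ d + 1 := by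
  rcases T.eq_empty_or_nonempty with rfl | hT
  · simp
  · have hsub : T ⊆ Finset.Icc (T.min' hT) (T.min' hT + d) := by
      intro i hi
      have h1 := T.min'_le i hi
      rw [Finset.mem_Icc]
      refine ⟨h1, ?_⟩
      rcases h1.lt_or_eq with h2 | h2
      · exact h _ (T.min'_mem hT) i hi h2
      · omega
    have := Finset.card_le_card hsub
    rw [Nat.card_Icc] at this
    omega

open Classical in
theorem sum_subtype_windows {ι : Type*} [Fintype ι] (g m : ℕ) (p : ι → ℕ → Prop)
    [Fintype {z : ι × Fin m // g ≤ (z.2 : ℕ) ∧ p z.1 z.2}] (F : ι → ℕ → ℝ) :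
    ∑ z : {z : ι × Fin m // g ≤ (z.2 : ℕ) ∧ p z.1 z.2}, F z.1.1 z.1.2 =
      ∑ x, ∑ i ∈ (Finset.Ico g m).filter (p x), F x i := by
  rw [← Finset.sum_subtype (Finset.univ.filter
    (fun z : ι × Fin m => g ≤ (z.2 : ℕ) ∧ p z.1 z.2)) (by simp)
    (fun z : ι × Fin m => F z.1 z.2), Finset.sum_filter, Fintype.sum_prod_type]
  refine Finset.sum_congr rfl (fun x _ => ?_)
  rw [Fin.sum_univ_eq_sum_range (fun i => if g ≤ i ∧ p x i then F x i else 0) m,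
    ← Finset.sum_filter]
  refine Finset.sum_congr ?_ (fun _ _ => rfl)
  ext i
  simp only [Finset.mem_filter, Finset.mem_range, Finset.mem_Ico]
  tauto

namespace Frame
variable {V : Type*} {M : Frame V}

open Classical in
/-- A diffuse move with window claims is an admissible move of a plan. -/
theorem HasMove.le_value {k : ℕ} {Θ Θ' : Set V} {ι : Type} [Fintype ι] {P : ι → Seg V}
    (hP : ∀ x, M.Lvl (k + 1) Θ (P x)) (hH : (M.Λ : ℝ) ^ k ≤ M.H) {η : ι → ℝ} (hη : ∀ x, 0 ≤ η x)
    {Ω : Type} [Fintype Ω] (X : Ω → ι) (I : Ω → ℕ) (hI : ∀ z, I z < M.Λ / 2)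
    (hXI : ∀ z z', X z = X z' → I z = I z' → z = z')
    (hp : ∀ z, (M.win (M.Λ ^ k) (P (X z)) (I z)).len M.w ≤ M.A k * M.Λ ^ k)
    {ρ δ γ lam ψ e : ℝ}
    (hlam : 0 ≤ lam) (hδ : 0 ≤ δ) (hψ : M.Λ * δ ≤ ψ) (hΘ : Θ' ⊆ Θ) {v : V} {n : ℕ}
    (h : M.HasMove (fun z => η (X z)) (fun z => M.win (M.Λ ^ k) (P (X z)) (I z)) Θ' (M.Λ ^ k)
      ρ δ γ v)
    (he : ∀ u ∈ Θ', e ≤ Plan.value M.dn P Θ (M.Λ ^ k) ψ η lam n u) :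
    γ / M.lag k - lam * ρ + e ≤ Plan.value M.dn P Θ (M.Λ ^ k) ψ η lam (n + 1) v := by
  obtain ⟨κ, hκ, pr, C, hC, cl, h1, h2, h3, h4, h5, h6, h7, h8, h9⟩ := h
  have hlag : (1 : ℝ) ≤ M.lag k := by
    have : 1 ≤ M.lag k := by simp [lag]
    exact_mod_cast this
  have hR := M.one_le_pow k
  set e' := Fintype.equivFin κ with he'
  have hre : ∀ g : κ → ℝ, ∑ i, g (e'.symm i) = ∑ b, g b := fun g => e'.symm.sum_comp g
  -- By `touch_near` a block meets at most A k + 2 = `lag k` of the selected windows of one path, so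
  -- this average of window claims is a legitimate claim on the path.
  set φ : κ → ι → ℝ := fun b x => (∑ z : Ω with (X z) = x, cl b z) / M.lag k with hφ
  have hψ0 : 0 ≤ ψ := le_trans (by positivity) hψ
  have hinj : ∀ x, Set.InjOn I {z | (X z) = x} := by
    intro x z hz z' hz' hzz
    exact hXI z z' (hz.trans hz'.symm) hzz
  have hcount : ∀ b x, ((Finset.univ.filter (fun z : Ω => (X z) = x ∧
      (M.win (M.Λ ^ k) (P (X z)) (I z)).Touch (C b))).card : ℝ) ≤ M.lag k := by
    intro b x
    rw [← Finset.card_image_of_injOn (f := fun z : Ω => I z)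
      ((hinj x).mono (fun z hz => by
        simp only [Finset.coe_filter, Finset.mem_univ, true_and, Set.mem_ofPred_eq] at hz
        exact hz.1))]
    have := Finset.card_le_of_forall_le_add (Finset.image I
      (Finset.univ.filter (fun z : Ω => (X z) = x ∧
      (M.win (M.Λ ^ k) (P (X z)) (I z)).Touch (C b)))) (M.A k + 1) (by
        intro i hi i' hi' hii
        obtain ⟨z, hz, rfl⟩ := Finset.mem_image.1 hi
        obtain ⟨z', hz', rfl⟩ := Finset.mem_image.1 hi'
        simp only [Finset.mem_filter, Finset.mem_univ, true_and] at hz hz'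
        have ht := hz.2
        have ht' := hz'.2
        have hs := hp z
        rw [hz.1] at ht hs
        rw [hz'.1] at ht'
        exact touch_near (hP x).far hH (h4 b) hii (hI z') hs ht ht')
    exact_mod_cast this
  have hφ0 : ∀ b x, 0 ≤ φ b x := fun b x =>
    div_nonneg (Finset.sum_nonneg (fun z _ => (h6 b z).1)) (by linarith)
  have hok : Plan.OkMove M.dn P Θ (M.Λ ^ k) ψ (fun i => pr (e'.symm i)) (fun i => C (e'.symm i))
      (fun i => φ (e'.symm i)) := by
    refine ⟨fun i => h1 _, (hre pr).trans h2, fun i v hv => hΘ (h3 _ v hv), fun i => h4 _,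
      fun i x => hφ0 _ x, fun i x => ?_, fun i x ht => ?_, fun x => ?_⟩
    · generalize e'.symm i = b
      rw [hφ]
      dsimp only
      rw [div_le_one (by linarith)]
      refine le_trans ?_ (hcount b x)
      rw [Finset.card_eq_sum_ones, Nat.cast_sum, ← Finset.filter_filter,
        Finset.sum_filter (s := Finset.univ.filter (fun z : Ω => (X z) = x))]
      refine Finset.sum_le_sum (fun z _ => ?_)
      split_ifs with ht
      · simpa using (h6 b z).2
      · exact (h7 b z ht).le
    · generalize e'.symm i = b at ht ⊢
      rw [hφ]
      dsimp only
      rw [Finset.sum_eq_zero, zero_div]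
      intro z hz
      refine h7 b z (fun hz' => ht ?_)
      obtain ⟨y, hy, t, ht1, ht2, rfl⟩ := hz'
      rw [← (Finset.mem_filter.1 hz).2]
      refine ⟨_, hy, t, (cut_spec (M := M) _).1.trans ht1, ht2.trans ?_, rfl⟩
      exact cut_le_of_far (hP _).far (hI z)
    · rw [hre (fun b => pr b * φ b x)]
      simp only [hφ, ← mul_div_assoc, Finset.mul_sum]
      rw [← Finset.sum_div, Finset.sum_comm, div_le_iff₀ (by linarith)]
      calc ∑ z : Ω with (X z) = x, ∑ b, pr b * cl b z
          ≤ ∑ z : Ω with (X z) = x, δ := Finset.sum_le_sum (fun z _ => h8 z)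
        _ = ((Finset.univ.filter (fun z : Ω => (X z) = x)).card : ℝ) * δ := by
            rw [Finset.sum_const, nsmul_eq_mul]
        _ ≤ M.Λ * δ := by
            refine mul_le_mul_of_nonneg_right ?_ hδ
            have : (Finset.univ.filter (fun z : Ω => (X z) = x)).card ≤ M.Λ / 2 := by
              rw [← Finset.card_image_of_injOn (f := fun z : Ω => I z)
                ((hinj x).mono (fun z hz => by simpa using hz))]
              refine (Finset.card_le_card (t := Finset.range (M.Λ / 2)) (fun i hi => ?_)).trans
                (by rw [Finset.card_range])
              obtain ⟨z, -, rfl⟩ := Finset.mem_image.1 hi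
              exact Finset.mem_range.2 (hI z)
            exact_mod_cast this.trans (Nat.div_le_self _ _)
        _ ≤ ψ := hψ
        _ ≤ ψ * M.lag k := le_mul_of_one_le_right hψ0 hlag
  refine Plan.le_value_succ M.dn_nonneg hψ0 hη hlam (fun i => hC _) hok v _ (fun i => ?_)
  generalize e'.symm i = b
  have hlast := he _ (h3 b _ (List.getLast_mem (hC b)))
  have hhead := mul_le_mul_of_nonneg_left (h5 b) hlam
  have hsum : γ / M.lag k ≤ ∑ x, η x * φ b x := by
    have e1 : ∑ x, η x * φ b x = (∑ z : Ω, η (X z) * cl b z) / M.lag k := by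
      rw [← Finset.sum_fiberwise (s := (Finset.univ : Finset Ω)) (g := fun z => (X z)),
        Finset.sum_div]
      refine Finset.sum_congr rfl (fun x _ => ?_)
      rw [hφ]
      dsimp only
      rw [← mul_div_assoc, Finset.mul_sum]
      congr 1
      exact Finset.sum_congr rfl (fun z hz => by rw [(Finset.mem_filter.1 hz).2])
    rw [e1]
    exact div_le_div_of_nonneg_right (h9 b) (by linarith)
  linarith

end Frame

namespace Frame
variable {V : Type*} {M : Frame V}

/-- All levels of `f` near `f v` have the same rounding. -/
def Steady (f : V → ℝ) (h σ : ℝ) (v : V) : Prop :=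
  ∀ y, f v - h / 32 ≤ y → y < f v - h / 32 + h / 8 →
    ⌊(y + σ) / (h / 4)⌋ = ⌊(f v - h / 32 + σ) / (h / 4)⌋

open Classical in
/-- If neither alternative of the dichotomy holds at level `k + 1`, allowing one more move raises
the value at many window sources. -/
theorem Dichotomy.value_increase {k : ℕ} {α q : ℝ} (hM : M.Dichotomy k α q) (hα : 0 < α)
    (hq : 0 < q) (hA : 40 * M.A (k + 1) ≤ M.A k) (hA0 : 0 < M.A k) (hΛ : 4 * (M.lag k + 1) ≤ M.Λ)
    (hH : (M.Λ : ℝ) ^ k ≤ M.H) (hrad : ∀ j < k, M.rad j ≤ M.rad k) {Θ : Finset V} {ι : Type}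
    [Fintype ι] {P : ι → Seg V} {η : ι → ℝ} (hη : ∀ x, 0 ≤ η x) (hη1 : ∑ x, η x = 1)
    (hP : ∀ x, M.Lvl (k + 1) Θ (P x)) {h lam τ q' : ℝ} (hh : 0 < h) (hlam : 0 ≤ lam)
    (hhdef : h * M.lag k ≤ M.Λ / 10 * α * M.Λ ^ (2 * k) / (128 * M.tvol Θ))
    (hb : (M.lag k + 1) * (2 * lam * (M.A (k + 1) * M.Λ ^ (k + 1)) + 4 * τ) * 40 ≤ M.Λ * (h / 32))
    (hlr : lam * M.rad k ≤ h / 32) {n : ℕ} {ψ : ℝ} (hψ : ψ = 1 / (2 * M.Λ))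
    (hval : ∀ v, Plan.value M.dn P Θ (M.Λ ^ k) ψ η lam n v ≤ 4 * τ)
    (hq1 : q' ≤ q / (480 * (k + 1))) (hq2 : q' ≤ 1 / (92160 * M.Λ ^ 2))
    (hno : ∀ j < k + 1, ∀ S : List V, (∀ v ∈ S, v ∈ Θ) →
      ∑ x, η x * M.score (k + 1) j S (P x) < q' / M.Λ ^ j) :
    M.Λ * h / 1920 ≤ ∑ x, η x * ∑ i ∈ Finset.Ico (M.lag k) (M.Λ / 2),
      (Plan.value M.dn P Θ (M.Λ ^ k) ψ η lam (n + 1) (M.src k (P x) i) -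
        Plan.value M.dn P Θ (M.Λ ^ k) ψ η lam n (M.src k (P x) i)) := by
  have hR := M.one_le_pow k
  have hΛ0 : (0 : ℝ) < M.Λ := by exact_mod_cast M.one_le_Λ
  have hΛ1 : (1 : ℝ) ≤ M.Λ := by exact_mod_cast M.one_le_Λ
  have hψ0 : 0 ≤ ψ := by rw [hψ]; positivity
  set f := Plan.value M.dn P Θ (M.Λ ^ k) ψ η lam n with hf
  have hf0 : ∀ v, 0 ≤ f v := Plan.value_nonneg M.dn_nonneg hψ0 hη hlam n
  have hfl : ∀ u v, f v - lam * M.dn u v ≤ f u :=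
    Plan.value_sub_le M.dn_tri M.dn_nonneg hψ0 hη hlam n
  have hmono : ∀ v, f v ≤ Plan.value M.dn P Θ (M.Λ ^ k) ψ η lam (n + 1) v :=
    Plan.value_mono M.dn_nonneg hψ0 hη hlam n
  have hflat : ∀ x, (M.Λ : ℝ) / 5 ≤
      ((Finset.Ico (M.lag k) (M.Λ / 2)).filter (M.Flat k f (h / 32) (P x))).card := fun x =>
    (hP x).many_flat f hlam hfl hf0 hval hA hA0 hΛ (by positivity) hb
  -- Each flat window is steady for at least one of the two offsets 0 and h/8, so one offset keeps
  -- half of the flat windows.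
  obtain ⟨σ, hσ⟩ : ∃ σ : ℝ, (M.Λ : ℝ) / 10 ≤ ∑ x, η x *
      (((Finset.Ico (M.lag k) (M.Λ / 2)).filter (fun i => M.Flat k f (h / 32) (P x) i ∧
        Steady f h σ (M.src k (P x) i))).card : ℝ) := by
    by_contra hcon
    push Not at hcon
    have h0 := hcon 0
    have h1 := hcon (h / 8)
    have h2 : ∑ x, η x * ((M.Λ : ℝ) / 5) ≤ ∑ x, η x *
      (((Finset.Ico (M.lag k) (M.Λ / 2)).filter (fun i => M.Flat k f (h / 32) (P x) i ∧
        Steady f h 0 (M.src k (P x) i))).card : ℝ) + ∑ x, η x *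
      (((Finset.Ico (M.lag k) (M.Λ / 2)).filter (fun i => M.Flat k f (h / 32) (P x) i ∧
        Steady f h (h / 8) (M.src k (P x) i))).card : ℝ) := by
      rw [← Finset.sum_add_distrib]
      refine Finset.sum_le_sum (fun x _ => ?_)
      rw [← mul_add]
      refine mul_le_mul_of_nonneg_left ((hflat x).trans ?_) (hη x)
      rw [← Nat.cast_add, Nat.cast_le]
      refine le_trans (Finset.card_le_card ?_) (Finset.card_union_le _ _)
      intro i hi
      rw [Finset.mem_filter] at hi
      rw [Finset.mem_union, Finset.mem_filter, Finset.mem_filter]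
      have e4 : h / 4 / 2 = h / 8 := by ring
      rcases exists_shift_floor_eq (h / 4) (f (M.src k (P x) i) - h / 32) (by positivity) with
        h3 | h3
      · left
        rw [e4] at h3
        refine ⟨hi.1, hi.2, fun y h4 h5 => ?_⟩
        rw [add_zero, add_zero]
        exact h3 y h4 h5
      · right
        rw [e4] at h3
        exact ⟨hi.1, hi.2, fun y h4 h5 => h3 y h4 h5⟩
    rw [← Finset.sum_mul, hη1] at h2
    linarith
  set p : ι → ℕ → Prop := fun x i => M.Flat k f (h / 32) (P x) i ∧
    Steady f h σ (M.src k (P x) i) with hp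
  set Ω := {z : ι × Fin (M.Λ / 2) // M.lag k ≤ (z.2 : ℕ) ∧ p z.1 z.2} with hΩ
  have hsumΩ : ∀ F : ι → ℕ → ℝ, ∑ z : Ω, F z.1.1 z.1.2 =
      ∑ x, ∑ i ∈ (Finset.Ico (M.lag k) (M.Λ / 2)).filter (p x), F x i :=
    fun F => by
      convert sum_subtype_windows (M.lag k) (M.Λ / 2) p F
  set μ := ∑ z : Ω, η z.1.1 with hμ
  have hμ1 : (M.Λ : ℝ) / 10 ≤ μ := by
    refine hσ.trans (le_of_eq ?_)
    rw [hμ, hsumΩ (fun x _ => η x)]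
    exact Finset.sum_congr rfl (fun x _ => by rw [Finset.sum_const, nsmul_eq_mul, mul_comm])
  have hμ0 : 0 < μ := lt_of_lt_of_le (by positivity) hμ1
  set row : V → ℤ := fun v => ⌊(f v + σ) / (h / 4)⌋ with hrow
  set ℓ : Ω → ℤ := fun z => ⌊(f (M.src k (P z.1.1) z.1.2) - h / 32 + σ) / (h / 4)⌋ with hℓ
  -- The slack h/16 covers h/32 for the oscillation within a window and h/32 for a step of length
  -- `rad k`.
  have hle_row : ∀ (z : Ω) c, f c ≤ f (M.src k (P z.1.1) z.1.2) + h / 16 → row c ≤ ℓ z := by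
    intro z c hc
    have h1 := z.2.2.2 (f (M.src k (P z.1.1) z.1.2) + h / 16) (by linarith) (by linarith)
    rw [hℓ]
    dsimp only
    rw [← h1]
    exact Int.floor_le_floor (by gcongr)
  have heq_row : ∀ (z : Ω) c, |f c - f (M.src k (P z.1.1) z.1.2)| ≤ h / 32 → row c = ℓ z := by
    intro z c hc
    rw [abs_le] at hc
    exact z.2.2.2 (f c) (by linarith) (by linarith)
  have hnear : ∀ u c, M.dn u c ≤ M.rad k → f c ≤ f u + h / 32 := by
    intro u c hc
    have h1 := hfl u c
    have h2 := mul_le_mul_of_nonneg_left hc hlam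
    linarith
  have hmemY : ∀ (z : Ω) y, (M.win (M.Λ ^ k) (P z.1.1) z.1.2).Mem y →
      |f y - f (M.src k (P z.1.1) z.1.2)| ≤ h / 32 := by
    rintro z y ⟨t, h1, h2, rfl⟩
    exact z.2.2.1.2 t ((cut_mono (by linarith) (Nat.sub_le _ _)).trans h1) h2
  have hlagR : (M.lag k : ℝ) = M.A k + 2 := by rw [lag]; push_cast; ring
  -- A lag of A + 2 windows gives distance at least 2(A + 2)R - 1 > 2AR + R, where A = A k and R =
  -- Λ^k.
  have hfar : ∀ (z : Ω) y, (M.win (M.Λ ^ k) (P z.1.1) z.1.2).Mem y →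
      M.rad k + M.Λ ^ k < M.df (M.src k (P z.1.1) z.1.2) y := by
    rintro z y ⟨t, h1, h2, rfl⟩
    have hz : (z.1.2 : ℕ) < M.Λ / 2 := z.1.2.2
    have h3 := far_df (hP z.1.1).far (i := z.1.2 - M.lag k) (i' := z.1.2) (Nat.sub_le _ _) hz.le h1
      (h2.trans (cut_le_of_far (hP z.1.1).far hz))
    rw [Nat.cast_sub z.2.1] at h3
    refine lt_of_lt_of_le ?_ h3
    rw [sub_sub_cancel, hlagR, rad]
    nlinarith
  have hvol : 0 < M.tvol Θ := by
    have hne : Nonempty ι := by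
      by_contra hcon
      rw [not_nonempty_iff] at hcon
      simp at hη1
    exact lt_of_lt_of_le (by positivity) (hP (Classical.arbitrary ι)).pow_le_tvol
  have hY : ∀ z : Ω, M.Lvl k (Θ.filter (fun v => row v = ℓ z) : Finset V)
      (M.win (M.Λ ^ k) (P z.1.1) z.1.2) := by
    intro z
    refine ⟨win_far (hP _).far z.1.2.2, fun t h1 h2 => ?_, z.2.2.1.1⟩
    rw [Finset.mem_coe, Finset.mem_filter]
    exact ⟨(hP z.1.1).mem t ((cut_spec (M := M) _).1.trans h1)
      (h2.trans (cut_le_of_far (hP _).far z.1.2.2)), heq_row z _ (hmemY z _ ⟨t, h1, h2, rfl⟩)⟩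
  have hin : ∀ (F G : ι → ℕ → ℝ), (∀ x, ∀ i ∈ Finset.Ico (M.lag k) (M.Λ / 2), p x i →
      F x i ≤ η x * G x i) → (∀ x, ∀ i ∈ Finset.Ico (M.lag k) (M.Λ / 2), 0 ≤ G x i) →
      ∑ z : Ω, F z.1.1 z.1.2 ≤ ∑ x, η x * ∑ i ∈ Finset.Ico (M.lag k) (M.Λ / 2), G x i := by
    intro F G h1 h2
    rw [hsumΩ]
    refine Finset.sum_le_sum (fun x _ => ?_)
    rw [Finset.mul_sum]
    refine (Finset.sum_le_sum (fun i hi => ?_)).trans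
      (Finset.sum_le_sum_of_subset_of_nonneg (Finset.filter_subset _ _)
        (fun i hi _ => mul_nonneg (hη x) (h2 x i hi)))
    rw [Finset.mem_filter] at hi
    exact h1 x i hi.1 hi.2
  have hscore : ∀ j S, ∑ x, η x * ∑ i ∈ Finset.Ico (M.lag k) (M.Λ / 2),
      (if j = k then
        (if (M.win (M.Λ ^ k) (P x) i).len M.w ≤ M.A k * M.Λ ^ k ∧
            M.Kill (M.rad k) S (M.src k (P x) i) (M.win (M.Λ ^ k) (P x) i) then 1 else 0)
      else score M k j S (M.win (M.Λ ^ k) (P x) i)) =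
      M.Λ * ∑ x, η x * M.score (k + 1) j S (P x) := by
    intro j S
    rw [Finset.mul_sum]
    refine Finset.sum_congr rfl (fun x _ => ?_)
    rw [score]
    field_simp
  -- With this θ, the diffuseness 16θ of a window claim, times at most Λ windows per path, is
  -- exactly ψ = 1/(2Λ).
  have hθ : (0 : ℝ) < 1 / (32 * M.Λ ^ 2) := by positivity
  rcases hM.rows hα hq Θ (Ω := Ω) (fun z => η z.1.1) (fun z => hη _) hμ0
    (fun z => M.src k (P z.1.1) z.1.2) (fun z => M.win (M.Λ ^ k) (P z.1.1) z.1.2) row ℓ hY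
    (fun z c hc => hle_row z c (by linarith [hnear _ c hc]))
    (fun z y c hy hc => hle_row z c (by
      linarith [hnear _ c hc, (abs_le.1 (hmemY z y hy)).2]))
    hfar hrad hθ (by
      rw [div_le_one (by positivity)]
      nlinarith) with ⟨j, hj, S, hS1, hS2⟩ | ⟨S, hS1, hS2⟩ | ⟨G, hG1, hG2⟩
  · exfalso
    have h1 := hno j (by omega) S hS1
    have hk : (0 : ℝ) < k := by
      have : 0 < k := by omega
      exact_mod_cast this
    have h2 := hin (fun x i => η x * M.score k j S (M.win (M.Λ ^ k) (P x) i))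
      (fun x i => M.score k j S (M.win (M.Λ ^ k) (P x) i)) (fun _ _ _ _ => le_rfl)
      (fun _ _ _ => score_nonneg _ _ _ _)
    have h3 := hscore j S
    simp only [hj.ne, if_false] at h3
    rw [h3] at h2
    have h4 : M.Λ / 10 * (q / (48 * k * M.Λ ^ j)) ≤ μ * (q / (48 * k * M.Λ ^ j)) :=
      mul_le_mul_of_nonneg_right hμ1 (by positivity)
    have h5 : M.Λ * (q' / M.Λ ^ j) ≤ M.Λ / 10 * (q / (48 * k * M.Λ ^ j)) := by
      calc M.Λ * (q' / M.Λ ^ j) ≤ M.Λ * (q / (480 * k) / M.Λ ^ j) := by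
            gcongr
            refine hq1.trans ?_
            gcongr
            linarith
        _ = _ := by field_simp; norm_num
    have h6 := mul_lt_mul_of_pos_left h1 hΛ0
    linarith
  · exfalso
    have h1 := hno k (by omega) S hS1
    have h2 := hin (fun x i => η x * (if M.Kill (M.rad k) S (M.src k (P x) i)
        (M.win (M.Λ ^ k) (P x) i) then 1 else 0))
      (fun x i => if (M.win (M.Λ ^ k) (P x) i).len M.w ≤ M.A k * M.Λ ^ k ∧
            M.Kill (M.rad k) S (M.src k (P x) i) (M.win (M.Λ ^ k) (P x) i) then 1 else 0)
      (fun x i _ hpx => by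
        have := hpx.1.1
        simp only [this, true_and]
        exact le_rfl)
      (fun _ _ _ => by split_ifs <;> simp)
    have h3 := hscore k S
    simp only [if_true] at h3
    rw [h3] at h2
    have h4 : M.Λ / 10 * (1 / (32 * M.Λ ^ 2) / (288 * M.Λ ^ k)) ≤
        μ * (1 / (32 * M.Λ ^ 2) / (288 * M.Λ ^ k)) :=
      mul_le_mul_of_nonneg_right hμ1 (by positivity)
    have h5 : M.Λ * (q' / M.Λ ^ k) ≤ M.Λ / 10 * (1 / (32 * M.Λ ^ 2) / (288 * M.Λ ^ k)) := by
      calc M.Λ * (q' / M.Λ ^ k) ≤ M.Λ * (1 / (92160 * M.Λ ^ 2) / M.Λ ^ k) := by gcongr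
        _ = _ := by field_simp; norm_num
    have h6 := mul_lt_mul_of_pos_left h1 hΛ0
    linarith
  -- The move claims at least h, pays at most h/32 to reach the block, and ends in the same row,
  -- where f is lower by at most h/4.
  · have hinc : ∀ z ∈ G, h / 2 ≤
        Plan.value M.dn P Θ (M.Λ ^ k) ψ η lam (n + 1) (M.src k (P z.1.1) z.1.2) -
          f (M.src k (P z.1.1) z.1.2) := by
      intro z hz
      have hmv := hG2 z hz
      have h1 := HasMove.le_value (Θ := (Θ : Set V))
        (Θ' := ((Θ.filter (fun v => row v = ℓ z) : Finset V) : Set V)) hP hH hη (fun z : Ω => z.1.1)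
        (fun z => z.1.2) (fun z => z.1.2.2)
        (fun z z' h1 h2 => Subtype.ext (Prod.ext h1 (Fin.ext h2))) (fun z => z.2.2.1.1) hlam (by positivity) (ψ := ψ) (n := n)
        (e := f (M.src k (P z.1.1) z.1.2) - h / 4) (by rw [hψ]; apply le_of_eq; field_simp; norm_num)
        (fun u hu => (Finset.mem_filter.1 (Finset.mem_coe.1 hu)).1) hmv (by
          intro u hu
          rw [Finset.mem_coe, Finset.mem_filter] at hu
          have h2 : row (M.src k (P z.1.1) z.1.2) = ℓ z := heq_row z _ (by simp; linarith)
          have h3 := Int.abs_sub_lt_one_of_floor_eq_floor (hu.2.trans h2.symm)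
          rw [← sub_div, abs_div, abs_of_pos (show 0 < h / 4 by positivity),
            div_lt_one (by positivity), abs_lt] at h3
          linarith [h3.1])
      have h4 : h ≤ μ * α * M.Λ ^ (2 * k) / (128 * M.tvol Θ) / M.lag k := by
        have hl : (0 : ℝ) < M.lag k := by rw [hlagR]; positivity
        rw [le_div_iff₀ hl]
        refine hhdef.trans ?_
        gcongr
      linarith
    have h1 := hin (fun x i => η x * (Plan.value M.dn P Θ (M.Λ ^ k) ψ η lam (n + 1)
        (M.src k (P x) i) - f (M.src k (P x) i)))
      (fun x i => Plan.value M.dn P Θ (M.Λ ^ k) ψ η lam (n + 1)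
        (M.src k (P x) i) - f (M.src k (P x) i)) (fun _ _ _ _ => le_rfl)
      (fun _ _ _ => sub_nonneg.2 (hmono _))
    refine le_trans ?_ h1
    calc M.Λ * h / 1920 = M.Λ / 10 / 96 * (h / 2) := by ring
      _ ≤ μ / 96 * (h / 2) := by gcongr
      _ ≤ (∑ z ∈ G, η z.1.1) * (h / 2) := mul_le_mul_of_nonneg_right hG1 (by positivity)
      _ ≤ ∑ z ∈ G, η z.1.1 * (Plan.value M.dn P Θ (M.Λ ^ k) ψ η lam (n + 1)
            (M.src k (P z.1.1) z.1.2) - f (M.src k (P z.1.1) z.1.2)) := by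
          rw [Finset.sum_mul]
          exact Finset.sum_le_sum (fun z hz => mul_le_mul_of_nonneg_left (hinc z hz) (hη _))
      _ ≤ _ := Finset.sum_le_sum_of_subset_of_nonneg (Finset.subset_univ _)
          (fun z _ _ => mul_nonneg (hη _) (sub_nonneg.2 (hmono _)))

end Frame

/-! ### Induction over the levels -/

namespace Frame
variable {V : Type*} {M : Frame V}

/-- A path of level 0 has length at least 1, hence so does its volume. Averaging over vertices with
weight `vol`, some single vertex lies on a fraction 1/tvol of the paths. -/
theorem dichotomy_zero (q : ℝ) : M.Dichotomy 0 1 q := by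
  classical
  intro Θ ι _ P η hη hη1 hP
  left
  have hv : 0 < M.tvol Θ := by
    have hne : Nonempty ι := by
      by_contra hcon
      rw [not_nonempty_iff] at hcon
      simp at hη1
    exact lt_of_lt_of_le (by simp) (hP (Classical.arbitrary ι)).pow_le_tvol
  have h1 : (1 : ℝ) ≤ ∑ v ∈ Θ, M.vol v * ∑ x, η x * (if (P x).Mem v then 1 else 0) := by
    calc (1 : ℝ) = ∑ x, η x * 1 := by simp [hη1]
      _ ≤ ∑ x, η x * ∑ v ∈ Θ, (if (P x).Mem v then M.vol v else 0) := by
        refine Finset.sum_le_sum (fun x _ => mul_le_mul_of_nonneg_left ?_ (hη x))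
        have h1 := (hP x).far.2.trans (M.df_le_dn _ _)
        rw [pow_zero] at h1
        exact h1.trans ((M.dn_le_len (hP x).far.1 le_rfl (hP x).far.1.1 le_rfl).trans
          (M.len_le_vol (hP x).far.1 Θ (fun i hi hi' => (hP x).mem i hi hi')))
      _ = _ := by
        simp only [Finset.mul_sum]
        rw [Finset.sum_comm]
        refine Finset.sum_congr rfl (fun v _ => Finset.sum_congr rfl (fun x _ => ?_))
        split_ifs <;> ring
  obtain ⟨v, hvΘ, hvl⟩ : ∃ v ∈ Θ, 1 / M.tvol Θ ≤ ∑ x, η x * (if (P x).Mem v then 1 else 0) := by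
    by_contra hcon
    push Not at hcon
    have h2 : ∑ v ∈ Θ, M.vol v * ∑ x, η x * (if (P x).Mem v then 1 else 0) <
        ∑ v ∈ Θ, M.vol v * (1 / M.tvol Θ) := by
      refine Finset.sum_lt_sum (fun v hvΘ => mul_le_mul_of_nonneg_left (hcon v hvΘ).le
        (M.vol_nonneg v)) ?_
      obtain ⟨v, hvΘ, hv0⟩ : ∃ v ∈ Θ, 0 < M.vol v := by
        by_contra h
        push Not at h
        exact absurd (Finset.sum_nonpos h) (not_le.2 hv)
      exact ⟨v, hvΘ, mul_lt_mul_of_pos_left (hcon v hvΘ) hv0⟩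
    rw [← Finset.sum_mul, mul_one_div] at h2
    change _ < M.tvol Θ / M.tvol Θ at h2
    rw [div_self hv.ne'] at h2
    linarith
  refine ⟨[v], by simpa using hvΘ, by simp [chainLen], ?_⟩
  simpa [Seg.Touch] using hvl

-- If both alternatives failed, each of Λ rounds would raise the value by h/2 at a constant fraction
-- of about Λ sources, a total of order Λ²h. The value never exceeds 4τ with τ = c₀Λh, so the total
-- is at most 4c₀Λ²h, too little for small c₀. The factor Λ² between the thresholds of consecutive
-- levels comes from about Λ windows per path and Λ moves per chain.
open Classical in
theorem Dichotomy.succ {k : ℕ} {α q : ℝ} (hM : M.Dichotomy k α q) (hα : 0 < α)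
    (hq : 0 < q) (hA : 40 * M.A (k + 1) ≤ M.A k) (hA0 : 0 < M.A k) (hΛ : 4 * (M.lag k + 1) ≤ M.Λ)
    (hH : (M.Λ : ℝ) ^ k ≤ M.H) (hrad : ∀ j < k, M.rad j ≤ M.rad k) :
    M.Dichotomy (k + 1)
      (α / (5120 * (M.lag k + 1) * (M.A (k + 1) + 1) * (1280 * M.lag k)))
      (min (q / (480 * (k + 1))) (1 / (92160 * M.Λ ^ 2))) := by
  intro Θ ι _ P η hη hη1 hP
  by_contra hcon
  push Not at hcon
  obtain ⟨hT, hno⟩ := hcon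
  have hR := M.one_le_pow k
  have hΛ0 : (0 : ℝ) < M.Λ := by exact_mod_cast M.one_le_Λ
  have hvol : 0 < M.tvol Θ := by
    have hne : Nonempty ι := by
      by_contra hcon
      rw [not_nonempty_iff] at hcon
      simp at hη1
    exact lt_of_lt_of_le (by positivity) (hP (Classical.arbitrary ι)).pow_le_tvol
  have hlag : (M.lag k : ℝ) = M.A k + 2 := by rw [lag]; push_cast; ring
  have hA0' : (0 : ℝ) < M.A k := by exact_mod_cast hA0
  have hA1' : (0 : ℝ) ≤ M.A (k + 1) := Nat.cast_nonneg _
  have hl : (0 : ℝ) < M.lag k := by rw [hlag]; positivity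
  set c₀ : ℝ := 1 / (5120 * (M.lag k + 1) * (M.A (k + 1) + 1)) with hc₀
  have hc0 : 0 < c₀ := by positivity
  have hc1 : c₀ * (5120 * (M.lag k + 1) * (M.A (k + 1) + 1)) = 1 := by rw [hc₀]; field_simp
  set h : ℝ := M.Λ / 10 * α * M.Λ ^ (2 * k) / (128 * M.tvol Θ) / M.lag k with hh
  have hh0 : 0 < h := by positivity
  set τ : ℝ := c₀ * M.Λ * h with hτ
  have hτ0 : 0 < τ := by positivity
  have hτeq : α / (5120 * (M.lag k + 1) * (M.A (k + 1) + 1) * (1280 * M.lag k)) *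
      M.Λ ^ (2 * (k + 1)) / M.tvol Θ = τ := by
    rw [hτ, hc₀, hh, show 2 * (k + 1) = 2 * k + 2 by ring, pow_add]
    field_simp
    norm_num
  rw [hτeq] at hT
  -- The tax rate 2τ/B of `Plan.value_le`, for chains of length B = Λ^(k+1).
  set lam : ℝ := 2 * τ / M.Λ ^ (k + 1) with hlam
  have hlam0 : 0 ≤ lam := by positivity
  set ψ : ℝ := 1 / (2 * M.Λ) with hψ
  have hψ0 : 0 ≤ ψ := by positivity
  have hval : ∀ n ≤ M.Λ, ∀ v, Plan.value M.dn P Θ (M.Λ ^ k) ψ η lam n v ≤ 4 * τ := by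
    intro n hn v
    refine Plan.value_le M.dn_nonneg hψ0 hη (by linarith) hn ?_ (by positivity) hτ0.le ?_ ?_ v
    · rw [hψ]; apply le_of_eq; field_simp
    · rw [pow_succ, mul_comm]
    · exact fun L hL1 hL2 => (hT L hL1 hL2).le
  have hb : (M.lag k + 1) * (2 * lam * (M.A (k + 1) * M.Λ ^ (k + 1)) + 4 * τ) * 40 ≤
      M.Λ * (h / 32) := by
    have e1 : lam * M.Λ ^ (k + 1) = 2 * τ := by rw [hlam]; field_simp
    have e2 : (M.lag k + 1) * (2 * lam * (M.A (k + 1) * M.Λ ^ (k + 1)) + 4 * τ) * 40 =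
        (c₀ * (5120 * (M.lag k + 1) * (M.A (k + 1) + 1))) * (M.Λ * (h / 32)) := by
      have : 2 * lam * (M.A (k + 1) * M.Λ ^ (k + 1)) = 2 * M.A (k + 1) * (2 * τ) := by
        rw [← e1]; ring
      rw [this, hτ]
      ring
    rw [e2, hc1, one_mul]
  have hlr : lam * M.rad k ≤ h / 32 := by
    have e1 : lam * M.rad k = c₀ * (128 * M.A k) * (h / 32) := by
      rw [hlam, rad, hτ, pow_succ]
      field_simp
      norm_num
    rw [e1]
    have h2 : c₀ * (128 * M.A k) ≤ 1 := by
      rw [← hc1]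
      refine mul_le_mul_of_nonneg_left ?_ hc0.le
      rw [hlag]
      nlinarith [mul_nonneg hA0'.le hA1']
    have := mul_le_mul_of_nonneg_right h2 (show 0 ≤ h / 32 by positivity)
    linarith
  have hround : ∀ n < M.Λ, M.Λ * h / 1920 ≤
      ∑ x, η x * ∑ i ∈ Finset.Ico (M.lag k) (M.Λ / 2),
      (Plan.value M.dn P Θ (M.Λ ^ k) ψ η lam (n + 1) (M.src k (P x) i) -
        Plan.value M.dn P Θ (M.Λ ^ k) ψ η lam n (M.src k (P x) i)) := by
    intro n hn
    refine hM.value_increase hα hq hA hA0 hΛ hH hrad hη hη1 hP hh0 hlam0 ?_ hb hlr hψ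
      (hval n hn.le) (min_le_left _ _) (min_le_right _ _) hno
    rw [hh, div_mul_cancel₀ _ hl.ne']
  have hsum := Finset.sum_le_sum (fun n (hn : n ∈ Finset.range M.Λ) =>
    hround n (Finset.mem_range.1 hn))
  rw [Finset.sum_const, Finset.card_range, nsmul_eq_mul, Finset.sum_comm] at hsum
  have hup : ∑ x, ∑ n ∈ Finset.range M.Λ, η x * ∑ i ∈ Finset.Ico (M.lag k) (M.Λ / 2),
      (Plan.value M.dn P Θ (M.Λ ^ k) ψ η lam (n + 1) (M.src k (P x) i) -
        Plan.value M.dn P Θ (M.Λ ^ k) ψ η lam n (M.src k (P x) i)) ≤ ∑ x, η x * (M.Λ * (4 * τ)) := by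
    refine Finset.sum_le_sum (fun x _ => ?_)
    rw [← Finset.mul_sum, Finset.sum_comm]
    refine mul_le_mul_of_nonneg_left ?_ (hη x)
    calc _ ≤ ∑ i ∈ Finset.Ico (M.lag k) (M.Λ / 2), 4 * τ := by
          refine Finset.sum_le_sum (fun i _ => ?_)
          rw [Finset.sum_range_sub (fun n =>
            Plan.value M.dn P Θ (M.Λ ^ k) ψ η lam n (M.src k (P x) i))]
          have h1 := hval M.Λ le_rfl (M.src k (P x) i)
          have h2 := Plan.value_nonneg (P := P) (Θ := (Θ : Set V)) (R := M.Λ ^ k) M.dn_nonneg hψ0 hη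
            hlam0 0 (M.src k (P x) i)
          linarith
      _ = ((M.Λ / 2 - M.lag k : ℕ) : ℝ) * (4 * τ) := by
          rw [Finset.sum_const, Nat.card_Ico, nsmul_eq_mul]
      _ ≤ M.Λ * (4 * τ) := by
          refine mul_le_mul_of_nonneg_right ?_ (by positivity)
          exact_mod_cast (Nat.sub_le _ _).trans (Nat.div_le_self _ _)
  rw [← Finset.sum_mul, hη1, one_mul] at hup
  -- Λ·(Λh/1920) ≤ 4c₀Λ²h contradicts c₀ ≤ 1/15360.
  have hfin := hsum.trans hup
  have hc2 : c₀ * 15360 ≤ 1 := by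
    rw [← hc1]
    refine mul_le_mul_of_nonneg_left ?_ hc0.le
    rw [hlag]
    nlinarith [mul_nonneg hA0'.le hA1']
  have hpos : 0 < M.Λ * (M.Λ * h) := by positivity
  have h3 : M.Λ * (4 * τ) = 4 * c₀ * (M.Λ * (M.Λ * h)) := by rw [hτ]; ring
  rw [h3] at hfin
  nlinarith

end Frame

namespace Frame
variable {V : Type*} {M : Frame V}

theorem Dichotomy.mono {k : ℕ} {α q q' : ℝ} (h : M.Dichotomy k α q) (hq : q' ≤ q) :
    M.Dichotomy k α q' := by
  intro Θ ι _ P η hη hη1 hP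
  have hΛ : (0 : ℝ) < M.Λ := by exact_mod_cast M.one_le_Λ
  rcases h Θ ι P η hη hη1 hP with h1 | ⟨j, hj, S, h1, h2⟩
  · exact Or.inl h1
  · exact Or.inr ⟨j, hj, S, h1, le_trans (by gcongr) h2⟩

/-- The constants depend only on `A` and `K`, not on the graph or on Λ. The loss Λ^(-2) in the kill
alternative does not accumulate, because `Dichotomy.succ` takes a minimum. -/
theorem exists_dichotomy.{u} (A : ℕ → ℕ) (K : ℕ) (hA0 : ∀ k ≤ K, 0 < A k)
    (hA : ∀ k < K, 40 * A (k + 1) ≤ A k) : ∃ α κ : ℝ, 0 < α ∧ 0 < κ ∧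
      ∀ (V : Type u) (M : Frame V), M.A = A → 4 * (A 0 + 3) ≤ M.Λ → (M.Λ : ℝ) ^ K ≤ M.H →
        M.Dichotomy K α (κ / M.Λ ^ 2) := by
  have hanti : ∀ j k, j ≤ k → k ≤ K → A k ≤ A j := by
    intro j k hjk
    induction k, hjk using Nat.le_induction with
    | base => exact fun _ => le_rfl
    | succ k hjk ih =>
      intro hk
      have h1 := ih (by omega)
      have h2 := hA k (by omega)
      omega
  induction K with
  | zero => exact ⟨1, 1, one_pos, one_pos, fun V M _ _ _ => dichotomy_zero _⟩
  | succ K ih =>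
    obtain ⟨α, κ, hα, hκ, h⟩ := ih (fun k hk => hA0 k (by omega)) (fun k hk => hA k (by omega))
      (fun j k hjk hk => hanti j k hjk (by omega))
    refine ⟨α / (5120 * (A K + 2 + 1) * (A (K + 1) + 1) * (1280 * (A K + 2))),
      min (κ / (480 * (K + 1))) (1 / 92160), by positivity, by positivity, ?_⟩
    rintro V M rfl hΛ hH
    have hΛ0 : (0 : ℝ) < M.Λ := by exact_mod_cast M.one_le_Λ
    have hΛ1 : (1 : ℝ) ≤ M.Λ := by exact_mod_cast M.one_le_Λ
    have hK0 := hanti 0 K (Nat.zero_le _) (by omega)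
    have hH' : (M.Λ : ℝ) ^ K ≤ M.H := by
      refine le_trans ?_ hH
      exact pow_le_pow_right₀ hΛ1 (Nat.le_succ K)
    have h1 := (h V M rfl hΛ hH').succ hα (by positivity) (hA K (by omega)) (hA0 K (by omega))
      (by simp only [lag]; omega) hH' (fun j hj => by
        have h2 := hanti 0 j (Nat.zero_le _) (by omega)
        have h3 : M.A j ≤ M.A K * M.Λ := by
          have := hA0 K (by omega)
          nlinarith
        have h3' : (M.A j : ℝ) ≤ M.A K * M.Λ := by exact_mod_cast h3
        simp only [rad]
        calc 2 * (M.A j : ℝ) * M.Λ ^ j ≤ 2 * (M.A K * M.Λ) * M.Λ ^ j := by gcongr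
          _ = 2 * M.A K * M.Λ ^ (j + 1) := by ring
          _ ≤ 2 * M.A K * M.Λ ^ K := by
            gcongr
            omega)
    have e : ((M.lag K : ℕ) : ℝ) = M.A K + 2 := by rw [lag]; push_cast; ring
    rw [e] at h1
    refine h1.mono (le_min ?_ ?_)
    · calc min (κ / (480 * (K + 1))) (1 / 92160) / (M.Λ : ℝ) ^ 2
          ≤ κ / (480 * (K + 1)) / M.Λ ^ 2 := by gcongr; exact min_le_left _ _
        _ = _ := by field_simp
    · calc min (κ / (480 * (K + 1))) (1 / 92160) / (M.Λ : ℝ) ^ 2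
          ≤ 1 / 92160 / M.Λ ^ 2 := by gcongr; exact min_le_right _ _
        _ = _ := by field_simp

end Frame

/-! ### Walks and truncated distances -/

/-- There is a walk from one vertex to another of the given total weight. -/
inductive HasWalk {V : Type*} (F : V → V → Prop) (w : V → V → ℝ) : V → V → ℝ → Prop
  | nil (s : V) : HasWalk F w s s 0
  | cons {s u t : V} {L : ℝ} (h : F s u) (p : HasWalk F w u t L) : HasWalk F w s t (w s u + L)

namespace HasWalk
variable {V : Type*} {F F' : V → V → Prop} {w : V → V → ℝ} {s t u : V} {L L' : ℝ}

theorem nonneg (hw : ∀ x y, 0 ≤ w x y) (h : HasWalk F w s t L) : 0 ≤ L := by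
  induction h with
  | nil => exact le_rfl
  | cons h p ih => exact add_nonneg (hw _ _) ih

theorem trans (h : HasWalk F w s t L) (h' : HasWalk F w t u L') : HasWalk F w s u (L + L') := by
  induction h with
  | nil => simpa using h'
  | cons h p ih => rw [add_assoc]; exact (ih h').cons h

theorem single (h : F s t) : HasWalk F w s t (w s t) := by simpa using (nil t).cons h

theorem mono (h : HasWalk F w s t L) (hF : ∀ x y, F x y → F' x y) : HasWalk F' w s t L := by
  induction h with
  | nil => exact nil _
  | cons h p ih => exact ih.cons (hF _ _ h)

theorem reach (h : HasWalk F w s t L) : Relation.ReflTransGen F s t := by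
  induction h with
  | nil => exact .refl
  | cons h p ih => exact ih.head h

theorem exists_of_reach (h : Relation.ReflTransGen F s t) : ∃ L, HasWalk F w s t L := by
  induction h using Relation.ReflTransGen.head_induction_on with
  | refl => exact ⟨0, nil _⟩
  | head h _ ih =>
    obtain ⟨L, hL⟩ := ih
    exact ⟨_, hL.cons h⟩

/-- Loop erasure. -/
theorem exists_seg (hw : ∀ x y, 0 ≤ w x y) (h : HasWalk F w s t L) :
    ∃ (p : ℕ → V) (b : ℕ), (⟨p, 0, b⟩ : Seg V).IsPath F ∧ p 0 = s ∧ p b = t ∧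
      (⟨p, 0, b⟩ : Seg V).len w ≤ L := by
  induction h with
  | nil s =>
    exact ⟨fun _ => s, 0, ⟨le_rfl, fun i _ hi => absurd hi (by simp),
      fun i hi j hj _ => by simp at hi hj; omega⟩, rfl, rfl, by simp [Seg.len]⟩
  | @cons s u t L h _ ih =>
    obtain ⟨p, b, hp, h0, hb, hl⟩ := ih
    by_cases hs : ∃ j ≤ b, p j = s
    · obtain ⟨j, hj, hjs⟩ := hs
      refine ⟨fun i => p (j + i), b - j, ⟨Nat.zero_le _, fun i _ hi => ?_, fun i hi i' hi' he => ?_⟩,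
        hjs, by simp only [Nat.add_sub_cancel' hj]; exact hb, ?_⟩
      · exact hp.2.1 (j + i) (Nat.zero_le _) (by simp only at hi ⊢; omega)
      · simp only [Set.mem_Icc] at hi hi'
        have := hp.2.2 (x₁ := j + i) (x₂ := j + i') ⟨Nat.zero_le _, by simp only; omega⟩
          ⟨Nat.zero_le _, by simp only; omega⟩ he
        omega
      · refine le_trans ?_ (hl.trans (le_add_of_nonneg_left (hw _ _)))
        simp only [Seg.len]
        have e := Finset.sum_Ico_eq_sum_range (fun i => w (p i) (p (i + 1))) j b
        rw [← Finset.range_eq_Ico, show (fun i => w (p (j + i)) (p (j + (i + 1)))) =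
          fun i => w (p (j + i)) (p (j + i + 1)) from rfl, ← e]
        exact Finset.sum_le_sum_of_subset_of_nonneg
          (by rw [← Finset.range_eq_Ico] ; intro i hi; simp only [Finset.mem_Ico, Finset.mem_range] at hi ⊢; omega)
          (fun _ _ _ => hw _ _)
    · push Not at hs
      refine ⟨fun i => Nat.casesOn i s p, b + 1, ⟨Nat.zero_le _, fun i _ hi => ?_,
        fun i hi i' hi' he => ?_⟩, rfl, hb, ?_⟩
      · cases i with
        | zero => change F s (p 0); rw [h0]; exact h
        | succ i => exact hp.2.1 i (Nat.zero_le _) (by simp only at hi ⊢; omega)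
      · simp only [Set.mem_Icc] at hi hi'
        cases i with
        | zero =>
          cases i' with
          | zero => rfl
          | succ i' => exact absurd he.symm (hs i' (by omega))
        | succ i =>
          cases i' with
          | zero => exact absurd he (hs i (by omega))
          | succ i' =>
            exact congrArg Nat.succ (hp.2.2 (x₁ := i) (x₂ := i') ⟨Nat.zero_le _, by simp only; omega⟩
              ⟨Nat.zero_le _, by simp only; omega⟩ he)
      · simp only [Seg.len]
        rw [← Finset.range_eq_Ico, Finset.sum_range_succ']
        simp only [Seg.len, ← Finset.range_eq_Ico] at hl
        change ∑ i ∈ Finset.range b, w (p i) (p (i + 1)) + w s (p 0) ≤ _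
        rw [h0]
        linarith

end HasWalk

theorem Seg.IsPath.hasWalk {V : Type*} {F : V → V → Prop} {w : V → V → ℝ} {s : Seg V}
    (h : s.IsPath F) : HasWalk F w (s.p s.a) (s.p s.b) (s.len w) := by
  have key : ∀ n, s.a ≤ n → n ≤ s.b →
      HasWalk F w (s.p s.a) (s.p n) (∑ i ∈ Finset.Ico s.a n, w (s.p i) (s.p (i + 1))) := by
    intro n hn
    induction n, hn using Nat.le_induction with
    | base => intro _; simpa using HasWalk.nil _
    | succ n hn ih =>
      intro hb
      rw [Finset.sum_Ico_succ_top hn]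
      exact (ih (by omega)).trans (HasWalk.single (h.2.1 n hn (by omega)))
  exact key s.b h.1 le_rfl

/-- Distance in a weighted digraph, truncated at `T`. -/
noncomputable def tdist {V : Type*} (F : V → V → Prop) (w : V → V → ℝ) (T : ℝ) (s t : V) : ℝ :=
  sInf {L | L = T ∨ HasWalk F w s t L}

section tdist
variable {V : Type*} {F F' : V → V → Prop} {w : V → V → ℝ} {T : ℝ} {s t u : V} {L : ℝ}

theorem tdist_bddBelow (hw : ∀ x y, 0 ≤ w x y) (hT : 0 ≤ T) :
    BddBelow {L | L = T ∨ HasWalk F w s t L} := by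
  refine ⟨0, ?_⟩
  rintro L (rfl | h)
  · exact hT
  · exact h.nonneg hw

theorem tdist_nonneg (hw : ∀ x y, 0 ≤ w x y) (hT : 0 ≤ T) : 0 ≤ tdist F w T s t := by
  refine le_csInf ⟨T, Or.inl rfl⟩ ?_
  rintro L (rfl | h)
  · exact hT
  · exact h.nonneg hw

theorem tdist_le_self (hw : ∀ x y, 0 ≤ w x y) (hT : 0 ≤ T) : tdist F w T s t ≤ T :=
  csInf_le (tdist_bddBelow hw hT) (Or.inl rfl)

theorem tdist_le_walk (hw : ∀ x y, 0 ≤ w x y) (hT : 0 ≤ T) (h : HasWalk F w s t L) :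
    tdist F w T s t ≤ L :=
  csInf_le (tdist_bddBelow hw hT) (Or.inr h)

theorem exists_walk_of_tdist_lt {x : ℝ} (h : tdist F w T s t < x) (hx : x ≤ T) :
    ∃ L < x, HasWalk F w s t L := by
  obtain ⟨L, hL, hLx⟩ := exists_lt_of_csInf_lt ⟨T, Or.inl rfl⟩ h
  rcases hL with rfl | hL
  · linarith
  · exact ⟨L, hLx, hL⟩

theorem le_tdist {x : ℝ} (hx : x ≤ T) (h : ∀ L, HasWalk F w s t L → x ≤ L) :
    x ≤ tdist F w T s t := by
  refine le_csInf ⟨T, Or.inl rfl⟩ ?_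
  rintro L (rfl | hL)
  · exact hx
  · exact h L hL

theorem tdist_refl (hw : ∀ x y, 0 ≤ w x y) (hT : 0 ≤ T) : tdist F w T s s = 0 :=
  le_antisymm (tdist_le_walk hw hT (HasWalk.nil s)) (tdist_nonneg hw hT)

theorem tdist_triangle (hw : ∀ x y, 0 ≤ w x y) (hT : 0 ≤ T) :
    tdist F w T s u ≤ tdist F w T s t + tdist F w T t u := by
  have h1 := tdist_nonneg (F := F) (s := s) (t := t) hw hT
  have h2 := tdist_nonneg (F := F) (s := t) (t := u) hw hT
  have h3 := tdist_le_self (F := F) (s := s) (t := u) hw hT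
  by_contra hcon
  push Not at hcon
  have h4 : tdist F w T s t < tdist F w T s u - tdist F w T t u := by linarith
  obtain ⟨L, hL, hw1⟩ := exists_walk_of_tdist_lt h4 (by linarith)
  have h5 : tdist F w T t u < tdist F w T s u - L := by linarith
  obtain ⟨L', hL', hw2⟩ := exists_walk_of_tdist_lt h5 (by linarith [hw1.nonneg hw])
  have := tdist_le_walk hw hT (hw1.trans hw2)
  linarith

theorem tdist_anti (hw : ∀ x y, 0 ≤ w x y) (hT : 0 ≤ T) (hF : ∀ x y, F' x y → F x y) :
    tdist F w T s t ≤ tdist F' w T s t :=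
  le_tdist (tdist_le_self hw hT) (fun _ h => tdist_le_walk hw hT (h.mono hF))

end tdist

/-! ### Region growing -/

open MeasureTheory in
/-- Some point of an interval is covered by few of finitely many weighted intervals. -/
theorem exists_point_few_intervals {ι : Type*} (s : Finset ι) (c lo hi W : ι → ℝ)
    (hc : ∀ i ∈ s, 0 ≤ c i) (hW : ∀ i ∈ s, hi i - lo i ≤ W i) (hW0 : ∀ i ∈ s, 0 ≤ W i) (r δ : ℝ)
    (hδ : 0 < δ) : ∃ x, r ≤ x ∧ x ≤ r + δ ∧
      δ * ∑ i ∈ s with lo i ≤ x ∧ x < hi i, c i ≤ ∑ i ∈ s with lo i ≤ r + δ, c i * W i := by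
  classical
  set t := s.filter (fun i => lo i ≤ r + δ) with ht
  set g : ℝ → ℝ := fun x => ∑ i ∈ t, (Set.Ico (lo i) (hi i)).indicator (fun _ => c i) x with hg
  have hvol : volume (Set.Ioc r (r + δ)) = ENNReal.ofReal δ := by rw [Real.volume_Ioc]; congr 1; ring
  have hne : volume (Set.Ioc r (r + δ)) ≠ 0 := by rw [hvol]; simpa using hδ
  have hnt : volume (Set.Ioc r (r + δ)) ≠ ⊤ := by rw [hvol]; simp
  have hint : ∀ i ∈ t, IntegrableOn ((Set.Ico (lo i) (hi i)).indicator (fun _ => c i))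
      (Set.Ioc r (r + δ)) volume := fun i _ =>
    (integrableOn_const (C := c i) hnt).indicator measurableSet_Ico
  have hgint : IntegrableOn g (Set.Ioc r (r + δ)) volume := integrable_finsetSum _ hint
  obtain ⟨x, hx, hle⟩ := exists_le_setAverage hne hnt hgint
  refine ⟨x, hx.1.le, hx.2, ?_⟩
  have hgx : ∑ i ∈ s with lo i ≤ x ∧ x < hi i, c i = g x := by
    simp only [hg, Set.indicator_apply, Set.mem_Ico]
    rw [← Finset.sum_filter, ht, Finset.filter_filter]
    refine Finset.sum_congr ?_ (fun _ _ => rfl)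
    ext i
    simp only [Finset.mem_filter]
    refine ⟨fun h => ⟨h.1, h.2.1.trans hx.2, h.2⟩, fun h => ⟨h.1, h.2.2⟩⟩
  have hI : ∫ y in Set.Ioc r (r + δ), g y ≤ ∑ i ∈ t, c i * W i := by
    rw [hg, integral_finsetSum _ hint]
    refine Finset.sum_le_sum (fun i hit => ?_)
    have his := (Finset.mem_filter.1 hit).1
    rw [setIntegral_indicator measurableSet_Ico, setIntegral_const, smul_eq_mul, mul_comm]
    refine mul_le_mul_of_nonneg_left ?_ (hc i his)
    calc volume.real (Set.Ioc r (r + δ) ∩ Set.Ico (lo i) (hi i))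
        ≤ volume.real (Set.Ico (lo i) (hi i)) :=
          measureReal_mono Set.inter_subset_right (by simp)
      _ ≤ W i := by
          rw [Real.volume_real_Ico]
          exact max_le (hW i his) (hW0 i his)
  rw [setAverage_eq, measureReal_def, hvol, ENNReal.toReal_ofReal hδ.le, smul_eq_mul] at hle
  rw [hgx]
  calc δ * g x ≤ δ * (δ⁻¹ * ∫ y in Set.Ioc r (r + δ), g y) := mul_le_mul_of_nonneg_left hle hδ.le
    _ = ∫ y in Set.Ioc r (r + δ), g y := by field_simp
    _ ≤ _ := hI

/-- A sequence that cannot double too often has a step that does not double. -/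
theorem exists_no_doubling (v : ℕ → ℝ) (v₀ B : ℝ) (L : ℕ) (hv₀ : 0 ≤ v₀) (hv : ∀ l, 0 ≤ v l)
    (h0 : ∀ l, v l = 0 ∨ v₀ ≤ v l) (hB : v (L + 1) ≤ B * v₀) (hBL : B < 2 ^ L) :
    ∃ l ≤ L, v (l + 1) ≤ 2 * v l := by
  by_contra hcon
  push Not at hcon
  have key : ∀ l ≤ L, 2 ^ l * v₀ ≤ v (l + 1) := by
    intro l
    induction l with
    | zero =>
      intro _
      have hp : 0 < v (0 + 1) := lt_of_le_of_lt (by have := hv 0; linarith) (hcon 0 (Nat.zero_le _))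
      rcases h0 1 with h | h
      · rw [zero_add, h] at hp
        exact absurd hp (lt_irrefl _)
      · simpa using h
    | succ l ih =>
      intro hl
      have h1 := ih (by omega)
      have h2 := hcon (l + 1) hl
      rw [pow_succ]
      linarith
  have h1 := key L le_rfl
  have h2 := hcon L le_rfl
  have h3 := hv L
  rcases hv₀.lt_or_eq with h | h
  · have := mul_lt_mul_of_pos_right hBL h
    linarith
  · rw [← h, mul_zero] at hB
    linarith

section carve
variable {V : Type*} [DecidableEq V] (E : Finset (V × V)) (w : V → V → ℝ) (c : V × V → ℝ)

/-- Total weighted cost of a set of edges. -/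
def wcost (E : Finset (V × V)) (w : V → V → ℝ) (c : V × V → ℝ) : ℝ := ∑ e ∈ E, c e * w e.1 e.2

variable {E w c}

open Classical in
/-- Successive region growing around the members of a list, inside `U`. -/
theorem exists_carve_aux (hw : ∀ x y, 0 ≤ w x y) (hc : ∀ e, 0 ≤ c e) (d : V → V → ℝ)
    (hd : ∀ e ∈ E, ∀ z, d e.1 z ≤ w e.1 e.2 + d e.2 z) {ρ v₀ B : ℝ} (hρ : 0 < ρ) (hv₀ : 0 ≤ v₀)
    {L : ℕ} (hBL : B < 2 ^ L) (S : List V) (U : Finset V)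
    (hU : wcost (E.filter (fun e => e.1 ∈ U ∧ e.2 ∈ U)) w c + v₀ * U.card ≤ B * v₀) :
    ∃ (X : Finset (V × V)) (τ : V → ℕ), X ⊆ E ∧
      (∀ e ∈ E, e ∉ X → e.1 ∈ U → e.2 ∈ U → τ e.1 ≤ τ e.2) ∧
      (∀ v ∈ U, ∀ z, S[τ v]? = some z → d v z ≤ ρ) ∧
      (∀ v ∈ U, ∀ j z, S[j]? = some z → d v z ≤ ρ / 2 → τ v ≤ j) ∧
      ∑ e ∈ X, c e ≤ 4 * (L + 1) / ρ *
        (wcost (E.filter (fun e => e.1 ∈ U ∧ e.2 ∈ U)) w c + v₀ * U.card) := by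
  induction S generalizing U with
  | nil =>
    -- Index 0 lies past the end of the empty list, so the value means "in no ball".
    refine ⟨∅, fun _ => 0, by simp, by simp, by simp, by simp, ?_⟩
    have : 0 ≤ wcost (E.filter (fun e => e.1 ∈ U ∧ e.2 ∈ U)) w c :=
      Finset.sum_nonneg (fun e _ => mul_nonneg (hc e) (hw _ _))
    simp only [Finset.sum_empty]
    positivity
  | cons s S ih =>
    set EU := E.filter (fun e => e.1 ∈ U ∧ e.2 ∈ U) with hEU
    set vol : ℝ → ℝ := fun r => wcost (EU.filter (fun e => d e.2 s ≤ r)) w c +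
      v₀ * (U.filter (fun v => d v s ≤ r)).card with hvol
    have hwc : ∀ A : Finset (V × V), 0 ≤ wcost A w c :=
      fun A => Finset.sum_nonneg (fun e _ => mul_nonneg (hc e) (hw _ _))
    have hmonoc : ∀ {A A' : Finset (V × V)}, A ⊆ A' → wcost A w c ≤ wcost A' w c := fun h =>
      Finset.sum_le_sum_of_subset_of_nonneg h (fun e _ _ => mul_nonneg (hc e) (hw _ _))
    have hvol0 : ∀ r, 0 ≤ vol r := fun r =>
      add_nonneg (hwc _) (mul_nonneg hv₀ (Nat.cast_nonneg _))
    have hvolmono : ∀ {r r' : ℝ}, r ≤ r' → vol r ≤ vol r' := by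
      intro r r' h
      refine add_le_add (hmonoc ?_) (mul_le_mul_of_nonneg_left ?_ hv₀)
      · exact Finset.monotone_filter_right _ (fun e _ he => le_trans he h)
      · rw [Nat.cast_le]
        exact Finset.card_le_card (Finset.monotone_filter_right _ (fun e _ he => le_trans he h))
    -- The radii from ρ/2 to ρ are divided into L + 1 steps. The ball volume cannot double in all of
    -- them, and in a step without doubling some radius cuts edges of cost at most 2·vol/δ.
    set δ : ℝ := ρ / (2 * (L + 1)) with hδ
    have hδ0 : 0 < δ := by positivity
    obtain ⟨l, hl, hdbl⟩ := exists_no_doubling (fun l => vol (ρ / 2 + l * δ)) v₀ B L hv₀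
      (fun l => hvol0 _) (fun l => by
        by_cases h : (U.filter (fun v => d v s ≤ ρ / 2 + l * δ)).card = 0
        · left
          simp only [hvol, h, Nat.cast_zero, mul_zero, add_zero]
          rw [Finset.card_eq_zero, Finset.filter_eq_empty_iff] at h
          rw [wcost, Finset.sum_eq_zero]
          intro e he
          rw [Finset.mem_filter, hEU, Finset.mem_filter] at he
          exact absurd he.2 (h he.1.2.2)
        · right
          have h1 : (1 : ℝ) ≤ (U.filter (fun v => d v s ≤ ρ / 2 + l * δ)).card := by
            exact_mod_cast Nat.one_le_iff_ne_zero.2 h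
          simp only [hvol]
          have := hwc (EU.filter (fun e => d e.2 s ≤ ρ / 2 + l * δ))
          nlinarith)
      (by
        refine le_trans (add_le_add (hmonoc (Finset.filter_subset _ _))
          (mul_le_mul_of_nonneg_left ?_ hv₀)) hU
        rw [Nat.cast_le]
        exact Finset.card_le_card (Finset.filter_subset _ _)) hBL
    obtain ⟨r, hr1, hr2, hcut⟩ := exists_point_few_intervals EU c (fun e => d e.2 s)
      (fun e => d e.1 s) (fun e => w e.1 e.2) (fun e _ => hc e)
      (fun e he => by have := hd e (Finset.mem_filter.1 he).1 s; linarith) (fun e _ => hw _ _)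
      (ρ / 2 + l * δ) δ hδ0
    have hrρ2 : ρ / 2 ≤ r := le_trans (by have : 0 ≤ l * δ := by positivity
                                          linarith) hr1
    have hrρ : r ≤ ρ := by
      refine hr2.trans ?_
      have h1 : ((l : ℝ) + 1) ≤ L + 1 := by exact_mod_cast Nat.succ_le_succ hl
      have h2 : ((l : ℝ) + 1) * δ ≤ (L + 1) * δ := mul_le_mul_of_nonneg_right h1 hδ0.le
      have h3 : (L + 1) * δ = ρ / 2 := by rw [hδ]; field_simp
      linarith
    set Bl := U.filter (fun v => d v s ≤ r) with hBl
    set cutE := EU.filter (fun e => d e.2 s ≤ r ∧ r < d e.1 s) with hcutE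
    have hcutc : ∑ e ∈ cutE, c e ≤ 4 * (L + 1) / ρ * vol r := by
      have h1 : ∑ e ∈ EU with d e.2 s ≤ ρ / 2 + l * δ + δ, c e * w e.1 e.2 ≤
          vol (ρ / 2 + (l + 1 : ℕ) * δ) := by
        have e1 : ρ / 2 + l * δ + δ = ρ / 2 + (l + 1 : ℕ) * δ := by push_cast; ring
        rw [e1]
        exact le_add_of_nonneg_right (mul_nonneg hv₀ (Nat.cast_nonneg _))
      have h2 : δ * ∑ e ∈ cutE, c e ≤ 2 * vol r :=
        hcut.trans (h1.trans (hdbl.trans (by have := hvolmono hr1; linarith)))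
      have h3 : 4 * (L + 1) / ρ * vol r = δ⁻¹ * (2 * vol r) := by rw [hδ, inv_div]; ring
      rw [h3, ← div_eq_inv_mul, le_div_iff₀ hδ0, mul_comm]
      exact h2
    set U' := U \ Bl with hU'
    set EU' := E.filter (fun e => e.1 ∈ U' ∧ e.2 ∈ U') with hEU'
    -- The cut is paid by the volume of the ball, which disappears together with its vertices, so
    -- the charges of successive balls add up.
    have hpot : wcost EU' w c + v₀ * U'.card + vol r ≤ wcost EU w c + v₀ * U.card := by
      have h1 : wcost EU' w c + wcost (EU.filter (fun e => d e.2 s ≤ r)) w c ≤ wcost EU w c := by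
        rw [wcost, wcost, ← Finset.sum_union]
        · refine hmonoc (Finset.union_subset ?_ (Finset.filter_subset _ _))
          exact Finset.monotone_filter_right _ (fun e _ he =>
            ⟨(Finset.mem_sdiff.1 he.1).1, (Finset.mem_sdiff.1 he.2).1⟩)
        · rw [Finset.disjoint_left]
          intro e h1 h2
          rw [hEU', Finset.mem_filter] at h1
          rw [Finset.mem_filter, hEU, Finset.mem_filter] at h2
          exact (Finset.mem_sdiff.1 h1.2.2).2 (Finset.mem_filter.2 ⟨h2.1.2.2, h2.2⟩)
      have h2 : (U'.card : ℝ) + Bl.card = U.card := by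
        exact_mod_cast Finset.card_sdiff_add_card_eq_card (Finset.filter_subset _ U)
      simp only [hvol]
      rw [← h2]
      linarith
    obtain ⟨X, τ, hX, h1, h2, h3, h4⟩ := ih U' (by have := hvol0 r; linarith)
    refine ⟨X ∪ cutE, fun v => if v ∈ Bl then 0 else τ v + 1,
      Finset.union_subset hX ((Finset.filter_subset _ _).trans (Finset.filter_subset _ _)),
      fun e he heX ha hb => ?_, fun v hv z hz => ?_, fun v hv j z hz hdz => ?_, ?_⟩
    · rw [Finset.mem_union, not_or] at heX
      by_cases h5 : e.1 ∈ Bl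
      · simp [h5]
      · have h6 : e.2 ∉ Bl := by
          intro h6
          refine heX.2 (Finset.mem_filter.2 ⟨Finset.mem_filter.2 ⟨he, ha, hb⟩,
            (Finset.mem_filter.1 h6).2, ?_⟩)
          by_contra h7
          exact h5 (Finset.mem_filter.2 ⟨ha, not_lt.1 h7⟩)
        simp only [h5, h6, if_false]
        exact Nat.succ_le_succ (h1 e he heX.1 (Finset.mem_sdiff.2 ⟨ha, h5⟩)
          (Finset.mem_sdiff.2 ⟨hb, h6⟩))
    · by_cases h5 : v ∈ Bl
      · simp only [h5, if_true, List.getElem?_cons_zero, Option.some.injEq] at hz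
        rw [← hz]
        exact (Finset.mem_filter.1 h5).2.trans hrρ
      · simp only [h5, if_false, List.getElem?_cons_succ] at hz
        exact h2 v (Finset.mem_sdiff.2 ⟨hv, h5⟩) z hz
    · by_cases h5 : v ∈ Bl
      · simp [h5]
      · simp only [h5, if_false]
        cases j with
        | zero =>
          simp only [List.getElem?_cons_zero, Option.some.injEq] at hz
          rw [← hz] at hdz
          exact absurd (Finset.mem_filter.2 ⟨hv, hdz.trans hrρ2⟩) h5
        | succ j =>
          rw [List.getElem?_cons_succ] at hz
          exact Nat.succ_le_succ (h3 v (Finset.mem_sdiff.2 ⟨hv, h5⟩) j z hz hdz)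
    · have h5 : ∑ e ∈ X ∪ cutE, c e ≤ ∑ e ∈ X, c e + ∑ e ∈ cutE, c e := by
        rw [← Finset.sum_union_inter]
        exact le_add_of_nonneg_right (Finset.sum_nonneg (fun e _ => hc e))
      have h6 := mul_le_mul_of_nonneg_left hpot (show 0 ≤ 4 * (L + 1) / ρ by positivity)
      rw [mul_add] at h6
      linarith

/-- Cutting few edges makes the list index of the first near list member monotone along edges. -/
theorem exists_carve [Fintype V] [Nonempty V] (hw : ∀ x y, 0 ≤ w x y) (hc : ∀ e, 0 ≤ c e)
    (d : V → V → ℝ) (hd : ∀ e ∈ E, ∀ z, d e.1 z ≤ w e.1 e.2 + d e.2 z) {ρ : ℝ} (hρ : 0 < ρ)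
    {L : ℕ} (hL : 2 * Fintype.card V < 2 ^ L) (S : List V) :
    ∃ (X : Finset (V × V)) (τ : V → ℕ), X ⊆ E ∧
      (∀ e ∈ E, e ∉ X → τ e.1 ≤ τ e.2) ∧
      (∀ v z, S[τ v]? = some z → d v z ≤ ρ) ∧
      (∀ v j z, S[j]? = some z → d v z ≤ ρ / 2 → τ v ≤ j) ∧
      ∑ e ∈ X, c e ≤ 8 * (L + 1) / ρ * wcost E w c := by
  have hn : (0 : ℝ) < Fintype.card V := by exact_mod_cast Fintype.card_pos
  have hwc : 0 ≤ wcost E w c := Finset.sum_nonneg (fun e _ => mul_nonneg (hc e) (hw _ _))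
  have e1 : E.filter (fun e => e.1 ∈ Finset.univ ∧ e.2 ∈ Finset.univ) = E := by simp
  have hpot : wcost (E.filter (fun e => e.1 ∈ Finset.univ ∧ e.2 ∈ Finset.univ)) w c +
      wcost E w c / Fintype.card V * (Finset.univ : Finset V).card = 2 * wcost E w c := by
    rw [e1, Finset.card_univ]
    field_simp
    norm_num
  -- A seed volume of wcost/n per vertex only doubles the total and makes it 2n times the seed, so
  -- doubling stops within L steps when 2n < 2^L.
  obtain ⟨X, τ, h1, h2, h3, h4, h5⟩ := exists_carve_aux hw hc d hd hρ
    (v₀ := wcost E w c / Fintype.card V) (B := 2 * Fintype.card V) (L := L) (by positivity)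
    (by exact_mod_cast hL) S Finset.univ (by
      refine le_of_eq ?_
      convert hpot using 1
      field_simp)
  refine ⟨X, τ, h1, fun e he heX => h2 e he heX (Finset.mem_univ _) (Finset.mem_univ _),
    fun v => h3 v (Finset.mem_univ _), fun v => h4 v (Finset.mem_univ _), h5.trans (le_of_eq ?_)⟩
  have : wcost (E.filter (fun e => e.1 ∈ Finset.univ ∧ e.2 ∈ Finset.univ)) w c +
      wcost E w c / Fintype.card V * (Finset.univ : Finset V).card = 2 * wcost E w c := hpot
  calc _ = 4 * (L + 1) / ρ * (2 * wcost E w c) := by rw [← this]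
    _ = _ := by ring

end carve

/-! ### Strongly connected components of small diameter -/

section scc
variable {V : Type*} {E E' : Finset (V × V)} {w : V → V → ℝ} {c : V × V → ℝ}

/-- Adjacency relation of a finite set of edges. -/
def EAdj (E : Finset (V × V)) (x y : V) : Prop := (x, y) ∈ E

/-- Mutual reachability. -/
def Mut (E : Finset (V × V)) (x y : V) : Prop :=
  Relation.ReflTransGen (EAdj E) x y ∧ Relation.ReflTransGen (EAdj E) y x

theorem Mut.symm {x y : V} (h : Mut E x y) : Mut E y x := ⟨h.2, h.1⟩

theorem Mut.trans {x y z : V} (h : Mut E x y) (h' : Mut E y z) : Mut E x z :=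
  ⟨h.1.trans h'.1, h'.2.trans h.2⟩

theorem EAdj.reach_mono (h : E' ⊆ E) {x y : V} (hr : Relation.ReflTransGen (EAdj E') x y) :
    Relation.ReflTransGen (EAdj E) x y := Relation.ReflTransGen.mono (fun _ _ h' => h h') _ _ hr

theorem Mut.mono (h : E' ⊆ E) {x y : V} (hm : Mut E' x y) : Mut E x y :=
  ⟨EAdj.reach_mono h hm.1, EAdj.reach_mono h hm.2⟩

/-- Every edge of a walk that can be closed up has mutually reachable ends, so monotonicity inside
components is enough. -/
theorem le_of_mut (h : E' ⊆ E) (τ : V → ℕ) (hτ : ∀ a b, EAdj E' a b → Mut E a b → τ a ≤ τ b)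
    {x y : V} (hxy : Relation.ReflTransGen (EAdj E') x y)
    (hyx : Relation.ReflTransGen (EAdj E') y x) : τ x ≤ τ y := by
  induction hxy using Relation.ReflTransGen.head_induction_on with
  | refl => exact le_rfl
  | head hab hby ih =>
    have h1 : Mut E' _ _ := ⟨Relation.ReflTransGen.single hab, hby.trans hyx⟩
    exact (hτ _ _ hab (h1.mono h)).trans (ih (hyx.trans (Relation.ReflTransGen.single hab)))

variable [DecidableEq V]

/-- Region growing along reversed edges. -/
theorem exists_carve_out [Fintype V] [Nonempty V] (hw : ∀ x y, 0 ≤ w x y) (hc : ∀ e, 0 ≤ c e)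
    (d : V → V → ℝ) (hd : ∀ e ∈ E, ∀ z, d z e.2 ≤ d z e.1 + w e.1 e.2) {ρ : ℝ} (hρ : 0 < ρ)
    {L : ℕ} (hL : 2 * Fintype.card V < 2 ^ L) (S : List V) :
    ∃ (X : Finset (V × V)) (τ : V → ℕ), X ⊆ E ∧
      (∀ e ∈ E, e ∉ X → τ e.2 ≤ τ e.1) ∧
      (∀ v z, S[τ v]? = some z → d z v ≤ ρ) ∧
      (∀ v j z, S[j]? = some z → d z v ≤ ρ / 2 → τ v ≤ j) ∧
      ∑ e ∈ X, c e ≤ 8 * (L + 1) / ρ * wcost E w c := by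
  obtain ⟨X, τ, h1, h2, h3, h4, h5⟩ := exists_carve (E := E.map (Equiv.prodComm V V).toEmbedding)
    (w := fun x y => w y x) (c := fun e => c e.swap) (fun x y => hw y x) (fun e => hc _)
    (fun x y => d y x) (fun e he z => by
      obtain ⟨e', he', rfl⟩ := Finset.mem_map.1 he
      have := hd e' he' z
      simp only [Equiv.coe_toEmbedding, Equiv.prodComm_apply, Prod.fst_swap, Prod.snd_swap]
      linarith) hρ hL S
  refine ⟨X.map (Equiv.prodComm V V).toEmbedding, τ, fun e he => ?_, fun e he heX => ?_, h3, h4, ?_⟩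
  · obtain ⟨e', he', rfl⟩ := Finset.mem_map.1 he
    obtain ⟨e'', he'', rfl⟩ := Finset.mem_map.1 (h1 he')
    simpa using he''
  · exact h2 e.swap (Finset.mem_map.2 ⟨e, he, rfl⟩)
      (fun h => heX (Finset.mem_map.2 ⟨e.swap, h, by simp⟩))
  · rw [Finset.sum_map]
    refine h5.trans (le_of_eq ?_)
    congr 1
    rw [wcost, Finset.sum_map]
    simp [wcost]

open Classical in
/-- One round of halving the strongly connected components of large diameter. -/
theorem exists_scc_halving [Fintype V] [Nonempty V] (hw : ∀ x y, 0 ≤ w x y) (hc : ∀ e, 0 ≤ c e)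
    {L : ℕ} (hL : 2 * Fintype.card V < 2 ^ L) {T : ℝ} (hT : 1 ≤ T) (E : Finset (V × V)) :
    ∃ E' ⊆ E, ∑ e ∈ E \ E', c e ≤ 32 * (L + 1) * wcost E w c ∧
      ∀ x y, Mut E' x y →
        2 * (Finset.univ.filter (Mut E' x)).card ≤ (Finset.univ.filter (Mut E x)).card ∨
        tdist (EAdj E) w T x y ≤ 1 := by
  have hT0 : 0 ≤ T := by linarith
  -- Only edges inside components matter for mutual reachability, and restricting to them keeps
  -- every ball inside one component.
  set EI := E.filter (fun e => Mut E e.1 e.2) with hEI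
  have hEIE : EI ⊆ E := Finset.filter_subset _ _
  set d := tdist (EAdj EI) w T with hd
  have hdw : ∀ e ∈ EI, d e.1 e.2 ≤ w e.1 e.2 := fun e he =>
    tdist_le_walk hw hT0 (HasWalk.single he)
  have hdtri : ∀ x y z, d x z ≤ d x y + d y z := fun x y z => tdist_triangle hw hT0
  have hd0 : ∀ x, d x x = 0 := fun x => tdist_refl hw hT0
  have hdmut : ∀ x y, d x y ≤ 1 / 2 → Mut E x y := by
    intro x y h
    obtain ⟨l, -, hl⟩ := exists_walk_of_tdist_lt (lt_of_le_of_lt h (show (1 / 2 : ℝ) < T by linarith))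
      le_rfl
    have hr := hl.reach
    clear h hl
    induction hr with
    | refl => exact ⟨.refl, .refl⟩
    | tail _ h ih => exact ih.trans (Finset.mem_filter.1 h).2
  set inb : V → Finset V := fun v => Finset.univ.filter (fun u => d u v ≤ 1 / 2) with hinb
  set outb : V → Finset V := fun v => Finset.univ.filter (fun u => d v u ≤ 1 / 2) with houtb
  set scc : V → Finset V := fun v => Finset.univ.filter (Mut E v) with hscc
  have hscceq : ∀ x y, Mut E x y → scc x = scc y := by
    intro x y h
    ext z
    simp only [hscc, Finset.mem_filter, Finset.mem_univ, true_and]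
    exact ⟨fun h' => h.symm.trans h', fun h' => h.trans h'⟩
  set S₁ := (Finset.univ.filter (fun v => 2 * (inb v).card ≤ (scc v).card)).toList with hS1
  -- Carving is done around vertices whose in-ball, respectively out-ball, of radius 1/2 fills at
  -- most half of the component. A new component inside such a ball has halved.
  set S₂ := (Finset.univ.filter (fun v => 2 * (outb v).card ≤ (scc v).card)).toList with hS2
  obtain ⟨X₁, τ₁, hX1, ha1, ha2, ha3, ha4⟩ := exists_carve (E := EI) hw hc d
    (fun e he z => (hdtri _ e.2 _).trans (by have := hdw e he; linarith)) (ρ := 1 / 2) (by norm_num)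
    hL S₁
  obtain ⟨X₂, τ₂, hX2, hb1, hb2, hb3, hb4⟩ := exists_carve_out (E := EI) hw hc d
    (fun e he z => (hdtri _ e.1 _).trans (by have := hdw e he; linarith)) (ρ := 1 / 2) (by norm_num)
    hL S₂
  have hE'E : E \ (X₁ ∪ X₂) ⊆ E := Finset.sdiff_subset
  refine ⟨E \ (X₁ ∪ X₂), hE'E, ?_, fun x y hxy => ?_⟩
  · have h1 : E \ (E \ (X₁ ∪ X₂)) ⊆ X₁ ∪ X₂ := by
      intro e he
      simp only [Finset.mem_sdiff, not_and, not_not] at he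
      exact he.2 he.1
    have h2 : wcost EI w c ≤ wcost E w c :=
      Finset.sum_le_sum_of_subset_of_nonneg hEIE (fun e _ _ => mul_nonneg (hc e) (hw _ _))
    have h3 : ∑ e ∈ X₁ ∪ X₂, c e ≤ ∑ e ∈ X₁, c e + ∑ e ∈ X₂, c e := by
      rw [← Finset.sum_union_inter]
      exact le_add_of_nonneg_right (Finset.sum_nonneg (fun e _ => hc e))
    have h4 := Finset.sum_le_sum_of_subset_of_nonneg h1 (fun e _ _ => hc e)
    have h5 := mul_le_mul_of_nonneg_left h2 (show (0 : ℝ) ≤ 32 * (L + 1) by positivity)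
    have e1 : 8 * ((L : ℝ) + 1) / (1 / 2) * wcost EI w c = 16 * (L + 1) * wcost EI w c := by ring
    rw [e1] at ha4 hb4
    linarith
  · have hedge : ∀ a b, EAdj (E \ (X₁ ∪ X₂)) a b → Mut E a b →
        (a, b) ∈ EI ∧ (a, b) ∉ X₁ ∧ (a, b) ∉ X₂ := by
      intro a b hab hm
      have h1 := Finset.mem_sdiff.1 (show (a, b) ∈ E \ (X₁ ∪ X₂) from hab)
      rw [Finset.mem_union, not_or] at h1
      exact ⟨Finset.mem_filter.2 ⟨h1.1, hm⟩, h1.2⟩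
    have hτ1 : ∀ u v, Mut (E \ (X₁ ∪ X₂)) u v → τ₁ u = τ₁ v := by
      have key : ∀ u v, Mut (E \ (X₁ ∪ X₂)) u v → τ₁ u ≤ τ₁ v := fun u v h =>
        le_of_mut hE'E τ₁ (fun a b hab hm => ha1 (a, b) (hedge a b hab hm).1 (hedge a b hab hm).2.1)
          h.1 h.2
      exact fun u v h => le_antisymm (key u v h) (key v u h.symm)
    have hτ2 : ∀ u v, Mut (E \ (X₁ ∪ X₂)) u v → τ₂ u = τ₂ v := by
      have key : ∀ u v, Mut (E \ (X₁ ∪ X₂)) u v → τ₂ v ≤ τ₂ u := fun u v h => by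
        have hmp : EAdj (E \ (X₁ ∪ X₂)) ≤ Function.swap
            (EAdj ((E \ (X₁ ∪ X₂)).map (Equiv.prodComm V V).toEmbedding)) :=
          fun r s hrs => Finset.mem_map.2 ⟨(r, s), hrs, rfl⟩
        have h1 := le_of_mut (E := E.map (Equiv.prodComm V V).toEmbedding)
          (E' := (E \ (X₁ ∪ X₂)).map (Equiv.prodComm V V).toEmbedding)
          (Finset.map_subset_map.2 hE'E) τ₂ (fun a b hab hm => ?_)
          (x := v) (y := u) ?_ ?_
        · exact h1
        · obtain ⟨e, he, hee⟩ := Finset.mem_map.1 (show (a, b) ∈ _ from hab)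
          obtain ⟨rfl, rfl⟩ := Prod.mk.inj hee
          have hswap : ∀ {p q : V}, Relation.ReflTransGen
              (EAdj (E.map (Equiv.prodComm V V).toEmbedding)) p q →
              Relation.ReflTransGen (EAdj E) q p := by
            intro p q hpq
            rw [← Relation.reflTransGen_swap]
            refine Relation.ReflTransGen.mono (fun r s hrs => ?_) _ _ hpq
            obtain ⟨e, he, hee⟩ := Finset.mem_map.1 (show (r, s) ∈ _ from hrs)
            obtain ⟨rfl, rfl⟩ := Prod.mk.inj hee
            exact he
          have hm' : Mut E e.1 e.2 := ⟨hswap hm.1, hswap hm.2⟩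
          have h2 := hedge e.1 e.2 he hm'
          exact hb1 e h2.1 h2.2.2
        · rw [← Relation.reflTransGen_swap]
          exact Relation.ReflTransGen.mono hmp _ _ h.1
        · rw [← Relation.reflTransGen_swap]
          exact Relation.ReflTransGen.mono hmp _ _ h.2
      exact fun u v h => le_antisymm (key v u h.symm) (key u v h)
    have hsub : ∀ (z : V) (B : Finset V), Mut E x z → 2 * B.card ≤ (scc z).card →
        (∀ u, Mut (E \ (X₁ ∪ X₂)) x u → u ∈ B) →
        2 * (Finset.univ.filter (Mut (E \ (X₁ ∪ X₂)) x)).card ≤ (scc x).card := by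
      intro z B hz hB hu
      rw [hscceq x z hz]
      refine le_trans (Nat.mul_le_mul_left 2 (Finset.card_le_card (fun u h => ?_))) hB
      exact hu u (Finset.mem_filter.1 h).2
    by_cases hl1 : ∃ z, S₁[τ₁ x]? = some z
    · left
      obtain ⟨z, hz⟩ := hl1
      have hzm : z ∈ S₁ := List.mem_of_getElem? hz
      rw [hS1, Finset.mem_toList, Finset.mem_filter] at hzm
      refine hsub z (inb z) (hdmut _ _ (ha2 x z hz)) hzm.2 (fun u hu => ?_)
      refine Finset.mem_filter.2 ⟨Finset.mem_univ _, ha2 u z ?_⟩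
      rw [← hτ1 x u hu]; exact hz
    by_cases hl2 : ∃ z, S₂[τ₂ x]? = some z
    · left
      obtain ⟨z, hz⟩ := hl2
      have hzm : z ∈ S₂ := List.mem_of_getElem? hz
      rw [hS2, Finset.mem_toList, Finset.mem_filter] at hzm
      refine hsub z (outb z) (hdmut _ _ (hb2 x z hz)).symm hzm.2 (fun u hu => ?_)
      refine Finset.mem_filter.2 ⟨Finset.mem_univ _, hb2 u z ?_⟩
      rw [← hτ2 x u hu]; exact hz
    right
    have hxout : (scc x).card < 2 * (outb x).card := by
      by_contra hcon
      push Not at hcon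
      have : x ∈ S₂ := by
        rw [hS2, Finset.mem_toList, Finset.mem_filter]
        exact ⟨Finset.mem_univ _, hcon⟩
      obtain ⟨j, hj⟩ := List.getElem?_of_mem this
      have h1 := hb3 x j x hj (by rw [hd0]; norm_num)
      refine hl2 ⟨S₂[τ₂ x]'(lt_of_le_of_lt h1 (List.getElem?_eq_some_iff.1 hj).1), ?_⟩
      exact List.getElem?_eq_getElem _
    have hyin : (scc y).card < 2 * (inb y).card := by
      by_contra hcon
      push Not at hcon
      have : y ∈ S₁ := by
        rw [hS1, Finset.mem_toList, Finset.mem_filter]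
        exact ⟨Finset.mem_univ _, hcon⟩
      obtain ⟨j, hj⟩ := List.getElem?_of_mem this
      have h1 := ha3 y j y hj (by rw [hd0]; norm_num)
      rw [← hτ1 x y hxy] at h1
      refine hl1 ⟨S₁[τ₁ x]'(lt_of_le_of_lt h1 (List.getElem?_eq_some_iff.1 hj).1), ?_⟩
      exact List.getElem?_eq_getElem _
    have hMxy := hxy.mono hE'E
    rw [← hscceq x y hMxy] at hyin
    -- For uncarved x and y, the out-ball of x and the in-ball of y each fill more than half of the
    -- component, so they meet and d(x, y) ≤ 1/2 + 1/2.
    obtain ⟨m, hm⟩ := Finset.inter_nonempty_of_card_lt_card_add_card (s := scc x) (t := outb x)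
      (u := inb y) (fun u hu => Finset.mem_filter.2 ⟨Finset.mem_univ _,
        hdmut _ _ (Finset.mem_filter.1 hu).2⟩) (fun u hu => Finset.mem_filter.2 ⟨Finset.mem_univ _,
        hMxy.trans (hdmut _ _ (Finset.mem_filter.1 hu).2).symm⟩) (by omega)
    rw [Finset.mem_inter] at hm
    have h1 := (Finset.mem_filter.1 hm.1).2
    have h2 := (Finset.mem_filter.1 hm.2).2
    have h3 : tdist (EAdj E) w T x y ≤ d x y := tdist_anti hw hT0 (fun a b h => hEIE h)
    have h4 := hdtri x m y
    linarith

open Classical in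
/-- Deleting few edges makes mutually reachable vertices close in the original graph. -/
theorem exists_scc_ldd [Fintype V] [Nonempty V] (hw : ∀ x y, 0 ≤ w x y) (hc : ∀ e, 0 ≤ c e)
    {m : ℕ} (hm : Fintype.card V < 2 ^ m) {T : ℝ} (hT : 1 ≤ T) (E : Finset (V × V)) :
    ∃ E' ⊆ E, ∑ e ∈ E \ E', c e ≤ m * (32 * (m + 2)) * wcost E w c ∧
      ∀ x y, Mut E' x y → tdist (EAdj E) w T x y ≤ 1 := by
  have hT0 : 0 ≤ T := by linarith
  have key : ∀ i : ℕ, ∃ E' ⊆ E, ∑ e ∈ E \ E', c e ≤ i * (32 * (m + 2)) * wcost E w c ∧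
      ∀ x y, Mut E' x y → 2 ^ i * (Finset.univ.filter (Mut E' x)).card ≤ Fintype.card V ∨
        tdist (EAdj E) w T x y ≤ 1 := by
    intro i
    induction i with
    | zero =>
      refine ⟨E, subset_rfl, by simp, fun x y _ => Or.inl ?_⟩
      rw [pow_zero, one_mul]
      exact Finset.card_le_univ _
    | succ i ih =>
      obtain ⟨E₁, hE1, h1, h2⟩ := ih
      obtain ⟨E₂, hE2, h3, h4⟩ := exists_scc_halving hw hc (L := m + 1) (by rw [pow_succ]; omega) hT E₁
      refine ⟨E₂, hE2.trans hE1, ?_, fun x y hxy => ?_⟩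
      · have h5 : ∑ e ∈ E \ E₂, c e ≤ ∑ e ∈ E \ E₁, c e + ∑ e ∈ E₁ \ E₂, c e := by
          have h6 : E \ E₂ ⊆ (E \ E₁) ∪ (E₁ \ E₂) := by
            intro e he
            simp only [Finset.mem_union, Finset.mem_sdiff] at he ⊢
            tauto
          refine (Finset.sum_le_sum_of_subset_of_nonneg h6 (fun e _ _ => hc e)).trans ?_
          rw [← Finset.sum_union_inter]
          exact le_add_of_nonneg_right (Finset.sum_nonneg (fun e _ => hc e))
        have h7 : wcost E₁ w c ≤ wcost E w c :=
          Finset.sum_le_sum_of_subset_of_nonneg hE1 (fun e _ _ => mul_nonneg (hc e) (hw _ _))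
        have h8 := mul_le_mul_of_nonneg_left h7 (show (0 : ℝ) ≤ 32 * ((m + 1 : ℕ) + 1) by positivity)
        push_cast at h3 h8 ⊢
        have e1 : (i + 1 : ℝ) * (32 * (m + 2)) * wcost E w c =
          i * (32 * (m + 2)) * wcost E w c + 32 * (m + 1 + 1) * wcost E w c := by ring
        rw [e1]
        linarith
      · rcases h2 x y (hxy.mono hE2) with h5 | h5
        · rcases h4 x y hxy with h6 | h6
          · left
            calc 2 ^ (i + 1) * (Finset.univ.filter (Mut E₂ x)).card
                = 2 ^ i * (2 * (Finset.univ.filter (Mut E₂ x)).card) := by ring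
              _ ≤ 2 ^ i * (Finset.univ.filter (Mut E₁ x)).card := Nat.mul_le_mul_left _ h6
              _ ≤ _ := h5
          · right
            exact (tdist_anti hw hT0 (fun a b h => hE1 h)).trans h6
        · exact Or.inr h5
  obtain ⟨E', hE', h1, h2⟩ := key m
  refine ⟨E', hE', h1, fun x y hxy => (h2 x y hxy).resolve_left (fun h => ?_)⟩
  have h3 : 1 ≤ (Finset.univ.filter (Mut E' x)).card :=
    Finset.card_pos.2 ⟨x, Finset.mem_filter.2 ⟨Finset.mem_univ _, .refl, .refl⟩⟩
  have h4 : 2 ^ m * 1 ≤ 2 ^ m * (Finset.univ.filter (Mut E' x)).card := Nat.mul_le_mul_left _ h3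
  omega

end scc

/-! ### Greedy covering and kill operations -/

open Classical in
/-- Rounding a fractional cover greedily. -/
theorem exists_cover_list {O P : Type*} [Fintype O] (D γ : O → ℝ) (hD : ∀ o, 0 ≤ D o)
    (hγ : ∀ o, 0 ≤ γ o) (k : O → P → Prop) {B t : ℝ} (ht : 0 < t) (hB : ∑ o, D o * γ o ≤ B)
    (N : ℕ) (H : Finset P) (hN : H.card = N) (hH : ∀ p ∈ H, t ≤ ∑ o, if k o p then D o else 0) :
    ∃ l : List O, (∀ p ∈ H, ∃ o ∈ l, k o p) ∧ (l.map γ).sum ≤ B / t * (1 + Real.log N) := by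
  have hB0 : 0 ≤ B := (Finset.sum_nonneg (fun o _ => mul_nonneg (hD o) (hγ o))).trans hB
  induction N using Nat.strong_induction_on generalizing H with
  | _ N ih =>
    rcases Nat.eq_zero_or_pos N with h0 | hpos
    · subst h0
      rw [Finset.card_eq_zero] at hN
      subst hN
      exact ⟨[], by simp, by simp; positivity⟩
    have hN0 : (0 : ℝ) < N := by exact_mod_cast hpos
    set kl : O → ℝ := fun o => ((H.filter (k o)).card : ℝ) with hkl
    have hkl0 : ∀ o, 0 ≤ kl o := fun o => Nat.cast_nonneg _
    have hsum : t * N ≤ ∑ o, D o * kl o := by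
      calc t * N = ∑ p ∈ H, t := by rw [Finset.sum_const, hN, nsmul_eq_mul, mul_comm]
        _ ≤ ∑ p ∈ H, ∑ o, if k o p then D o else 0 := Finset.sum_le_sum hH
        _ = _ := by
          rw [Finset.sum_comm]
          refine Finset.sum_congr rfl (fun o _ => ?_)
          rw [← Finset.sum_filter, Finset.sum_const, nsmul_eq_mul, mul_comm]
    -- Some operation has a price per newly covered element no worse than the fractional average
    -- B/(tN).
    obtain ⟨o, hko, ho⟩ : ∃ o, 0 < kl o ∧ γ o * (t * N) ≤ kl o * B := by
      by_contra hcon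
      push Not at hcon
      have hle : ∀ o, D o * kl o * B ≤ D o * γ o * (t * N) := by
        intro o
        rcases (hkl0 o).lt_or_eq with h | h
        · have := mul_le_mul_of_nonneg_left (hcon o h).le (hD o)
          linarith
        · rw [← h]
          have := mul_nonneg (mul_nonneg (hD o) (hγ o)) (mul_nonneg ht.le hN0.le)
          linarith
      obtain ⟨o, ho⟩ : ∃ o, 0 < D o * kl o := by
        by_contra h
        push Not at h
        have := Finset.sum_nonpos (fun o (_ : o ∈ Finset.univ) => h o)
        have : 0 < t * N := by positivity
        linarith
      have hDo : 0 < D o := by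
        rcases (hD o).lt_or_eq with h | h
        · exact h
        · rw [← h, zero_mul] at ho; exact absurd ho (lt_irrefl _)
      have hko : 0 < kl o := by
        rcases (hkl0 o).lt_or_eq with h | h
        · exact h
        · rw [← h, mul_zero] at ho; exact absurd ho (lt_irrefl _)
      have hlt : ∑ o, D o * kl o * B < ∑ o, D o * γ o * (t * N) :=
        Finset.sum_lt_sum (fun o _ => hle o) ⟨o, Finset.mem_univ _, by
          have := mul_lt_mul_of_pos_left (hcon o hko) hDo
          linarith⟩
      rw [← Finset.sum_mul, ← Finset.sum_mul] at hlt
      have h1 := mul_le_mul_of_nonneg_right hsum hB0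
      have h2 := mul_le_mul_of_nonneg_right hB (show 0 ≤ t * N by positivity)
      linarith
    set H' := H.filter (fun p => ¬ k o p) with hH'
    have hcard : (H.filter (k o)).card + H'.card = N := by
      rw [← hN]; exact Finset.card_filter_add_card_filter_not _
    have hkpos : 0 < (H.filter (k o)).card := by
      have : (0 : ℝ) < ((H.filter (k o)).card : ℝ) := hko
      exact_mod_cast this
    have hγo : γ o ≤ B / t * (kl o / N) := by
      rw [div_mul_div_comm, le_div_iff₀ (by positivity)]
      linarith
    have hBt : 0 ≤ B / t := by positivity
    rcases Nat.eq_zero_or_pos H'.card with h0 | h0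
    · refine ⟨[o], fun p hp => ⟨o, List.mem_singleton_self _, ?_⟩, ?_⟩
      · by_contra h
        rw [Finset.card_eq_zero] at h0
        have : p ∈ H' := Finset.mem_filter.2 ⟨hp, h⟩
        rw [h0] at this
        exact absurd this (Finset.notMem_empty p)
      · have hk1 : kl o = N := by
          simp only [hkl]
          rw [← hcard, h0, add_zero]
        rw [hk1, div_self hN0.ne', mul_one] at hγo
        have hlog := Real.log_nonneg (show (1 : ℝ) ≤ N by exact_mod_cast hpos)
        simp only [List.map_cons, List.map_nil, List.sum_cons, List.sum_nil, add_zero]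
        nlinarith
    · obtain ⟨l, hl1, hl2⟩ := ih H'.card (by omega) H' rfl
        (fun p hp => hH p (Finset.mem_filter.1 hp).1)
      refine ⟨o :: l, fun p hp => ?_, ?_⟩
      · by_cases h : k o p
        · exact ⟨o, List.mem_cons_self, h⟩
        · obtain ⟨o', ho', hk⟩ := hl1 p (Finset.mem_filter.2 ⟨hp, h⟩)
          exact ⟨o', List.mem_cons_of_mem _ ho', hk⟩
      · rw [List.map_cons, List.sum_cons]
        have h1 : (0 : ℝ) < H'.card := by exact_mod_cast h0
        have h2 : (kl o : ℝ) + H'.card = N := by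
          simp only [hkl]
          exact_mod_cast hcard
        -- From log x ≤ x - 1: the logarithm drops by at least the covered fraction, which pays for
        -- this operation.
        have h3 : Real.log H'.card ≤ Real.log N - kl o / N := by
          have h4 := Real.log_le_sub_one_of_pos (show (0 : ℝ) < H'.card / N by positivity)
          rw [Real.log_div h1.ne' hN0.ne'] at h4
          have h5 : (H'.card : ℝ) / N - 1 = - (kl o / N) := by
            rw [← h2]; field_simp; ring
          linarith
        have h4 := mul_le_mul_of_nonneg_left h3 hBt
        rw [mul_sub] at h4
        rw [mul_add, mul_one] at hl2 ⊢
        linarith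

namespace Frame
variable {V : Type*}

/-- The frame of a digraph `E` and a subgraph `F` whose strongly connected components are small. -/
noncomputable def ofEdges (E F : Finset (V × V)) (hF : F ⊆ E) (w : V → V → ℝ)
    (hw : ∀ x y, 0 ≤ w x y) (hw1 : ∀ e ∈ E, w e.1 e.2 ≤ 1) (vol : V → ℝ)
    (hv0 : ∀ x, 0 ≤ vol x) (hvol : ∀ e ∈ E, w e.1 e.2 ≤ vol e.1) (H : ℝ) (hH : 0 ≤ H)
    (hback : ∀ x y, Mut F x y → tdist (EAdj E) w (H + 1) x y ≤ 1) (Λ : ℕ) (hΛ : 1 ≤ Λ)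
    (A : ℕ → ℕ) : Frame V where
  dn := tdist (EAdj F) w (H + 1)
  df := tdist (EAdj E) w (H + 1)
  w := w
  vol := vol
  E := EAdj F
  H := H
  Λ := Λ
  A := A
  df_le_dn _ _ := tdist_anti hw (by linarith) (fun _ _ h => hF h)
  df_nonneg _ _ := tdist_nonneg hw (by linarith)
  dn_self _ := tdist_refl hw (by linarith)
  df_tri _ _ _ := tdist_triangle hw (by linarith)
  dn_tri _ _ _ := tdist_triangle hw (by linarith)
  dn_le_w _ _ h := tdist_le_walk hw (by linarith) (HasWalk.single h)
  w_nonneg := hw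
  w_le_one _ _ h := hw1 _ (hF h)
  w_le_vol _ _ h := hvol _ (hF h)
  vol_nonneg := hv0
  -- Truncation at H + 1 is invisible up to H, so a distance of at most H comes from an actual
  -- return walk.
  back s hs hd := by
    obtain ⟨l, -, hl⟩ := exists_walk_of_tdist_lt (lt_of_le_of_lt hd (lt_add_one H)) le_rfl
    exact hback _ _ ⟨(hs.hasWalk (w := w)).reach, hl.reach⟩
  one_le_Λ := hΛ

/-- An operation kills a pair: carving around the list separates the two vertices. -/
def KillPair (M : Frame V) (ρ : ℝ) (S : List V) (z : V × V) : Prop :=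
  ∃ S₁ y S₂, S = S₁ ++ y :: S₂ ∧ M.dn z.2 y ≤ ρ / 2 ∧ ∀ c ∈ S₁ ++ [y], ρ < M.dn z.1 c

variable {M : Frame V}

/-- The start of the window is within its length A_j Λ^j = rad/2 of any vertex on it. -/
theorem KillPair.of_kill {j : ℕ} {S : List V} {s : Seg V} {a b : ℕ} {x : V}
    (hs : s.IsPath M.E) (ha : s.a ≤ a) (hab : a ≤ b) (hb : b ≤ s.b)
    (hl : (⟨s.p, a, b⟩ : Seg V).len M.w ≤ M.A j * M.Λ ^ j)
    (h : M.Kill (M.rad j) S x ⟨s.p, a, b⟩) : M.KillPair (M.rad j) S (x, s.p a) := by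
  obtain ⟨S₁, y, S₂, h1, ⟨t, h2, h3, rfl⟩, h4⟩ := h
  refine ⟨S₁, _, S₂, h1, ?_, h4⟩
  have h5 := M.dn_le_len (hs.sub ha hab hb) le_rfl h2 h3
  have h6 : M.rad j / 2 = M.A j * M.Λ ^ j := by rw [rad]; ring
  rw [h6]
  exact h5.trans hl

/-- A chain of blocks far from `x` that meets a short path kills it. -/
theorem KillPair.of_touch {k : ℕ} {C : List V} {s : Seg V} {a b : ℕ} {x : V}
    (hs : s.IsPath M.E) (ha : s.a ≤ a) (hab : a ≤ b) (hb : b ≤ s.b)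
    (hl : (⟨s.p, a, b⟩ : Seg V).len M.w ≤ M.A k * M.Λ ^ k)
    (hC : chainLen M.dn C ≤ M.Λ ^ k)
    (hfar : ∀ y, (⟨s.p, a, b⟩ : Seg V).Mem y → M.rad k + M.Λ ^ k < M.df x y)
    (h : (⟨s.p, a, b⟩ : Seg V).Touch C) : M.KillPair (M.rad k) C (x, s.p a) := by
  obtain ⟨y, hy, hmem⟩ := h
  obtain ⟨S₁, S₂, rfl⟩ := List.append_of_mem hy
  exact KillPair.of_kill hs ha hab hb hl
    ⟨S₁, y, S₂, rfl, hmem, fun c hc => M.lt_of_far hC hc (hfar y hmem)⟩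

end Frame

/-- The path through a tuple of vertices. -/
def tupleSeg {V : Type*} {n : ℕ} (hn : 0 < n) (z : Fin n → V) (a b : ℕ) : Seg V :=
  ⟨fun i => z ⟨min i (n - 1), by omega⟩, a, b⟩

namespace Frame
variable {V : Type*} {M : Frame V}

/-- For the zero function, flatness of a window only says that it is short. -/
theorem Lvl.exists_window {k : ℕ} {Θ : Set V} {s : Seg V} (hs : M.Lvl (k + 1) Θ s)
    (hA : 40 * M.A (k + 1) ≤ M.A k) (hA0 : 0 < M.A k) (hΛ : 4 * (M.lag k + 1) ≤ M.Λ) :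
    ∃ i, M.lag k ≤ i ∧ i < M.Λ / 2 ∧ M.Lvl k Θ (M.win (M.Λ ^ k) s i) ∧
      ∀ y, (M.win (M.Λ ^ k) s i).Mem y → M.rad k + M.Λ ^ k < M.df (M.src k s i) y := by
  classical
  have hR := M.one_le_pow k
  have hΛ0 : (0 : ℝ) < M.Λ := by exact_mod_cast M.one_le_Λ
  have h1 := hs.many_flat (fun _ => 0) (lam := 0) (Vm := 0) (h := 1) le_rfl (by simp) (by simp)
    (by simp) hA hA0 hΛ one_pos (by simp)
  have h2 : 0 < ((Finset.Ico (M.lag k) (M.Λ / 2)).filter (M.Flat k (fun _ => 0) 1 s)).card := by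
    have : (0 : ℝ) < ((Finset.Ico (M.lag k) (M.Λ / 2)).filter
      (M.Flat k (fun _ => 0) 1 s)).card := lt_of_lt_of_le (by positivity) h1
    exact_mod_cast this
  obtain ⟨i, hi⟩ := Finset.card_pos.1 h2
  rw [Finset.mem_filter, Finset.mem_Ico] at hi
  refine ⟨i, hi.1.1, hi.1.2, ⟨win_far hs.far hi.1.2, fun t h3 h4 => ?_, hi.2.1⟩, ?_⟩
  · exact hs.mem t ((cut_spec (M := M) _).1.trans h3) (h4.trans (cut_le_of_far hs.far hi.1.2))
  · rintro y ⟨t, h3, h4, rfl⟩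
    have h5 := far_df hs.far (i := i - M.lag k) (i' := i) (Nat.sub_le _ _) hi.1.2.le h3
      (h4.trans (cut_le_of_far hs.far hi.1.2))
    rw [Nat.cast_sub hi.1.1] at h5
    refine lt_of_lt_of_le ?_ h5
    have e : ((M.lag k : ℕ) : ℝ) = M.A k + 2 := by rw [lag]; push_cast; ring
    rw [sub_sub_cancel, e, rad]
    nlinarith

open Classical in
/-- A weighted family of kill operations that hits every short path with far ends. -/
theorem Dichotomy.exists_operations [Fintype V] {K : ℕ} {α q : ℝ} (hM : M.Dichotomy K α q)
    (hα : 0 < α) (hq : 0 < q) (hA : 40 * M.A (K + 1) ≤ M.A K) (hA0 : 0 < M.A K)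
    (hΛ : 4 * (M.lag K + 1) ≤ M.Λ) (hvol : M.tvol Finset.univ ≤ (M.Λ : ℝ) ^ (3 * K)) {n : ℕ}
    (hn : 0 < n) :
    ∃ (O : Type) (_ : Fintype O) (D : O → ℝ) (j : O → ℕ) (S : O → List V),
      (∀ o, 0 ≤ D o) ∧ ∑ o, D o / M.Λ ^ j o ≤ 2 ∧
      ∀ (z : Fin n → V) (b : ℕ), b < n → M.Lvl (K + 1) Set.univ (tupleSeg hn z 0 b) →
        ∃ i a, i ≤ a ∧ a ≤ b ∧ min (α / 4) (q / (4 * (K + 1))) ≤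
          ∑ o, if M.KillPair (M.rad (j o)) (S o)
            ((tupleSeg hn z 0 b).p i, (tupleSeg hn z 0 b).p a) then D o else 0 := by
  have hΛ0 : (0 : ℝ) < M.Λ := by exact_mod_cast M.one_le_Λ
  -- Minimax needs a finite index type, so paths are encoded by tuples of `n` vertices with two end
  -- positions.
  let Ω := {ω : (Fin n → V) × Fin n × Fin n // M.Lvl K (Finset.univ : Finset V)
    (tupleSeg hn ω.1 ω.2.1 ω.2.2)}
  let e := Fintype.equivFin Ω
  have hwin : ∀ (z : Fin n → V) (b : ℕ), b < n → M.Lvl (K + 1) Set.univ (tupleSeg hn z 0 b) →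
      ∃ (x : Fin (Fintype.card Ω)) (i : ℕ), M.lag K ≤ i ∧ i < M.Λ / 2 ∧
        M.win (M.Λ ^ K) (tupleSeg hn z 0 b) i =
          tupleSeg hn (e.symm x).1.1 (e.symm x).1.2.1 (e.symm x).1.2.2 ∧
        ∀ y, (M.win (M.Λ ^ K) (tupleSeg hn z 0 b) i).Mem y →
          M.rad K + M.Λ ^ K < M.df (M.src K (tupleSeg hn z 0 b) i) y := by
    intro z b hb hs
    obtain ⟨i, h1, h2, h3, h4⟩ := hs.exists_window hA hA0 hΛ
    have h5 := cut_le_of_far hs.far (show i + 1 ≤ M.Λ / 2 from h2)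
    have h6 : M.cut (M.Λ ^ K) (tupleSeg hn z 0 b) i ≤ M.cut (M.Λ ^ K) (tupleSeg hn z 0 b) (i + 1) :=
      cut_mono (by positivity) (Nat.le_succ i)
    have h7 : M.cut (M.Λ ^ K) (tupleSeg hn z 0 b) (i + 1) < n := lt_of_le_of_lt h5 hb
    refine ⟨e ⟨(z, ⟨_, lt_of_le_of_lt h6 h7⟩, ⟨_, h7⟩), ?_⟩, i, h1, h2, ?_, h4⟩
    · rw [Finset.coe_univ]; exact h3
    · rw [Equiv.symm_apply_apply]
      rfl
  rcases isEmpty_or_nonempty (Fin (Fintype.card Ω)) with hemp | hne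
  · refine ⟨Empty, inferInstance, fun _ => 0, fun _ => 0, fun _ => [], by simp, by simp,
      fun z b hb hs => ?_⟩
    obtain ⟨x, -⟩ := hwin z b hb hs
    exact hemp.elim x
  obtain ⟨κ, hκ, wt, C, J, S, h1, h2, -, h4, -, h6, h7⟩ := hM.mixture hα hq Finset.univ
    (fun x : Fin (Fintype.card Ω) => tupleSeg hn (e.symm x).1.1 (e.symm x).1.2.1 (e.symm x).1.2.2)
    (fun x => (e.symm x).2)
  -- Chains act as operations of level `K`, lists as operations of level `J b`. Multiplying by
  -- Λ^level makes each kind contribute total price 1.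
  refine ⟨κ ⊕ κ, inferInstance, Sum.elim (fun b => wt b * M.Λ ^ K) (fun b => wt b * M.Λ ^ J b),
    Sum.elim (fun _ => K) J, Sum.elim C S, ?_, ?_, fun z b hb hs => ?_⟩
  · rintro (b | b)
    · have := h1 b
      simp only [Sum.elim_inl]
      positivity
    · have := h1 b
      simp only [Sum.elim_inr]
      positivity
  · rw [Fintype.sum_sum_type]
    simp only [Sum.elim_inl, Sum.elim_inr]
    have e1 : ∀ b j, wt b * (M.Λ : ℝ) ^ j / M.Λ ^ j = wt b := fun b j => by field_simp
    simp only [e1, h2]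
    norm_num
  · obtain ⟨x, i, hi1, hi2, hwx, hfar⟩ := hwin z b hb hs
    set s := tupleSeg hn z 0 b with hsdef
    have hcb : M.cut (M.Λ ^ K) s (i + 1) ≤ s.b := cut_le_of_far hs.far hi2
    have hcm : ∀ {i j : ℕ}, i ≤ j → M.cut (M.Λ ^ K) s i ≤ M.cut (M.Λ ^ K) s j :=
      fun hij => cut_mono (by positivity) hij
    have hLw : M.Lvl K (Finset.univ : Finset V) (M.win (M.Λ ^ K) s i) := by
      rw [hwx]; exact (e.symm x).2
    have hnn : ∀ o (p : Prop) [Decidable p], 0 ≤ if p then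
        (Sum.elim (fun b => wt b * (M.Λ : ℝ) ^ K) (fun b => wt b * (M.Λ : ℝ) ^ J b) : κ ⊕ κ → ℝ) o
        else 0 := by
      intro o p _
      split_ifs
      · rcases o with b | b
        · have := h1 b
          simp only [Sum.elim_inl]
          positivity
        · have := h1 b
          simp only [Sum.elim_inr]
          positivity
      · exact le_rfl
    have hvol0 : 0 < M.tvol Finset.univ := lt_of_lt_of_le (by positivity) hLw.pow_le_tvol
    rcases h7 x with h8 | h8
    · refine ⟨M.cut (M.Λ ^ K) s (i - M.lag K), M.cut (M.Λ ^ K) s i, hcm (Nat.sub_le _ _),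
        (hcm (Nat.le_succ i)).trans hcb, ?_⟩
      rw [Fintype.sum_sum_type]
      refine le_trans ?_ (le_add_of_nonneg_right (Finset.sum_nonneg (fun o _ => hnn (Sum.inr o) _)))
      simp only [Sum.elim_inl]
      have h9 := mul_le_mul_of_nonneg_right h8 (show (0 : ℝ) ≤ M.Λ ^ K by positivity)
      refine (min_le_left _ _).trans (le_trans ?_ (h9.trans ?_))
      -- The balance behind the exponent 1/3: the volume bound Λ^(3K) cancels Λ^(2K) from the chain
      -- and Λ^K from its weight.
      · have e2 : α * (M.Λ : ℝ) ^ (2 * K) / M.tvol Finset.univ / 4 * M.Λ ^ K =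
            α / 4 * (M.Λ ^ (3 * K) / M.tvol Finset.univ) := by
          rw [show 3 * K = 2 * K + K by ring, pow_add]; ring
        rw [e2]
        exact le_mul_of_one_le_right (by positivity) ((one_le_div hvol0).2 hvol)
      · rw [Finset.sum_mul]
        refine Finset.sum_le_sum (fun b _ => ?_)
        by_cases ht : (M.win (M.Λ ^ K) s i).Touch (C b)
        · have hk : M.KillPair (M.rad K) (C b) (M.src K s i, s.p (M.cut (M.Λ ^ K) s i)) :=
            KillPair.of_touch hs.far.1 (cut_spec (M := M) _).1 (hcm (Nat.le_succ i)) hcb hLw.len_le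
              (h4 b) hfar ht
          rw [← hwx, if_pos ht]
          exact (if_pos hk).ge
        · rw [← hwx, if_neg ht, zero_mul]
          exact hnn (Sum.inl b) _
    · have h9 : ∃ j, q / (4 * (K + 1)) ≤
          ∑ b, (if J b = j then wt b * (M.Λ : ℝ) ^ j else 0) * M.score K j (S b)
            (M.win (M.Λ ^ K) s i) := by
        by_contra hcon
        push Not at hcon
        have h10 : ∑ b, wt b * (M.Λ ^ J b * M.score K (J b) (S b) (M.win (M.Λ ^ K) s i)) ≤
            ∑ j ∈ Finset.range K, ∑ b, (if J b = j then wt b * (M.Λ : ℝ) ^ j else 0) *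
              M.score K j (S b) (M.win (M.Λ ^ K) s i) := by
          rw [Finset.sum_comm]
          refine Finset.sum_le_sum (fun b _ => ?_)
          have hterm : ∀ j, 0 ≤ (if J b = j then wt b * (M.Λ : ℝ) ^ j else 0) *
              M.score K j (S b) (M.win (M.Λ ^ K) s i) := fun j => by
            have := h1 b
            have := score_nonneg (M := M) K j (S b) (M.win (M.Λ ^ K) s i)
            split_ifs <;> positivity
          rcases h6 b with hJ | hJ
          · refine le_trans ?_ (Finset.single_le_sum (fun j _ => hterm j) (Finset.mem_range.2 hJ))
            rw [if_pos rfl]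
            apply le_of_eq; ring
          · rw [hJ, score_nil, mul_zero, mul_zero]
            exact Finset.sum_nonneg (fun j _ => by rw [score_nil, mul_zero])
        have h11 : ∑ j ∈ Finset.range K, ∑ b, (if J b = j then wt b * (M.Λ : ℝ) ^ j else 0) *
              M.score K j (S b) (M.win (M.Λ ^ K) s i) ≤
            ∑ j ∈ Finset.range K, q / (4 * (K + 1)) :=
          Finset.sum_le_sum (fun j _ => (hcon j).le)
        rw [Finset.sum_const, Finset.card_range, nsmul_eq_mul] at h11
        have h12 : (K : ℝ) * (q / (4 * (K + 1))) < q / 4 := by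
          rw [← mul_div_assoc, div_lt_div_iff₀ (by positivity) (by norm_num)]
          nlinarith
        rw [← hwx] at h8
        linarith
      obtain ⟨j, hj⟩ := h9
      obtain ⟨i', a, b', hh1, hh2, hh3, hh4, hh5, hh6⟩ := exists_window_of_score
        (fun b => if J b = j then wt b * (M.Λ : ℝ) ^ j else 0) S (t := q / (4 * (K + 1)))
        (by positivity) hLw.far hj
      have hbs : b' ≤ s.b := hh4.trans hcb
      have has : s.a ≤ a := (cut_spec (M := M) (R := M.Λ ^ K) (s := s) i).1.trans (hh1.trans hh2)
      refine ⟨i', a, hh2, hh3.trans hbs, ?_⟩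
      rw [Fintype.sum_sum_type]
      refine le_trans ?_ (le_add_of_nonneg_left (Finset.sum_nonneg (fun o _ => hnn (Sum.inl o) _)))
      refine (min_le_right _ _).trans (hh6.trans ?_)
      refine Finset.sum_le_sum (fun b _ => ?_)
      by_cases hJ : J b = j
      · by_cases hK : M.Kill (M.rad j) (S b) ((M.win (M.Λ ^ K) s i).p i')
            ⟨(M.win (M.Λ ^ K) s i).p, a, b'⟩
        · have hk : M.KillPair (M.rad j) (S b) (s.p i', s.p a) :=
            KillPair.of_kill hs.far.1 has hh3 hbs hh5 hK
          subst hJ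
          rw [if_pos rfl, if_pos hK, mul_one]
          exact (if_pos hk).ge
        · rw [if_neg hK, mul_zero]
          exact hnn (Sum.inr b) _
      · rw [if_neg hJ, zero_mul]
        exact hnn (Sum.inr b) _

end Frame

theorem HasWalk.exists_tupleSeg {V : Type*} [Fintype V] {F : V → V → Prop} {w : V → V → ℝ}
    (hw : ∀ x y, 0 ≤ w x y) {s t : V} {L : ℝ} (h : HasWalk F w s t L)
    (hn : 0 < Fintype.card V) :
    ∃ (z : Fin (Fintype.card V) → V) (b : ℕ), b < Fintype.card V ∧
      (tupleSeg hn z 0 b).IsPath F ∧ (tupleSeg hn z 0 b).p 0 = s ∧ (tupleSeg hn z 0 b).p b = t ∧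
      (tupleSeg hn z 0 b).len w ≤ L := by
  obtain ⟨p, b, hp, h0, hb, hl⟩ := h.exists_seg hw
  have hbn : b < Fintype.card V := by
    have h1 : Function.Injective (fun i : Fin (b + 1) => p i) := fun i j hij =>
      Fin.ext (hp.2.2 ⟨Nat.zero_le _, Nat.lt_succ_iff.1 i.2⟩ ⟨Nat.zero_le _, Nat.lt_succ_iff.1 j.2⟩
        hij)
    have h2 := Fintype.card_le_of_injective _ h1
    rw [Fintype.card_fin] at h2
    omega
  set z : Fin (Fintype.card V) → V := fun i => p i with hz
  have hpz : ∀ i ≤ b, (tupleSeg hn z 0 b).p i = p i := by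
    intro i hi
    simp only [tupleSeg, hz]
    congr 1
    omega
  refine ⟨z, b, hbn, ⟨Nat.zero_le _, fun i _ hi => ?_, fun i hi j hj hij => ?_⟩,
    (hpz 0 (Nat.zero_le _)).trans h0, (hpz b le_rfl).trans hb, ?_⟩
  · have hi' : i < b := hi
    rw [hpz i hi'.le, hpz (i + 1) hi']
    exact hp.2.1 i (Nat.zero_le _) hi
  · rw [hpz i hi.2, hpz j hj.2] at hij
    exact hp.2.2 hi hj hij
  · refine le_trans (le_of_eq ?_) hl
    simp only [Seg.len]
    refine Finset.sum_congr rfl (fun i hi => ?_)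
    have hi' : i < b := (Finset.mem_Ico.1 hi).2
    rw [hpz i hi'.le, hpz (i + 1) hi']

namespace Frame
variable {V : Type*} [DecidableEq V] [Fintype V] [Nonempty V] {M : Frame V}

/-- Along surviving edges the index of the ball cannot decrease. The target gets index at most that
of `y`, while the source avoids all balls up to that of `y`, so its index is larger. -/
theorem exists_carve_operation {F : Finset (V × V)} (hF : M.E = EAdj F) {c : V × V → ℝ}
    (hc : ∀ e, 0 ≤ c e) {L : ℕ} (hL : 2 * Fintype.card V < 2 ^ L) (j : ℕ) (hA : 1 ≤ M.A j)
    (S : List V) :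
    ∃ X ⊆ F, ∑ e ∈ X, c e ≤ 4 * (L + 1) * wcost F M.w c / M.Λ ^ j ∧
      ∀ z, M.KillPair (M.rad j) S z → ¬ Relation.ReflTransGen (EAdj (F \ X)) z.1 z.2 := by
  have hΛ0 : (0 : ℝ) < M.Λ := by exact_mod_cast M.one_le_Λ
  have hA' : (1 : ℝ) ≤ M.A j := by exact_mod_cast hA
  have hρ : 0 < M.rad j := by rw [rad]; positivity
  obtain ⟨X, τ, h1, h2, h3, h4, h5⟩ := exists_carve (E := F) M.w_nonneg hc M.dn
    (fun e he z => (M.dn_tri e.1 e.2 z).trans (by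
      have := M.dn_le_w e.1 e.2 (by rw [hF]; exact he)
      linarith)) hρ hL S
  refine ⟨X, h1, h5.trans ?_, ?_⟩
  · have hwc : 0 ≤ wcost F M.w c :=
      Finset.sum_nonneg (fun e _ => mul_nonneg (hc e) (M.w_nonneg _ _))
    have h6 : 2 * (M.Λ : ℝ) ^ j ≤ M.rad j := by
      rw [rad]
      have : (M.Λ : ℝ) ^ j ≤ M.A j * M.Λ ^ j := le_mul_of_one_le_left (by positivity) hA'
      linarith
    calc 8 * ((L : ℝ) + 1) / M.rad j * wcost F M.w c
        ≤ 8 * ((L : ℝ) + 1) / (2 * M.Λ ^ j) * wcost F M.w c := by gcongr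
      _ = _ := by field_simp; ring
  · rintro ⟨x, u⟩ ⟨S₁, y, S₂, rfl, hu, hx⟩ hr
    simp only at hu hx hr
    have hmono : τ x ≤ τ u := by
      clear hu hx
      induction hr with
      | refl => exact le_rfl
      | tail _ h ih =>
        have h := Finset.mem_sdiff.1 h
        exact ih.trans (h2 _ h.1 h.2)
    have hτu : τ u ≤ S₁.length := h4 u S₁.length y (by simp) hu
    have hlt : τ x < (S₁ ++ [y]).length := by
      simp only [List.length_append, List.length_cons, List.length_nil]; omega
    have e : S₁ ++ y :: S₂ = (S₁ ++ [y]) ++ S₂ := by simp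
    have h6 : (S₁ ++ y :: S₂)[τ x]? = some ((S₁ ++ [y])[τ x]) := by
      rw [e, List.getElem?_append_left hlt, List.getElem?_eq_getElem hlt]
    exact absurd (h3 x _ h6) (not_le.2 (hx _ (List.getElem_mem hlt)))

end Frame

/-! ### Phases that stretch distances -/

/-- Lengths of the paths considered at each level, in units of the level. -/
def lengthProfile (K k : ℕ) : ℕ := 8 * 40 ^ (K + 1 - k)

/-- A surviving walk of length at most 8Λ^(K+1) with far ends would, after loop erasure, be a path
of level K+1, since `lengthProfile K (K + 1) = 8`. It therefore contains a pair that the operations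
hit with weight at least t', and the greedy cover includes an operation separating that pair. -/
theorem exists_phase.{u} (K : ℕ) : ∃ Q : ℝ, 0 < Q ∧
    ∀ (V : Type u) [Fintype V] [DecidableEq V] [Nonempty V] (w : V → V → ℝ) (c : V × V → ℝ)
      (vol : V → ℝ) (Λ m : ℕ) (E : Finset (V × V)), (∀ x y, 0 ≤ w x y) → (∀ e, 0 ≤ c e) →
      (∀ x, 0 ≤ vol x) → 4 * (lengthProfile K 0 + 3) ≤ Λ → Fintype.card V < 2 ^ m →
      ∑ v, vol v ≤ (Λ : ℝ) ^ (3 * K) → (∀ e ∈ E, w e.1 e.2 ≤ 1) →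
      (∀ e ∈ E, w e.1 e.2 ≤ vol e.1) →
      ∃ E' ⊆ E, ∑ e ∈ E \ E', c e ≤ Q * Λ ^ 2 * (m + 2) ^ 2 * wcost E w c ∧
        ∀ s t l, HasWalk (EAdj E') w s t l →
          (Λ : ℝ) ^ (K + 1) ≤ tdist (EAdj E) w (Λ ^ (K + 1) + 1) s t → 8 * Λ ^ (K + 1) < l := by
  classical
  obtain ⟨α, κ, hα, hκ, hdich⟩ := Frame.exists_dichotomy.{u} (lengthProfile K) K
    (fun k _ => by simp [lengthProfile])
    (fun k hk => by
      simp only [lengthProfile]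
      rw [show K + 1 - k = (K + 1 - (k + 1)) + 1 by omega, pow_succ]
      omega)
  set t₀ := min (α / 4) (κ / (4 * (K + 1))) with ht₀
  have ht0 : 0 < t₀ := by positivity
  refine ⟨32 + 16 / t₀, by positivity, ?_⟩
  intro V _ _ _ w c vol Λ m E hw hc hv0 hΛ hm hsum hw1 hvol
  have hΛ1 : 1 ≤ Λ := by omega
  have hΛ1' : (1 : ℝ) ≤ Λ := by exact_mod_cast hΛ1
  have hΛ0 : (0 : ℝ) < Λ := by linarith
  have hH : (0 : ℝ) ≤ (Λ : ℝ) ^ (K + 1) := by positivity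
  have hn : 0 < Fintype.card V := Fintype.card_pos
  obtain ⟨F, hFE, hFcost, hFmut⟩ := exists_scc_ldd hw hc hm
    (show (1 : ℝ) ≤ (Λ : ℝ) ^ (K + 1) + 1 by linarith) E
  set M := Frame.ofEdges E F hFE w hw hw1 vol hv0 hvol _ hH hFmut Λ hΛ1 (lengthProfile K) with hM
  have hMΛ : M.Λ = Λ := rfl
  have hD := hdich V M rfl hΛ (pow_le_pow_right₀ hΛ1' (Nat.le_succ K))
  have hAK1 : lengthProfile K (K + 1) = 8 := by simp [lengthProfile]
  have hAK : lengthProfile K K = 320 := by simp [lengthProfile]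
  have hA0K : lengthProfile K K ≤ lengthProfile K 0 := by
    simp only [lengthProfile]
    exact Nat.mul_le_mul_left _ (Nat.pow_le_pow_right (by norm_num) (by omega))
  obtain ⟨O, hO, D, j, S, hD0, hDsum, hops⟩ := hD.exists_operations hα (by rw [hMΛ]; positivity)
    (by change 40 * lengthProfile K (K + 1) ≤ lengthProfile K K; rw [hAK1, hAK])
    (by change 0 < lengthProfile K K; rw [hAK]; norm_num)
    (by
      change 4 * (lengthProfile K K + 2 + 1) ≤ Λ
      omega) hsum hn
  choose X hXF hXcost hXkill using fun o => Frame.exists_carve_operation (M := M) (F := F) rfl hc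
    (L := m + 1) (by rw [pow_succ]; omega) (j o)
    (show 1 ≤ M.A (j o) by change 1 ≤ lengthProfile K (j o); simp only [lengthProfile]; exact Nat.mul_pos (by norm_num) (pow_pos (by norm_num) _)) (S o)
  have hWF : wcost F w c ≤ wcost E w c :=
    Finset.sum_le_sum_of_subset_of_nonneg hFE (fun e _ _ => mul_nonneg (hc e) (hw _ _))
  have hW0 : 0 ≤ wcost E w c := Finset.sum_nonneg (fun e _ => mul_nonneg (hc e) (hw _ _))
  set γ : O → ℝ := fun o => 4 * (m + 2) * wcost E w c / (Λ : ℝ) ^ j o with hγ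
  have hXγ : ∀ o, ∑ e ∈ X o, c e ≤ γ o := by
    intro o
    refine (hXcost o).trans ?_
    have e1 : (((m + 1 : ℕ) : ℝ) + 1) = m + 2 := by push_cast; ring
    rw [e1]
    simp only [hγ]
    rw [hMΛ]
    gcongr
    exact hWF
  set t' := min (α / 4) (κ / (M.Λ : ℝ) ^ 2 / (4 * (K + 1))) with ht'
  have htt : t₀ / Λ ^ 2 ≤ t' := by
    refine le_min ?_ ?_
    · rw [div_le_iff₀ (by positivity)]
      have h1 : t₀ ≤ α / 4 := min_le_left _ _
      have h2 : (1 : ℝ) ≤ Λ ^ 2 := one_le_pow₀ hΛ1'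
      nlinarith
    · calc t₀ / (Λ : ℝ) ^ 2 ≤ κ / (4 * (K + 1)) / Λ ^ 2 := by
            gcongr; exact min_le_right _ _
        _ = _ := by rw [hMΛ]; field_simp
  have ht'0 : 0 < t' := lt_of_lt_of_le (by positivity) htt
  set kp : O → V × V → Prop := fun o z => M.KillPair (M.rad (j o)) (S o) z with hkp
  -- Covering pairs of vertices instead of paths leaves at most n² targets, so the greedy factor is
  -- logarithmic in n.
  set Hs : Finset (V × V) := Finset.univ.filter (fun z => t' ≤ ∑ o, if kp o z then D o else 0)
    with hHs
  obtain ⟨l, hl1, hl2⟩ := exists_cover_list D γ hD0 (fun o => by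
      simp only [hγ]; positivity) kp (B := 8 * (m + 2) * wcost E w c) ht'0 (by
    calc ∑ o, D o * γ o = (∑ o, D o / (Λ : ℝ) ^ j o) * (4 * (m + 2) * wcost E w c) := by
          rw [Finset.sum_mul]
          exact Finset.sum_congr rfl (fun o _ => by simp only [hγ]; ring)
      _ ≤ 2 * (4 * (m + 2) * wcost E w c) := mul_le_mul_of_nonneg_right hDsum (by positivity)
      _ = _ := by ring) Hs.card Hs rfl (fun z hz => by
        have := (Finset.mem_filter.1 hz).2
        convert this)
  set Y : Finset (V × V) := l.toFinset.biUnion X with hY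
  have hYc : ∑ e ∈ Y, c e ≤ (l.map γ).sum := by
    have h1 : ∀ l : List O, ∑ e ∈ l.toFinset.biUnion X, c e ≤ (l.map γ).sum := by
      intro l
      induction l with
      | nil => simp
      | cons o l ih =>
        rw [List.toFinset_cons, Finset.biUnion_insert, List.map_cons, List.sum_cons]
        have h2 : ∑ e ∈ X o ∪ l.toFinset.biUnion X, c e ≤
            ∑ e ∈ X o, c e + ∑ e ∈ l.toFinset.biUnion X, c e := by
          rw [← Finset.sum_union_inter]
          exact le_add_of_nonneg_right (Finset.sum_nonneg (fun e _ => hc e))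
        have := hXγ o
        linarith
    exact h1 l
  have hlog : 1 + Real.log Hs.card ≤ 2 * (m + 2) := by
    rcases Nat.eq_zero_or_pos Hs.card with h0 | h0
    · rw [h0, Nat.cast_zero, Real.log_zero]
      have : (0 : ℝ) ≤ m := Nat.cast_nonneg m
      linarith
    · have h1 : Hs.card ≤ 2 ^ (2 * m) := by
        calc Hs.card ≤ Fintype.card (V × V) := Finset.card_le_univ _
          _ = Fintype.card V * Fintype.card V := Fintype.card_prod _ _
          _ ≤ 2 ^ m * 2 ^ m := Nat.mul_le_mul hm.le hm.le
          _ = 2 ^ (2 * m) := by rw [← pow_add]; congr 1; ring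
      have h2 : Real.log Hs.card ≤ Real.log ((2 : ℝ) ^ (2 * m)) :=
        Real.log_le_log (by exact_mod_cast h0) (by exact_mod_cast h1)
      rw [Real.log_pow] at h2
      have h3 : Real.log 2 ≤ 1 := by
        have := Real.log_le_sub_one_of_pos (show (0 : ℝ) < 2 by norm_num)
        linarith
      push_cast at h2
      have h4 : 2 * (m : ℝ) * Real.log 2 ≤ 2 * m * 1 :=
        mul_le_mul_of_nonneg_left h3 (by positivity)
      linarith
  refine ⟨F \ Y, Finset.sdiff_subset.trans hFE, ?_, ?_⟩
  · have h1 : E \ (F \ Y) ⊆ (E \ F) ∪ Y := by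
      intro e he
      simp only [Finset.mem_union, Finset.mem_sdiff] at he ⊢
      tauto
    have h2 : ∑ e ∈ (E \ F) ∪ Y, c e ≤ ∑ e ∈ E \ F, c e + ∑ e ∈ Y, c e := by
      rw [← Finset.sum_union_inter]
      exact le_add_of_nonneg_right (Finset.sum_nonneg (fun e _ => hc e))
    have h3 := Finset.sum_le_sum_of_subset_of_nonneg h1 (fun e _ _ => hc e)
    have hm0 : (0 : ℝ) ≤ m := Nat.cast_nonneg m
    have h4 : 8 * ((m : ℝ) + 2) * wcost E w c / t' * (1 + Real.log Hs.card) ≤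
        16 / t₀ * Λ ^ 2 * (m + 2) ^ 2 * wcost E w c := by
      calc _ ≤ 8 * ((m : ℝ) + 2) * wcost E w c / (t₀ / Λ ^ 2) * (2 * (m + 2)) := by
            have h5 : 8 * ((m : ℝ) + 2) * wcost E w c / t' ≤
                8 * ((m : ℝ) + 2) * wcost E w c / (t₀ / Λ ^ 2) := by
              gcongr
            refine mul_le_mul h5 hlog ?_ (by positivity)
            have : 0 ≤ Real.log Hs.card := Real.log_natCast_nonneg _
            linarith
        _ = _ := by rw [div_div_eq_mul_div]; ring
    have h5 : (m : ℝ) * (32 * (m + 2)) * wcost E w c ≤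
        32 * Λ ^ 2 * (m + 2) ^ 2 * wcost E w c := by
      refine mul_le_mul_of_nonneg_right ?_ hW0
      have h6 : (1 : ℝ) ≤ Λ ^ 2 := one_le_pow₀ hΛ1'
      calc (m : ℝ) * (32 * (m + 2)) ≤ 32 * 1 * (m + 2) ^ 2 := by nlinarith
        _ ≤ 32 * Λ ^ 2 * (m + 2) ^ 2 := by gcongr
    have e1 : (32 + 16 / t₀) * (Λ : ℝ) ^ 2 * (m + 2) ^ 2 * wcost E w c =
      32 * Λ ^ 2 * (m + 2) ^ 2 * wcost E w c + 16 / t₀ * Λ ^ 2 * (m + 2) ^ 2 * wcost E w c := by ring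
    rw [e1]
    linarith
  · intro s t ℓ hwalk hfar
    by_contra hcon
    push Not at hcon
    obtain ⟨z, b, hb, hp, hp0, hpb, hlen⟩ := hwalk.exists_tupleSeg hw hn
    set sg := tupleSeg hn z 0 b with hsg
    have hpF : sg.IsPath M.E := by
      refine ⟨hp.1, fun i h1 h2 => ?_, hp.2.2⟩
      exact (Finset.mem_sdiff.1 (hp.2.1 i h1 h2)).1
    have hlvl : M.Lvl (K + 1) Set.univ sg := by
      refine ⟨⟨hpF, ?_⟩, fun _ _ _ => Set.mem_univ _, ?_⟩
      · change (Λ : ℝ) ^ (K + 1) ≤ tdist (EAdj E) w (Λ ^ (K + 1) + 1) (sg.p 0) (sg.p b)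
        rw [hp0, hpb]; exact hfar
      · change sg.len w ≤ (lengthProfile K (K + 1) : ℕ) * (Λ : ℝ) ^ (K + 1)
        rw [hAK1]
        exact (hlen.trans hcon).trans (by push_cast; exact le_rfl)
    obtain ⟨i, a, hia, hab, hhit⟩ := hops z b hb hlvl
    obtain ⟨o, hol, hko⟩ := hl1 (sg.p i, sg.p a) (Finset.mem_filter.2 ⟨Finset.mem_univ _, by
      convert hhit⟩)
    refine hXkill o _ hko ?_
    have hsub := (hp.sub (Nat.zero_le i) hia hab).hasWalk (w := w)
    refine Relation.ReflTransGen.mono (fun x y hxy => ?_) _ _ hsub.reach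
    have h1 := Finset.mem_sdiff.1 hxy
    exact Finset.mem_sdiff.2 ⟨h1.1, fun h => h1.2
      (Finset.mem_biUnion.2 ⟨o, List.mem_toFinset.2 hol, h⟩)⟩

/-- If walks in a subgraph between points at distance `D` are much longer than `D`, then all long
distances grow in the subgraph. -/
theorem HasWalk.two_mul_le_of_stretch {V : Type*} {F F' : V → V → Prop} {w : V → V → ℝ}
    (hw : ∀ x y, 0 ≤ w x y) {D : ℝ} (hD : 1 ≤ D) (hF : ∀ x y, F' x y → F x y)
    (hw1 : ∀ x y, F' x y → w x y ≤ 1)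
    (h8 : ∀ s t l, HasWalk F' w s t l → D ≤ tdist F w (D + 1) s t → 8 * D < l)
    {s t : V} {L : ℝ} (hL : ∀ l, HasWalk F w s t l → L ≤ l) (hDL : 4 * D ≤ L) {l : ℝ}
    (h : HasWalk F' w s t l) : 2 * L ≤ l := by
  have hT : 0 ≤ D + 1 := by linarith
  -- The walk is cut whenever it first reaches distance D from the last cut point `o`. Each piece is
  -- longer than 8D, yet spans distance less than D + 1 ≤ 2D, so the whole distance is at most D
  -- plus a quarter of the length.
  have key : ∀ {x t : V} {l : ℝ}, HasWalk F' w x t l → ∀ o l₀, HasWalk F' w o x l₀ →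
      tdist F w (D + 1) o x < D → ∃ L, HasWalk F w o t L ∧ L ≤ D + (l₀ + l) / 4 := by
    intro x t l h
    induction h with
    | nil x =>
      intro o l₀ h₀ hlt
      obtain ⟨L, h1, h2⟩ := exists_walk_of_tdist_lt hlt (by linarith)
      exact ⟨L, h2, by linarith [h₀.nonneg hw]⟩
    | @cons x u t l hxu p ih =>
      intro o l₀ h₀ hlt
      have h1 := h₀.trans (HasWalk.single hxu)
      rcases lt_or_ge (tdist F w (D + 1) o u) D with hu | hu
      · obtain ⟨L, h2, h3⟩ := ih o _ h1 hu
        exact ⟨L, h2, by linarith⟩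
      · have h2 := h8 _ _ _ h1 hu
        have h3 : tdist F w (D + 1) o u < D + 1 := by
          have h4 := tdist_triangle (F := F) (s := o) (t := x) (u := u) hw hT
          have h5 := tdist_le_walk hw hT (HasWalk.single (w := w) (hF _ _ hxu))
          linarith [hw1 _ _ hxu]
        obtain ⟨L₁, h6, h7⟩ := exists_walk_of_tdist_lt h3 le_rfl
        obtain ⟨L₂, h9, h10⟩ := ih u 0 (HasWalk.nil u) (by
          rw [tdist_refl hw hT]; linarith)
        exact ⟨L₁ + L₂, h7.trans h9, by linarith⟩
  obtain ⟨L', h1, h2⟩ := key h s 0 (HasWalk.nil s) (by rw [tdist_refl hw hT]; linarith)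
  have := hL _ h1
  linarith

/-- Each phase doubles all distances that were at least 4Λ^(K+1). After `m` phases they exceed 2^m >
n, whereas a simple path with edges of length at most 1 has length below n. -/
theorem exists_cut.{u} (K : ℕ) : ∃ Q : ℝ, 0 < Q ∧
    ∀ (V : Type u) [Fintype V] [DecidableEq V] [Nonempty V] (w : V → V → ℝ) (c : V × V → ℝ)
      (vol : V → ℝ) (Λ m : ℕ) (E : Finset (V × V)), (∀ x y, 0 ≤ w x y) → (∀ e, 0 ≤ c e) →
      (∀ x, 0 ≤ vol x) → 4 * (lengthProfile K 0 + 3) ≤ Λ → Fintype.card V < 2 ^ m →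
      ∑ v, vol v ≤ (Λ : ℝ) ^ (3 * K) → (∀ e ∈ E, w e.1 e.2 ≤ 1) →
      (∀ e ∈ E, w e.1 e.2 ≤ vol e.1) →
      ∃ E' ⊆ E, ∑ e ∈ E \ E', c e ≤ m * (Q * Λ ^ 2 * (m + 2) ^ 2 * wcost E w c) ∧
        ∀ s t, (∀ L, HasWalk (EAdj E) w s t L → 4 * (Λ : ℝ) ^ (K + 1) ≤ L) →
          ¬ Relation.ReflTransGen (EAdj E') s t := by
  obtain ⟨Q, hQ, hphase⟩ := exists_phase.{u} K
  refine ⟨Q, hQ, ?_⟩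
  intro V _ _ _ w c vol Λ m E hw hc hv0 hΛ hm hsum hw1 hvol
  have hΛ1 : (1 : ℝ) ≤ Λ := by exact_mod_cast (by omega : 1 ≤ Λ)
  have hD : (1 : ℝ) ≤ (Λ : ℝ) ^ (K + 1) := one_le_pow₀ hΛ1
  set B := Q * (Λ : ℝ) ^ 2 * (m + 2) ^ 2 with hB
  have hB0 : 0 ≤ B := by positivity
  have hstep : ∀ i : ℕ, ∃ E' ⊆ E, ∑ e ∈ E \ E', c e ≤ i * (B * wcost E w c) ∧
      ∀ s t, (∀ L, HasWalk (EAdj E) w s t L → 4 * (Λ : ℝ) ^ (K + 1) ≤ L) →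
        ∀ L, HasWalk (EAdj E') w s t L → 2 ^ i * (4 * (Λ : ℝ) ^ (K + 1)) ≤ L := by
    intro i
    induction i with
    | zero => exact ⟨E, subset_rfl, by simp, fun s t h L hL => by simpa using h L hL⟩
    | succ i ih =>
      obtain ⟨E₁, h1, h2, h3⟩ := ih
      obtain ⟨E₂, h4, h5, h6⟩ := hphase V w c vol Λ m E₁ hw hc hv0 hΛ hm hsum
        (fun e he => hw1 e (h1 he)) (fun e he => hvol e (h1 he))
      refine ⟨E₂, h4.trans h1, ?_, fun s t h L hL => ?_⟩
      · have h7 : E \ E₂ ⊆ (E \ E₁) ∪ (E₁ \ E₂) := by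
          intro e he
          simp only [Finset.mem_union, Finset.mem_sdiff] at he ⊢
          tauto
        have h8 : ∑ e ∈ (E \ E₁) ∪ (E₁ \ E₂), c e ≤ ∑ e ∈ E \ E₁, c e + ∑ e ∈ E₁ \ E₂, c e := by
          rw [← Finset.sum_union_inter]
          exact le_add_of_nonneg_right (Finset.sum_nonneg (fun e _ => hc e))
        have h9 := Finset.sum_le_sum_of_subset_of_nonneg h7 (fun e _ _ => hc e)
        have h10 : wcost E₁ w c ≤ wcost E w c :=
          Finset.sum_le_sum_of_subset_of_nonneg h1 (fun e _ _ => mul_nonneg (hc e) (hw _ _))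
        have h11 := mul_le_mul_of_nonneg_left h10 hB0
        push_cast
        linarith
      · rw [pow_succ, mul_comm (2 ^ i), mul_assoc]
        have h2i : (1 : ℝ) ≤ 2 ^ i := one_le_pow₀ (by norm_num)
        exact hL.two_mul_le_of_stretch hw hD (fun x y hxy => h4 hxy)
          (fun x y hxy => hw1 _ (h1 (h4 hxy))) h6 (h3 s t h)
          (le_mul_of_one_le_left (by positivity) h2i)
  obtain ⟨E', h1, h2, h3⟩ := hstep m
  refine ⟨E', h1, h2, fun s t h hr => ?_⟩
  obtain ⟨L, hL⟩ := HasWalk.exists_of_reach (w := w) hr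
  obtain ⟨z, b, hb, hp, hp0, hpb, hlen⟩ := hL.exists_tupleSeg hw Fintype.card_pos
  set sg := tupleSeg Fintype.card_pos z 0 b with hsg
  have h4 : HasWalk (EAdj E') w s t (sg.len w) := by
    rw [← hp0, ← hpb]; exact hp.hasWalk
  have h5 := h3 s t h _ h4
  have h6 : sg.len w ≤ b := by
    have h7 : sg.len w ≤ ∑ _i ∈ Finset.Ico 0 b, (1 : ℝ) :=
      Finset.sum_le_sum (fun i hi => hw1 _ (h1 (hp.2.1 i (Finset.mem_Ico.1 hi).1
        (Finset.mem_Ico.1 hi).2)))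
    simpa using h7
  have h8 : (b : ℝ) < 2 ^ m := by exact_mod_cast hb.trans hm
  have h9 : (2 : ℝ) ^ m ≤ 2 ^ m * (4 * (Λ : ℝ) ^ (K + 1)) :=
    le_mul_of_one_le_right (by positivity) (by linarith)
  linarith

theorem HasWalk.div_const {V : Type*} {F : V → V → Prop} {w : V → V → ℝ} {s t : V} {L u : ℝ}
    (hu : u ≠ 0) (h : HasWalk F (fun x y => w x y / u) s t L) : HasWalk F w s t (u * L) := by
  induction h with
  | nil s => simpa using HasWalk.nil s
  | @cons s x t L h _ ih =>
    have := ih.cons h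
    rwa [show u * (w s x / u + L) = w s x + u * L by field_simp]

/-! ### From cuts for every cost to random cuts -/

/-- For all edge costs, some edge set of cost at most `ℓ / Δ` times the weighted cost of all edges
cuts all pairs at distance at least `Δ`. -/
def HasCut {V : Type*} [DecidableEq V] (E : Finset (V × V)) (w : V → V → ℝ) (Δ ℓ : ℝ) : Prop :=
  ∀ c : V × V → ℝ, (∀ e, 0 ≤ c e) → ∃ E' ⊆ E, ∑ e ∈ E \ E', c e ≤ ℓ / Δ * wcost E w c ∧
    ∀ s t, (∀ L, HasWalk (EAdj E) w s t L → Δ ≤ L) → ¬ Relation.ReflTransGen (EAdj E') s t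

/-- Lengths are rescaled by u = Δ/(4Λ^(K+1)). Deleting an edge longer than u costs at most its own
share c·w/u, which accounts for the summand 1. -/
theorem exists_hasCut.{u} (K : ℕ) : ∃ Q : ℝ, 0 < Q ∧
    ∀ (V : Type u) [Fintype V] [DecidableEq V] [Nonempty V] (w : V → V → ℝ)
      (vol : V → ℝ) (Λ m : ℕ) (E : Finset (V × V)) (Δ : ℝ), (∀ x y, 0 ≤ w x y) →
      (∀ x, 0 ≤ vol x) → 4 * (lengthProfile K 0 + 3) ≤ Λ → Fintype.card V < 2 ^ m →
      ∑ v, vol v ≤ (Λ : ℝ) ^ (3 * K) → 0 < Δ →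
      (∀ e ∈ E, w e.1 e.2 ≤ Δ / (4 * Λ ^ (K + 1)) →
        w e.1 e.2 / (Δ / (4 * Λ ^ (K + 1))) ≤ vol e.1) →
      HasCut E w Δ (4 * Λ ^ (K + 1) * (1 + m * (Q * Λ ^ 2 * (m + 2) ^ 2))) := by
  obtain ⟨Q, hQ, hcut⟩ := exists_cut.{u} K
  refine ⟨Q, hQ, ?_⟩
  intro V _ _ _ w vol Λ m E Δ hw hv0 hΛ hm hsum hΔ hvol c hc
  have hΛ1 : (1 : ℝ) ≤ Λ := by exact_mod_cast (by omega : 1 ≤ Λ)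
  set u := Δ / (4 * (Λ : ℝ) ^ (K + 1)) with hu
  have hu0 : 0 < u := by positivity
  set E₁ := E.filter (fun e => w e.1 e.2 ≤ u) with hE₁
  have hE₁E : E₁ ⊆ E := Finset.filter_subset _ _
  obtain ⟨E', h1, h2, h3⟩ := hcut V (fun x y => w x y / u) c vol Λ m E₁
    (fun x y => div_nonneg (hw x y) hu0.le) hc hv0 hΛ hm hsum
    (fun e he => (div_le_one hu0).2 (Finset.mem_filter.1 he).2)
    (fun e he => hvol e (hE₁E he) (Finset.mem_filter.1 he).2)
  refine ⟨E', h1.trans hE₁E, ?_, fun s t h => h3 s t (fun L hL => ?_)⟩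
  · have hW : ∀ F ⊆ E, wcost F (fun x y => w x y / u) c ≤ wcost E w c / u := by
      intro F hF
      rw [wcost, wcost, Finset.sum_div]
      refine (Finset.sum_le_sum_of_subset_of_nonneg hF (fun e _ _ => mul_nonneg (hc e)
        (div_nonneg (hw _ _) hu0.le))).trans (le_of_eq ?_)
      exact Finset.sum_congr rfl (fun e _ => by ring)
    have h4 : E \ E' ⊆ (E \ E₁) ∪ (E₁ \ E') := by
      intro e he
      simp only [Finset.mem_union, Finset.mem_sdiff] at he ⊢
      tauto
    have h5 : ∑ e ∈ (E \ E₁) ∪ (E₁ \ E'), c e ≤ ∑ e ∈ E \ E₁, c e + ∑ e ∈ E₁ \ E', c e := by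
      rw [← Finset.sum_union_inter]
      exact le_add_of_nonneg_right (Finset.sum_nonneg (fun e _ => hc e))
    have h6 := Finset.sum_le_sum_of_subset_of_nonneg h4 (fun e _ _ => hc e)
    have h7 : ∑ e ∈ E \ E₁, c e ≤ wcost (E \ E₁) (fun x y => w x y / u) c := by
      refine Finset.sum_le_sum (fun e he => le_mul_of_one_le_right (hc e) ?_)
      rw [le_div_iff₀ hu0, one_mul]
      have := Finset.mem_sdiff.1 he
      by_contra hcon
      exact this.2 (Finset.mem_filter.2 ⟨this.1, (not_le.1 hcon).le⟩)
    have h8 := hW (E \ E₁) Finset.sdiff_subset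
    have h9 := mul_le_mul_of_nonneg_left (hW E₁ hE₁E)
      (show (0 : ℝ) ≤ m * (Q * Λ ^ 2 * (m + 2) ^ 2) by positivity)
    have e1 : 4 * (Λ : ℝ) ^ (K + 1) * (1 + m * (Q * Λ ^ 2 * (m + 2) ^ 2)) / Δ * wcost E w c =
        wcost E w c / u + m * (Q * Λ ^ 2 * (m + 2) ^ 2) * (wcost E w c / u) := by
      rw [hu, div_div_eq_mul_div]; ring
    rw [e1]
    linarith
  · have h4 := h _ ((hL.div_const hu0.ne').mono (fun x y hxy => hE₁E hxy))
    have h5 : Δ = u * (4 * (Λ : ℝ) ^ (K + 1)) := by rw [hu]; field_simp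
    rw [h5] at h4
    exact le_of_mul_le_mul_left h4 hu0

/-- Some distribution over cuts of all pairs at distance at least `Δ` contains every edge with
probability proportional to its weight. -/
theorem HasCut.exists_pmf {V : Type*} [DecidableEq V] {E : Finset (V × V)}
    {w : V → V → ℝ} {Δ ℓ : ℝ} (h : HasCut E w Δ ℓ) (hw : ∀ x y, 0 ≤ w x y) (hΔ : 0 < Δ)
    (hℓ : 0 < ℓ) :
    ∃ μ : PMF (Set (V × V)), (∀ X ∈ μ.support, X ⊆ E ∧
        ∀ s t, (∀ L, HasWalk (EAdj E) w s t L → Δ ≤ L) →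
          ¬ Relation.ReflTransGen (fun x y => (x, y) ∈ E ∧ (x, y) ∉ X) s t) ∧
      ∀ e ∈ E, (μ.toOuterMeasure {X | e ∈ X}).toReal ≤ w e.1 e.2 / Δ * (2 * ℓ) := by
  classical
  have hcut : ∀ c : V × V → ℝ, (∀ e, 0 ≤ c e) → ∃ X ⊆ E, ∑ e ∈ X, c e ≤ ℓ / Δ * wcost E w c ∧
      ∀ s t, (∀ L, HasWalk (EAdj E) w s t L → Δ ≤ L) →
          ¬ Relation.ReflTransGen (fun x y => (x, y) ∈ E ∧ (x, y) ∉ X) s t := by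
    intro c hc
    obtain ⟨E', h1, h2, h3⟩ := h c hc
    refine ⟨E \ E', Finset.sdiff_subset, h2, fun s t hst hr => h3 s t hst ?_⟩
    refine Relation.ReflTransGen.mono (fun x y hxy => ?_) _ _ hr
    by_contra hcon
    exact hxy.2 (Finset.mem_sdiff.2 ⟨hxy.1, hcon⟩)
  let Adm := {X : Finset (V × V) // X ⊆ E ∧ (∀ e ∈ X, 0 < w e.1 e.2) ∧
    ∀ s t, (∀ L, HasWalk (EAdj E) w s t L → Δ ≤ L) →
          ¬ Relation.ReflTransGen (fun x y => (x, y) ∈ E ∧ (x, y) ∉ X) s t}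
  let ι := {e : E // 0 < w e.1.1 e.1.2}
  have hreply : ∀ q : V × V → ℝ, (∀ e, 0 ≤ q e) →
      (∑ e ∈ E, if 0 < w e.1 e.2 then q e else 0) ≤ 1 →
      ∃ X : Adm, ∑ e ∈ X.1, q e * (Δ / (w e.1 e.2 * ℓ)) ≤ 1 := by
    intro q hq hq1
    -- Edges of weight 0 must never be cut. They contribute nothing to `wcost`, but cutting one
    -- would cost 2, above the budget 1.
    set c : V × V → ℝ := fun e => if 0 < w e.1 e.2 then q e * (Δ / (w e.1 e.2 * ℓ)) else 2 with hc
    have hc0 : ∀ e, 0 ≤ c e := by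
      intro e
      simp only [hc]
      split_ifs with h0
      · have := hq e; positivity
      · norm_num
    obtain ⟨X, h1, h2, h3⟩ := hcut c hc0
    have h4 : wcost E w c = Δ / ℓ * ∑ e ∈ E, if 0 < w e.1 e.2 then q e else 0 := by
      rw [wcost, Finset.mul_sum]
      refine Finset.sum_congr rfl (fun e _ => ?_)
      simp only [hc]
      split_ifs with h0
      · field_simp
      · rw [le_antisymm (not_lt.1 h0) (hw _ _)]; simp
    have h5 : ∑ e ∈ X, c e ≤ 1 := by
      refine h2.trans ?_
      rw [h4, ← mul_assoc, div_mul_div_cancel₀ hΔ.ne', div_self hℓ.ne', one_mul]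
      exact hq1
    have h6 : ∀ e ∈ X, 0 < w e.1 e.2 := by
      intro e he
      by_contra hcon
      have := (Finset.single_le_sum (fun e _ => hc0 e) he).trans h5
      simp only [hc, if_neg hcon] at this
      norm_num at this
    refine ⟨⟨X, h1, h6, h3⟩, le_trans (le_of_eq ?_) h5⟩
    exact Finset.sum_congr rfl (fun e he => by simp only [hc, if_pos (h6 e he)])
  obtain ⟨X₀, -⟩ := hreply (fun _ => 0) (fun _ => le_rfl) (by simp)
  have : Nonempty Adm := ⟨X₀⟩
  -- The payoff 2 minus normalised cut is at least 1 for a good reply. Above 1/2 in the mixture, it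
  -- bounds each normalised cut probability by 3/2, hence by 2.
  obtain ⟨κ, _, wt, z, hwt0, hwt1, hpay⟩ := exists_mixture_of_forall_reply (α := Adm) (ι := ι)
    (fun X e => 2 - if e.1.1 ∈ X.1 then Δ / (w e.1.1.1 e.1.1.2 * ℓ) else 0) (fun p hp hp1 => by
      set q : V × V → ℝ := fun e => if h : ∃ h : e ∈ E, 0 < w e.1 e.2 then p ⟨⟨e, h.1⟩, h.2⟩ else 0
        with hq
      have hpq : ∀ i : ι, q i.1.1 = p i := fun i => by
        simp only [hq]
        rw [dif_pos ⟨i.1.2, i.2⟩]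
      have hsum : ∀ f : V × V → ℝ, ∑ i : ι, f i.1.1 =
          ∑ e ∈ E, if 0 < w e.1 e.2 then f e else 0 := by
        intro f
        rw [← Finset.sum_coe_sort E, ← Finset.sum_filter]
        exact (Finset.sum_subtype (Finset.univ.filter (fun e : E => 0 < w e.1.1 e.1.2))
          (by simp) (fun e : E => f e.1)).symm
      obtain ⟨X, hX⟩ := hreply q (fun e => by
        simp only [hq]; split_ifs
        · exact hp _
        · exact le_rfl) (by rw [← hsum]; simp only [hpq]; exact hp1.le)
      refine ⟨X, ?_⟩
      have e1 : ∑ i : ι, p i * (2 - if i.1.1 ∈ X.1 then Δ / (w i.1.1.1 i.1.1.2 * ℓ) else 0) =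
          2 - ∑ i : ι, q i.1.1 * (if i.1.1 ∈ X.1 then Δ / (w i.1.1.1 i.1.1.2 * ℓ) else 0) := by
        simp only [mul_sub, Finset.sum_sub_distrib, ← Finset.sum_mul, hp1, one_mul, hpq]
      have e2 : ∑ i : ι, q i.1.1 * (if i.1.1 ∈ X.1 then Δ / (w i.1.1.1 i.1.1.2 * ℓ) else 0) =
          ∑ e ∈ X.1, q e * (Δ / (w e.1 e.2 * ℓ)) := by
        rw [hsum (fun e => q e * (if e ∈ X.1 then Δ / (w e.1 e.2 * ℓ) else 0))]
        rw [← Finset.sum_subset X.2.1 (fun e _ he => by simp [he])]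
        exact Finset.sum_congr rfl (fun e he => by rw [if_pos (X.2.2.1 e he), if_pos he])
      rw [e1, e2]
      linarith)
  have hsum1 : ∑ k, ENNReal.ofReal (wt k) = 1 := by
    rw [← ENNReal.ofReal_sum_of_nonneg (fun k _ => hwt0 k), hwt1, ENNReal.ofReal_one]
  refine ⟨(PMF.ofFintype _ hsum1).map (fun k => ((z k).1 : Set (V × V))), ?_, ?_⟩
  · intro X hX
    obtain ⟨k, -, rfl⟩ := (PMF.mem_support_map_iff _ _ _).1 hX
    exact ⟨Finset.coe_subset.2 (z k).2.1, fun s t hst => by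
      simpa using (z k).2.2.2 s t hst⟩
  · intro e he
    have h1 : (((PMF.ofFintype _ hsum1).map (fun k => ((z k).1 : Set (V × V)))).toOuterMeasure
        {X | e ∈ X}).toReal = ∑ k, if e ∈ (z k).1 then wt k else 0 := by
      rw [PMF.toOuterMeasure_map_apply, PMF.toOuterMeasure_apply_fintype,
        ENNReal.toReal_sum (fun k _ => by
          rw [Set.indicator_apply]; split_ifs <;> simp)]
      refine Finset.sum_congr rfl (fun k _ => ?_)
      rw [Set.indicator_apply]
      simp only [Set.mem_preimage, Set.mem_ofPred_eq, Finset.mem_coe, PMF.ofFintype_apply]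
      split_ifs
      · exact ENNReal.toReal_ofReal (hwt0 k)
      · rfl
    rw [h1]
    rcases (hw e.1 e.2).lt_or_eq with hpos | h0
    · have h2 := hpay ⟨⟨e, he⟩, hpos⟩
      have h3 : ∑ k, wt k * (2 - if e ∈ (z k).1 then Δ / (w e.1 e.2 * ℓ) else 0) =
          2 - (∑ k, if e ∈ (z k).1 then wt k else 0) * (Δ / (w e.1 e.2 * ℓ)) := by
        simp only [mul_sub, Finset.sum_sub_distrib, ← Finset.sum_mul, hwt1, one_mul, mul_ite,
          mul_zero]
        rw [Finset.sum_mul]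
        simp only [ite_mul, zero_mul]
      rw [h3] at h2
      have h4 : (∑ k, if e ∈ (z k).1 then wt k else 0) * (Δ / (w e.1 e.2 * ℓ)) ≤ 2 := by linarith
      rw [← mul_div_assoc, div_le_iff₀ (by positivity)] at h4
      rw [div_mul_eq_mul_div, le_div_iff₀ hΔ]
      linarith
    · rw [← h0, zero_div, zero_mul]
      refine (Finset.sum_eq_zero (fun k _ => ?_)).le
      rw [if_neg]
      intro hek
      have := (z k).2.2.1 e hek
      linarith

/-! ### Translation to digraphs, and the two trivial decompositions -/

namespace Digraph
variable {V : Type*} {G : Digraph V} {w : V × V → ℝ≥0} {s t : V}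

theorem DiWalk.hasWalk {X : Set (V × V)} (p : G.DiWalk s t) (h : ∀ e ∈ p.edges, e ∉ X) :
    HasWalk (fun x y => G.Adj x y ∧ (x, y) ∉ X) (fun x y => (w (x, y) : ℝ)) s t (p.weight w) := by
  induction p with
  | nil => simpa [weight, edges] using HasWalk.nil _
  | @cons u v t huv p ih =>
    simp only [edges, List.mem_cons, forall_eq_or_imp] at h
    have := HasWalk.cons (F := fun x y => G.Adj x y ∧ (x, y) ∉ X) ⟨huv, h.1⟩ (ih h.2)
    simpa [weight, edges] using this

theorem exists_diWalk {L : ℝ} (h : HasWalk G.Adj (fun x y => (w (x, y) : ℝ)) s t L) :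
    ∃ p : G.DiWalk s t, (p.weight w : ℝ) = L := by
  induction h with
  | nil => exact ⟨.nil _, by simp [DiWalk.weight, DiWalk.edges]⟩
  | cons h _ ih =>
    obtain ⟨p, hp⟩ := ih
    exact ⟨.cons h p, by rw [← hp]; simp [DiWalk.weight, DiWalk.edges]⟩

theorem le_of_le_wdist {Δ : ℝ≥0} (h : (Δ : ℝ≥0∞) ≤ G.wdist w s t) {L : ℝ}
    (hL : HasWalk G.Adj (fun x y => (w (x, y) : ℝ)) s t L) : (Δ : ℝ) ≤ L := by
  obtain ⟨p, rfl⟩ := exists_diWalk hL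
  have := h.trans (iInf_le _ p)
  exact_mod_cast this

theorem isCutBy_of_not_hasWalk {X : Set (V × V)}
    (h : ∀ L, ¬ HasWalk (fun x y => G.Adj x y ∧ (x, y) ∉ X) (fun x y => (w (x, y) : ℝ)) s t L) :
    G.IsCutBy X s t := by
  intro p
  by_contra hcon
  push Not at hcon
  exact h _ (p.hasWalk hcon)

theorem toOuterMeasure_toReal_le_one {α : Type*} (μ : PMF α) (S : Set α) :
    (μ.toOuterMeasure S).toReal ≤ 1 := by
  have h : μ.toOuterMeasure S ≤ 1 :=
    (μ.toOuterMeasure.mono (Set.subset_univ S)).trans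
      ((μ.toOuterMeasure_apply_eq_one_iff Set.univ).2 (Set.subset_univ _)).le
  exact ENNReal.toReal_le_of_le_ofReal zero_le_one (by simpa using h)

theorem isWeakLDD_pure {X : Set (V × V)} {Δ : ℝ≥0} {loss : ℝ} (hX : X ⊆ G.edges)
    (hcut : ∀ s t : V, (Δ : ℝ≥0∞) ≤ G.wdist w s t → G.IsCutBy X s t) (hloss : 0 ≤ loss)
    (h : ∀ e ∈ X, (Δ : ℝ) ≤ w e * loss) (hΔ : 0 < Δ) : G.IsWeakLDD w Δ (PMF.pure X) loss := by
  refine ⟨fun Y hY => ?_, fun Y hY => ?_, fun e _ => ?_⟩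
  · rw [PMF.support_pure, Set.mem_singleton_iff] at hY
    rwa [hY]
  · rw [PMF.support_pure, Set.mem_singleton_iff] at hY
    rwa [hY]
  · by_cases he : e ∈ X
    · refine (toOuterMeasure_toReal_le_one _ _).trans ?_
      rw [div_mul_eq_mul_div, le_div_iff₀ (by exact_mod_cast hΔ), one_mul]
      exact h e he
    · rw [PMF.toOuterMeasure_pure_apply, if_neg (by simpa using he)]
      simp only [ENNReal.toReal_zero]
      positivity

variable [Fintype V]

/-- If the total weight is below `Δ`, nothing has to be cut. -/
theorem isWeakLDD_of_totalWeight_lt {Δ : ℝ≥0} {loss : ℝ} (hΔ : 0 < Δ)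
    (h : G.totalWeight w < Δ) (hloss : 0 ≤ loss) : G.IsWeakLDD w Δ (PMF.pure ∅) loss := by
  classical
  refine isWeakLDD_pure (Set.empty_subset _) (fun s t hst => ?_) hloss (by simp) hΔ
  refine isCutBy_of_not_hasWalk (w := w) (fun L hL => ?_)
  obtain ⟨z, b, hb, hp, hp0, hpb, hlen⟩ := hL.exists_tupleSeg (fun _ _ => NNReal.coe_nonneg _)
    (Fintype.card_pos_iff.2 ⟨s⟩)
  set sg := tupleSeg _ z 0 b with hsg
  have h1 := hp.hasWalk (w := fun x y => (w (x, y) : ℝ))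
  have h2 : HasWalk G.Adj (fun x y => (w (x, y) : ℝ)) s t (sg.len fun x y => (w (x, y) : ℝ)) := by
    rw [← hp0, ← hpb]
    exact h1.mono (fun x y hxy => hxy.1)
  have h3 := le_of_le_wdist hst h2
  have h4 : (sg.len fun x y => (w (x, y) : ℝ)) ≤ G.totalWeight w := by
    rw [totalWeight, NNReal.coe_sum]
    have hinj : Set.InjOn (fun i => (sg.p i, sg.p (i + 1))) (Finset.Ico 0 b) := by
      intro i hi j hj hij
      rw [Finset.coe_Ico] at hi hj
      exact hp.2.2 ⟨Nat.zero_le _, hi.2.le⟩ ⟨Nat.zero_le _, hj.2.le⟩ (Prod.ext_iff.1 hij).1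
    have h5 := Finset.sum_image (f := fun e => (w e : ℝ)) hinj
    refine h5.symm.le.trans (Finset.sum_le_sum_of_subset_of_nonneg ?_
      (fun _ _ _ => NNReal.coe_nonneg _))
    intro e he
    obtain ⟨i, hi, rfl⟩ := Finset.mem_image.1 he
    exact Finset.mem_filter.2 ⟨Finset.mem_univ _, (hp.2.1 i (Finset.mem_Ico.1 hi).1
      (Finset.mem_Ico.1 hi).2).1⟩
  have h6 : (G.totalWeight w : ℝ) < Δ := by exact_mod_cast h
  linarith

/-- Cutting all edges of weight at least `Δ / n`. -/
theorem isWeakLDD_heavy {Δ : ℝ≥0} {loss : ℝ} (hΔ : 0 < Δ)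
    (hloss : (Fintype.card V : ℝ) ≤ loss) :
    G.IsWeakLDD w Δ (PMF.pure {e | e ∈ G.edges ∧ (Δ : ℝ) ≤ w e * Fintype.card V}) loss := by
  have hn0 : (0 : ℝ) ≤ Fintype.card V := Nat.cast_nonneg _
  refine isWeakLDD_pure (fun e he => he.1) (fun s t hst => ?_) (hn0.trans hloss)
    (fun e he => he.2.trans (mul_le_mul_of_nonneg_left hloss (NNReal.coe_nonneg _))) hΔ
  refine isCutBy_of_not_hasWalk (w := w) (fun L hL => ?_)
  have hn : 0 < Fintype.card V := Fintype.card_pos_iff.2 ⟨s⟩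
  obtain ⟨z, b, hb, hp, hp0, hpb, hlen⟩ := hL.exists_tupleSeg (fun _ _ => NNReal.coe_nonneg _) hn
  set sg := tupleSeg hn z 0 b with hsg
  have h2 : HasWalk G.Adj (fun x y => (w (x, y) : ℝ)) s t (sg.len fun x y => (w (x, y) : ℝ)) := by
    rw [← hp0, ← hpb]
    exact hp.hasWalk.mono (fun x y hxy => hxy.1)
  have h3 := le_of_le_wdist hst h2
  have hn' : (0 : ℝ) < Fintype.card V := by exact_mod_cast hn
  have hΔ' : (0 : ℝ) < Δ := by exact_mod_cast hΔ
  have h4 : (sg.len fun x y => (w (x, y) : ℝ)) ≤ b * (Δ / Fintype.card V) := by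
    have h5 : (sg.len fun x y => (w (x, y) : ℝ)) ≤
        ∑ _i ∈ Finset.Ico 0 b, ((Δ : ℝ) / Fintype.card V) := by
      refine Finset.sum_le_sum (fun i hi => ?_)
      have h6 := hp.2.1 i (Finset.mem_Ico.1 hi).1 (Finset.mem_Ico.1 hi).2
      rw [le_div_iff₀ hn']
      by_contra hcon
      exact h6.2 ⟨h6.1, (not_le.1 hcon).le⟩
    simpa using h5
  have h7 : (b : ℝ) < Fintype.card V := by exact_mod_cast hb
  have h8 : b * ((Δ : ℝ) / Fintype.card V) < Fintype.card V * (Δ / Fintype.card V) :=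
    mul_lt_mul_of_pos_right h7 (by positivity)
  rw [mul_div_cancel₀ _ hn'.ne'] at h8
  linarith

open Classical in
theorem exists_isWeakLDD_of_hasCut {Δ : ℝ≥0} {loss ℓ : ℝ} (hΔ : 0 < Δ) (hℓ : 0 < ℓ)
    (hloss : 2 * ℓ ≤ loss)
    (h : HasCut (Finset.univ.filter (fun e => e ∈ G.edges)) (fun x y => (w (x, y) : ℝ)) Δ ℓ) :
    ∃ μ, G.IsWeakLDD w Δ μ loss := by
  have hE : ∀ x y, EAdj (Finset.univ.filter (fun e => e ∈ G.edges)) x y ↔ G.Adj x y := by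
    intro x y
    simp only [EAdj, Finset.mem_filter, Finset.mem_univ, true_and]
    rfl
  obtain ⟨μ, h1, h2⟩ := h.exists_pmf (fun _ _ => NNReal.coe_nonneg _) (by exact_mod_cast hΔ) hℓ
  refine ⟨μ, fun X hX e he => by simpa using (h1 X hX).1 he, fun X hX s t hst => ?_,
    fun e he => ?_⟩
  · refine isCutBy_of_not_hasWalk (w := w) (fun L hL => (h1 X hX).2 s t (fun L hL => ?_) ?_)
    · exact le_of_le_wdist hst (hL.mono (fun x y => (hE x y).1))
    · exact Relation.ReflTransGen.mono (fun x y hxy => ⟨(hE x y).2 hxy.1, hxy.2⟩) _ _ hL.reach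
  · exact (h2 e (by simpa using he)).trans (mul_le_mul_of_nonneg_left hloss (by positivity))

end Digraph

/-! ### Choice of parameters and the limit -/

theorem eventually_mul_log_add_three_pow_le (C : ℝ) {δ : ℝ} (hC : 0 < C) (hδ : 0 < δ) :
    ∀ᶠ n : ℕ in Filter.atTop, C * ((Nat.log 2 n : ℝ) + 3) ^ 3 ≤ (n : ℝ) ^ δ := by
  have h1 := (isLittleO_log_rpow_rpow_atTop 3 hδ).bound
    (show (0 : ℝ) < 1 / (C * 125) by positivity)
  have h2 := tendsto_natCast_atTop_atTop.eventually h1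
  have h3 := (Real.tendsto_log_atTop.comp (tendsto_natCast_atTop_atTop (R := ℝ))).eventually
    (Filter.eventually_ge_atTop 1)
  filter_upwards [h2, h3] with n hn hlog
  simp only [Function.comp] at hlog
  have h4 : (Nat.log 2 n : ℝ) ≤ 2 * Real.log n := by
    have h5 := Real.natLog_le_logb n 2
    have h6 : (1 / 2 : ℝ) < Real.log 2 := by linarith [Real.log_two_gt_d9]
    refine h5.trans ?_
    rw [Real.logb, Nat.cast_ofNat, div_le_iff₀ (by linarith)]
    nlinarith
  have h7 : ((Nat.log 2 n : ℝ) + 3) ^ 3 ≤ (5 * Real.log n) ^ 3 := by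
    gcongr
    linarith
  have h8 : Real.log n ^ 3 ≤ 1 / (C * 125) * (n : ℝ) ^ δ := by
    have h9 : (0 : ℝ) ≤ (n : ℝ) ^ δ := by positivity
    rw [Real.norm_of_nonneg h9, Real.norm_eq_abs] at hn
    refine le_trans (le_trans (le_of_eq ?_) (le_abs_self _)) hn
    exact_mod_cast (Real.rpow_natCast (Real.log n) 3).symm
  calc C * ((Nat.log 2 n : ℝ) + 3) ^ 3 ≤ C * (5 * Real.log n) ^ 3 := by gcongr
    _ = C * 125 * Real.log n ^ 3 := by ring
    _ ≤ C * 125 * (1 / (C * 125) * (n : ℝ) ^ δ) := by gcongr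
    _ = (n : ℝ) ^ δ := by field_simp

/-- Rounding x up to the integer Λ₀ + ⌈x⌉ ≤ (Λ₀ + 2)x costs only a constant, since `k` is fixed. The
exponent k + 4 is K + 1 for the scale plus 2 for the phases, with K = k + 1. -/
theorem exists_scale (k Λ₀ : ℕ) {Q : ℝ} (hQ : 0 < Q) : ∃ C : ℝ, 0 < C ∧
    ∀ (x : ℝ) (m : ℕ), 1 ≤ x → ∃ Λ : ℕ, Λ₀ ≤ Λ ∧ x ≤ Λ ∧
      2 * (4 * (Λ : ℝ) ^ (k + 1 + 1) * (1 + m * (Q * Λ ^ 2 * (m + 2) ^ 2))) ≤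
        x ^ (k + 4) * (C * (m + 2) ^ 3) := by
  refine ⟨8 * (1 + Q) * (Λ₀ + 2) ^ (k + 4), by positivity, fun x m hx => ?_⟩
  have hx1 : x ≤ ((Λ₀ + ⌈x⌉₊ : ℕ) : ℝ) := by
    push_cast
    have h1 := Nat.le_ceil x
    have h2 : (0 : ℝ) ≤ Λ₀ := Nat.cast_nonneg _
    linarith
  have hx2 : ((Λ₀ + ⌈x⌉₊ : ℕ) : ℝ) ≤ (Λ₀ + 2) * x := by
    push_cast
    have h1 := Nat.ceil_lt_add_one (zero_le_one.trans hx)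
    have h2 : (0 : ℝ) ≤ Λ₀ := Nat.cast_nonneg _
    nlinarith
  refine ⟨Λ₀ + ⌈x⌉₊, Nat.le_add_right _ _, hx1, ?_⟩
  set Λ := Λ₀ + ⌈x⌉₊
  have hΛ : (1 : ℝ) ≤ Λ := hx.trans hx1
  have hm : (0 : ℝ) ≤ m := Nat.cast_nonneg m
  have h3 : 1 + (m : ℝ) * (Q * Λ ^ 2 * (m + 2) ^ 2) ≤ (1 + Q) * Λ ^ 2 * (m + 2) ^ 3 := by
    have h4 : (1 : ℝ) ≤ Λ ^ 2 * (m + 2) ^ 3 := by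
      have h5 : (1 : ℝ) ≤ Λ ^ 2 := one_le_pow₀ hΛ
      have h6 : (1 : ℝ) ≤ (m + 2) ^ 3 := one_le_pow₀ (by linarith)
      nlinarith
    have h7 : (m : ℝ) * (Q * Λ ^ 2 * (m + 2) ^ 2) ≤ (m + 2) * (Q * Λ ^ 2 * (m + 2) ^ 2) := by
      gcongr
      linarith
    calc _ ≤ Λ ^ 2 * (m + 2) ^ 3 + (m + 2) * (Q * Λ ^ 2 * (m + 2) ^ 2) := add_le_add h4 h7
      _ = _ := by ring
  calc 2 * (4 * (Λ : ℝ) ^ (k + 1 + 1) * (1 + m * (Q * Λ ^ 2 * (m + 2) ^ 2)))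
      ≤ 2 * (4 * (Λ : ℝ) ^ (k + 1 + 1) * ((1 + Q) * Λ ^ 2 * (m + 2) ^ 3)) := by gcongr
    _ = (Λ : ℝ) ^ (k + 4) * (8 * (1 + Q) * (m + 2) ^ 3) := by ring
    _ ≤ ((Λ₀ + 2) * x) ^ (k + 4) * (8 * (1 + Q) * (m + 2) ^ 3) := by gcongr
    _ = _ := by rw [mul_pow]; ring

/-- The exponent is (k+4)/(3(k+1)) = 1/3 + 1/(k+1). -/
theorem rpow_pow_le_rpow_third {x ε : ℝ} (hx : 1 ≤ x) (k : ℕ) (hk : 8 ≤ ε * k) (hε : 0 < ε) :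
    (x ^ (1 / (3 * ((k : ℝ) + 1)))) ^ (k + 4) ≤ x ^ ((1 : ℝ) / 3 + ε / 2) := by
  rw [← Real.rpow_natCast, ← Real.rpow_mul (by linarith)]
  refine Real.rpow_le_rpow_of_exponent_le hx ?_
  have hk0 : (0 : ℝ) ≤ k := Nat.cast_nonneg k
  push_cast
  rw [div_mul_eq_mul_div, div_le_iff₀ (by positivity)]
  nlinarith

/-- The exponent is (k+4)/(2k+1) = 1/2 + 7/(2(2k+1)), and the excess power of W is absorbed by x. -/
theorem rpow_pow_le_mul_rpow_half {W x ε : ℝ} (hW : 1 ≤ W) (hWx : W ≤ x) (k : ℕ)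
    (hk : 8 ≤ ε * k) (hk3 : 3 ≤ k) :
    ((4 * W) ^ (1 / (2 * (k : ℝ) + 1))) ^ (k + 4) ≤
      W ^ ((1 : ℝ) / 2) * (8 * x ^ (ε / 2)) := by
  have hk3' : (3 : ℝ) ≤ k := by exact_mod_cast hk3
  set δ : ℝ := 7 / (2 * (2 * k + 1)) with hδ
  have hδ0 : 0 ≤ δ := by positivity
  have hδ1 : δ ≤ 1 := by
    rw [hδ, div_le_one (by positivity)]; linarith
  have hδε : δ ≤ ε / 2 := by
    have : 0 < ε := by
      by_contra hcon
      nlinarith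
    rw [hδ, div_le_iff₀ (by positivity)]
    nlinarith
  have e1 : 1 / (2 * (k : ℝ) + 1) * ((k + 4 : ℕ) : ℝ) = 1 / 2 + δ := by
    rw [hδ]; push_cast; field_simp; ring
  rw [← Real.rpow_natCast, ← Real.rpow_mul (by linarith), e1,
    Real.rpow_add (by linarith), Real.mul_rpow (by norm_num) (by linarith),
    Real.mul_rpow (by norm_num) (by linarith)]
  have e2 : (4 : ℝ) ^ ((1 : ℝ) / 2) = 2 := by
    rw [← Real.sqrt_eq_rpow, show (4 : ℝ) = 2 ^ 2 by norm_num]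
    exact Real.sqrt_sq (by norm_num)
  have h1 : (4 : ℝ) ^ δ ≤ 4 := by
    simpa using Real.rpow_le_rpow_of_exponent_le (show (1 : ℝ) ≤ 4 by norm_num) hδ1
  have h2 : W ^ δ ≤ x ^ (ε / 2) :=
    (Real.rpow_le_rpow (by linarith) hWx hδ0).trans
      (Real.rpow_le_rpow_of_exponent_le (hW.trans hWx) hδε)
  rw [e2]
  calc 2 * W ^ ((1 : ℝ) / 2) * (4 ^ δ * W ^ δ) ≤ 2 * W ^ ((1 : ℝ) / 2) * (4 * x ^ (ε / 2)) := by
        gcongr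
    _ = _ := by ring

/-- The loss on graphs with `n` nodes and relative total weight `W`. -/
noncomputable def weakLoss (n : ℕ) (W ε : ℝ) : ℝ :=
  min ((n : ℝ) ^ ((1 : ℝ) / 3 + ε)) (W ^ ((1 : ℝ) / 2) * (n : ℝ) ^ ε)

/-- All weighted digraphs with `n` nodes have weak low-diameter decompositions with loss
`weakLoss n W ε`. -/
def HasWeakLDD.{u} (n : ℕ) (ε : ℝ) : Prop :=
  ∀ (V : Type u) [Fintype V] (G : Digraph V) (w : V × V → ℝ≥0) (Δ : ℝ≥0), Fintype.card V = n →
    0 < Δ → ∃ μ : PMF (Set (V × V)),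
      G.IsWeakLDD w Δ μ (weakLoss n ((G.totalWeight w : ℝ) / (Δ : ℝ)) ε)

theorem weakLoss_nonneg (n : ℕ) {W : ℝ} (hW : 0 ≤ W) (ε : ℝ) : 0 ≤ weakLoss n W ε :=
  le_min (by positivity) (by positivity)

theorem HasWeakLDD.of_one_le.{u} {n : ℕ} {ε : ℝ}
    (h : ∀ (V : Type u) [Fintype V] (G : Digraph V) (w : V × V → ℝ≥0) (Δ : ℝ≥0),
      Fintype.card V = n → 0 < Δ → Nonempty V → 1 ≤ (G.totalWeight w : ℝ) / Δ →
      ∃ μ : PMF (Set (V × V)),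
        G.IsWeakLDD w Δ μ (weakLoss n ((G.totalWeight w : ℝ) / (Δ : ℝ)) ε)) :
    HasWeakLDD.{u} n ε := by
  intro V _ G w Δ hn hΔ
  have hΔ' : (0 : ℝ) < Δ := by exact_mod_cast hΔ
  rcases lt_or_ge (G.totalWeight w) Δ with hlt | hge
  · exact ⟨_, Digraph.isWeakLDD_of_totalWeight_lt hΔ hlt (weakLoss_nonneg _ (by positivity) _)⟩
  · rcases isEmpty_or_nonempty V with hV | hV
    · exfalso
      rw [Digraph.totalWeight, Finset.univ_eq_empty, Finset.filter_empty, Finset.sum_empty] at hge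
      exact absurd hΔ (not_lt.2 hge)
    · exact h V G w Δ hn hΔ hV ((one_le_div hΔ').2 (by exact_mod_cast hge))

/-- The fallback for small `n`: for W ≥ 1 the loss with ε = 1 is at least n, and cutting all edges
of weight at least Δ/n achieves n. -/
theorem hasWeakLDD_one.{u} (n : ℕ) : HasWeakLDD.{u} n 1 := by
  refine HasWeakLDD.of_one_le (fun V _ G w Δ hn hΔ hV hW => ?_)
  refine ⟨_, Digraph.isWeakLDD_heavy hΔ ?_⟩
  have hn1 : (1 : ℝ) ≤ n := by
    rw [← hn]; exact_mod_cast Fintype.card_pos (α := V)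
  rw [hn, weakLoss, Real.rpow_one]
  refine le_min ?_ ?_
  · calc (n : ℝ) = (n : ℝ) ^ (1 : ℝ) := (Real.rpow_one _).symm
      _ ≤ _ := Real.rpow_le_rpow_of_exponent_le hn1 (by norm_num)
  · exact le_mul_of_one_le_left (by linarith) (Real.one_le_rpow hW (by norm_num))

theorem le_of_rpow_half_mul_le {n W ε : ℝ} (hn : 1 ≤ n) (hW : 0 ≤ W)
    (h : W ^ ((1 : ℝ) / 2) * n ^ ε ≤ n ^ ((1 : ℝ) / 3 + ε)) : W ≤ n := by
  have hn0 : 0 < n := by linarith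
  rw [Real.rpow_add hn0] at h
  have h1 := le_of_mul_le_mul_right h (Real.rpow_pos_of_pos hn0 ε)
  have h2 : W ^ ((1 : ℝ) / 2) ≤ n ^ ((1 : ℝ) / 2) :=
    h1.trans (Real.rpow_le_rpow_of_exponent_le hn (by norm_num))
  exact (Real.rpow_le_rpow_iff hW hn0.le (by norm_num)).1 h2

/-- Whichever term attains the minimum decides the volume: 1 per vertex for the exponent 1/3, the
outgoing weight in units for the exponent 1/2. In the second case the minimum itself forces W ≤ n,
so small powers of W are small powers of n. -/
theorem eventually_hasWeakLDD.{u} {ε : ℝ} (hε : 0 < ε) :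
    ∀ᶠ n in Filter.atTop, HasWeakLDD.{u} n ε := by
  classical
  obtain ⟨k₀, hk₀⟩ := exists_nat_ge (8 / ε)
  set k := k₀ + 3 with hk
  have hk8 : 8 ≤ ε * k := by
    rw [div_le_iff₀ hε] at hk₀
    rw [hk]; push_cast; nlinarith
  obtain ⟨Q, hQ, hcut⟩ := exists_hasCut.{u} (k + 1)
  obtain ⟨C, hC, hscale⟩ := exists_scale k (4 * (lengthProfile (k + 1) 0 + 3)) hQ
  filter_upwards [eventually_mul_log_add_three_pow_le (8 * C) (by positivity) (half_pos hε)]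
    with n hlog
  refine HasWeakLDD.of_one_le (fun V _ G w Δ hn hΔ hV hW => ?_)
  have hΔ' : (0 : ℝ) < Δ := by exact_mod_cast hΔ
  set W := (G.totalWeight w : ℝ) / Δ with hWdef
  set E : Finset (V × V) := Finset.univ.filter (fun e => e ∈ G.edges) with hE
  have hn1 : (1 : ℝ) ≤ n := by
    rw [← hn]; exact_mod_cast Fintype.card_pos (α := V)
  set m := Nat.log 2 n + 1 with hm
  have hnm : Fintype.card V < 2 ^ m := by
    rw [hn]; exact Nat.lt_pow_succ_log_self (by norm_num) n
  have hm2 : (m : ℝ) + 2 = Nat.log 2 n + 3 := by rw [hm]; push_cast; ring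
  have hCm : C * ((m : ℝ) + 2) ^ 3 ≤ (n : ℝ) ^ (ε / 2) / 8 := by
    rw [hm2]; linarith
  have hnε : (0 : ℝ) < (n : ℝ) ^ (ε / 2) := by positivity
  have hw0 : ∀ x y, (0 : ℝ) ≤ (fun x y => (w (x, y) : ℝ)) x y := fun _ _ => NNReal.coe_nonneg _
  have hℓ : ∀ Λ : ℕ, 4 * (lengthProfile (k + 1) 0 + 3) ≤ Λ →
      (0 : ℝ) < 4 * (Λ : ℝ) ^ (k + 1 + 1) * (1 + m * (Q * Λ ^ 2 * (m + 2) ^ 2)) := by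
    intro Λ hΛ
    have : (0 : ℝ) < Λ := by exact_mod_cast (by omega : 0 < Λ)
    positivity
  rcases le_total ((n : ℝ) ^ ((1 : ℝ) / 3 + ε)) (W ^ ((1 : ℝ) / 2) * (n : ℝ) ^ ε) with hmin | hmin
  · rw [weakLoss, min_eq_left hmin]
    obtain ⟨Λ, hΛ₀, hxΛ, hΛ⟩ := hscale ((n : ℝ) ^ (1 / (3 * ((k : ℝ) + 1)))) m
      (Real.one_le_rpow hn1 (by positivity))
    have hΛ0 : (0 : ℝ) < Λ := by exact_mod_cast (by omega : 0 < Λ)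
    refine Digraph.exists_isWeakLDD_of_hasCut hΔ (hℓ Λ hΛ₀) ?_
      (hcut V (fun x y => (w (x, y) : ℝ)) (fun _ => 1) Λ m E Δ hw0 (fun _ => zero_le_one) hΛ₀ hnm
        ?_ hΔ' (fun e _ he => (div_le_one (by positivity)).2 he))
    · refine hΛ.trans ?_
      calc _ ≤ (n : ℝ) ^ ((1 : ℝ) / 3 + ε / 2) * (n : ℝ) ^ (ε / 2) := by
            refine mul_le_mul (rpow_pow_le_rpow_third hn1 k hk8 hε) (by linarith)
              (by positivity) (by positivity)
        _ = _ := by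
            rw [← Real.rpow_add (by linarith)]
            congr 1
            ring
    · rw [Finset.sum_const, Finset.card_univ, hn, nsmul_eq_mul, mul_one]
      have h1 : ((n : ℝ) ^ (1 / (3 * ((k : ℝ) + 1)))) ^ (3 * (k + 1)) = n := by
        rw [← Real.rpow_natCast, ← Real.rpow_mul (by linarith)]
        push_cast
        rw [one_div_mul_cancel (by positivity), Real.rpow_one]
      calc (n : ℝ) = ((n : ℝ) ^ (1 / (3 * ((k : ℝ) + 1)))) ^ (3 * (k + 1)) := h1.symm
        _ ≤ _ := pow_le_pow_left₀ (by positivity) hxΛ _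
  · have hWn := le_of_rpow_half_mul_le hn1 (by linarith) hmin
    rw [weakLoss, min_eq_right hmin]
    obtain ⟨Λ, hΛ₀, hxΛ, hΛ⟩ := hscale ((4 * W) ^ (1 / (2 * (k : ℝ) + 1))) m
      (Real.one_le_rpow (by linarith) (by positivity))
    have hΛ0 : (0 : ℝ) < Λ := by exact_mod_cast (by omega : 0 < Λ)
    set u : ℝ := Δ / (4 * (Λ : ℝ) ^ (k + 1 + 1)) with hu
    have hu0 : 0 < u := by positivity
    have hwu : ∀ e : V × V, 0 ≤ (w e : ℝ) / u := fun e => by positivity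
    refine Digraph.exists_isWeakLDD_of_hasCut hΔ (hℓ Λ hΛ₀) ?_
      (hcut V (fun x y => (w (x, y) : ℝ))
        (fun v => ∑ e ∈ E.filter (fun e => e.1 = v), (w e : ℝ) / u) Λ m E Δ hw0
        (fun _ => Finset.sum_nonneg (fun e _ => hwu e)) hΛ₀ hnm ?_ hΔ' (fun e he _ => ?_))
    · refine hΛ.trans ?_
      calc _ ≤ W ^ ((1 : ℝ) / 2) * (8 * (n : ℝ) ^ (ε / 2)) * ((n : ℝ) ^ (ε / 2) / 8) := by
            refine mul_le_mul (rpow_pow_le_mul_rpow_half hW hWn k hk8 (by omega)) hCm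
              (by positivity) (by positivity)
        _ = W ^ ((1 : ℝ) / 2) * ((n : ℝ) ^ (ε / 2) * (n : ℝ) ^ (ε / 2)) := by ring
        _ = _ := by rw [← Real.rpow_add (by linarith), add_halves]
    · have h1 : ((4 * W) ^ (1 / (2 * (k : ℝ) + 1))) ^ (2 * k + 1) = 4 * W := by
        rw [← Real.rpow_natCast, ← Real.rpow_mul (by linarith)]
        push_cast
        rw [one_div_mul_cancel (by positivity), Real.rpow_one]
      -- The total volume is 4WΛ^(k+2), and 3(k+1) = (2k+1) + (k+2).
      have h2 : 4 * W ≤ (Λ : ℝ) ^ (2 * k + 1) := by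
        rw [← h1]
        exact pow_le_pow_left₀ (Real.rpow_nonneg (by linarith) _) hxΛ _
      have h3 : ∑ v, ∑ e ∈ E.filter (fun e => e.1 = v), (w e : ℝ) / u =
          4 * W * (Λ : ℝ) ^ (k + 1 + 1) := by
        rw [Finset.sum_fiberwise E (fun e => e.1) (fun e => (w e : ℝ) / u), ← Finset.sum_div,
          hWdef, Digraph.totalWeight, NNReal.coe_sum, hu, hE]
        field_simp
      calc _ = 4 * W * (Λ : ℝ) ^ (k + 1 + 1) := h3
        _ ≤ (Λ : ℝ) ^ (2 * k + 1) * (Λ : ℝ) ^ (k + 1 + 1) := by gcongr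
        _ = _ := by rw [← pow_add]; congr 1; ring
    · exact Finset.single_le_sum (f := fun e : V × V => (w e : ℝ) / u) (fun e _ => hwu e)
        (Finset.mem_filter.2 ⟨he, rfl⟩)

theorem mainTheorem9 :
    ∃ ε : ℕ → ℝ, Filter.Tendsto ε Filter.atTop (𝓝 0) ∧
      ∀ (V : Type*) [Fintype V] (G : Digraph V) (w : V × V → ℝ≥0) (Δ : ℝ≥0), 0 < Δ →
        ∃ μ : PMF (Set (V × V)),
          G.IsWeakLDD w Δ μ
            (min ((Fintype.card V : ℝ) ^ ((1 : ℝ) / 3 + ε (Fintype.card V)))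
              (((G.totalWeight w : ℝ) / (Δ : ℝ)) ^ ((1 : ℝ) / 2) *
                (Fintype.card V : ℝ) ^ ε (Fintype.card V))) := by
  -- ε(n) is an admissible exponent within 1/(n+1) of the infimum, which need not be attained. Every
  -- fixed δ > 0 is eventually admissible, so ε(n) tends to 0.
  set S : ℕ → Set ℝ := fun n => {ε | 0 < ε ∧ HasWeakLDD n ε} with hS
  have hbdd : ∀ n, BddBelow (S n) := fun n => ⟨0, fun ε hε => hε.1.le⟩
  have hex : ∀ n, ∃ ε ∈ S n, ε < sInf (S n) + 1 / ((n : ℝ) + 1) := fun n =>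
    exists_lt_of_csInf_lt ⟨1, one_pos, hasWeakLDD_one n⟩
      (lt_add_of_pos_right _ Nat.one_div_pos_of_nat)
  choose ε hε hεlt using hex
  refine ⟨ε, ?_, fun V _ G w Δ hΔ => (hε _).2 V G w Δ rfl hΔ⟩
  rw [Metric.tendsto_atTop']
  intro δ hδ
  have h1 := eventually_hasWeakLDD (half_pos hδ)
  have h2 := (tendsto_one_div_add_atTop_nhds_zero_nat (𝕜 := ℝ)).eventually_lt_const (half_pos hδ)
  obtain ⟨N, hN⟩ := Filter.eventually_atTop.1 (h1.and h2)
  refine ⟨N, fun n hn => ?_⟩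
  obtain ⟨h3, h4⟩ := hN n hn.le
  have h5 := csInf_le (hbdd n) (show δ / 2 ∈ S n from ⟨half_pos hδ, h3⟩)
  have h6 := hεlt n
  rw [Real.dist_eq, sub_zero, abs_of_pos (hε n).1]
  linarith
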